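/- **Network.** Let $n$ be an even perfect square. Let $S^2$ be the sphere of area $1$ in $\mathbb R^3$ (radius $1/(2\sqrt\pi)$) with geodesic distance $d$. There are $n$ nodes, split into $n/2$ source-destination pairs uniformly at random. Each node $i$ has a great circle $G_i$ whose pole is uniformly distributed on $S^2$, independently over the nodes. On each great circle $\sqrt n$ equidistant lattice points, numbered consecutively $0,\dots,\sqrt n-1$, are placed arbitrarily (by any measurable rule, which may depend on the great circles of all nodes, on the pairing and on the points $z_{ij}$ below). Time is slotted. Independently of everything else, each node performs a natural random walk on its lattice points: it starts at a uniformly distributed lattice point and in each slot it stays, moves one step forward, or moves one step backward, with probability $1/3$ each. For each pair $i\ne j$ one of the two points of $G_i\cap G_j$ is selected by a fair coin and called $z_{ij}=z_{ji}$. Nodes $i\neq j$ are *neighbors* in a slot if each of them is at its lattice point closest to $z_{ij}$. Fix $\Delta>0$. A transmission from $v$ to $w$ is *successful* if $d(k,w)\ge(1+\Delta)\,d(v,w)$ for every other simultaneously transmitting node $k$. Fix constants $0<\kappa_1<2\pi(2+\Delta)<\kappa_2$; the configuration is *typical* if for all $i\ne j$ the number of great circles $G_k$ that meet the disk of radius $(2+\Delta)\sqrt{\pi/n}$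 around $z_{ij}$ lies in $[\kappa_1\sqrt n,\kappa_2\sqrt n]$. **Scheme $\Pi$** (parameters $0<p<1$, $0<\alpha<1$). If the configuration is not typical, the sources transmit directly to their destinations in round-robin order, one source per slot. If it is typical, every slot has two sub-slots. *Sub-slot A:* each source is active with probability $p$; an active source with at least one neighbor chooses, with probability $\alpha$, one of its neighbors uniformly at random and transmits a packet for its destination to it (sources always have packets). If the transmission is successful, the packet leaves the source; it has then reached its destination if the chosen neighbor is the destination, and otherwise it joins the end of the queue that the chosen neighbor keeps for this source-destination pair. If the transmission is not successful, nothing happens. *Sub-slot B:* each node is active with probability $p$; an active node with at least one neighbor that is a destination chooses one such neighbor uniformly at random and, if its queue for the corresponding pair is non-empty, transmits the first packet of this queue to it; if the transmission is successful, the packet has reached its destination and leaves the queue. All queues are empty at the start, and all activity decisions and choices are independent. **Delay.** The delay of a packet is the number of slots from the one in which it leaves its source up to the one in which it reaches its destination, both included ($\infty$ if it never does). For pair $i$ let $\bar D^i=\limsup_{k\to\infty}\frac1k\sum_{j=1}^k D^i(j)$, where $D^i(j)$ is the delay of the $j$-th packet that leaves its source. The delay of the scheme is $D_\Pi(n)=E\big[\frac2n\sum_{i=1}^{n/2}\bar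 D^i\big]$, the expectation being over the network, the motion and the scheme. **Theorem.** For all $\Delta>0$, $0<p<1$ and $0<\kappa_1<2\pi(2+\Delta)<\kappa_2$ there is $\alpha_0>0$ such that for every $\alpha\in(0,1)$ with $\alpha<\alpha_0$ the delay of Scheme $\Pi$ is $\Theta(n\log n)$: there are constants $c,C>0$ and $N$, which depend only on $\Delta,p,\kappa_1,\kappa_2,\alpha$, such that $$c\,n\log n\le D_\Pi(n)\le C\,n\log n$$ for all even perfect squares $n>N$ and all placements of the lattice points. -/

import Mathlib

open MeasureTheory ProbabilityTheory Filter
open scoped ENNReal unitInterval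

namespace GreatCircleNetwork

noncomputable section

/-! ### The sphere of unit area

A point of the sphere is represented by its direction, a unit vector of `ℝ³`; the point itself is
`sphereRadius` times this vector. -/

abbrev E3 : Type := EuclideanSpace ℝ (Fin 3)

abbrev Dir : Type := Metric.sphere (0 : E3) 1

/-- Radius of the sphere of area one. -/
def sphereRadius : ℝ := 1 / (2 * √Real.pi)

/-- Distance on the sphere of unit area between the points with directions `x` and `y`. -/
def geoDist (x y : E3) : ℝ := sphereRadius * InnerProductGeometry.angle x y

/-- The uniform distribution on the sphere. -/
def poleLaw : Measure Dir :=
  ((volume : Measure E3).toSphere Set.univ)⁻¹ • (volume : Measure E3).toSphere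

/-- The point with direction `x` lies on the great circle with pole `u`. -/
def OnGreatCircle (u : Dir) (x : E3) : Prop := ‖x‖ = 1 ∧ inner ℝ x (u : E3) = 0

/-! ### Configurations -/

/-- The part of the network that does not change with time: the poles of the great circles of the
nodes, the permutation that forms the source-destination pairs, and the fair coins that select
the intersection points of the great circles. -/
abbrev Config (n : ℕ) : Type :=
  (Fin n → Dir) × Equiv.Perm (Fin n) × (Fin n → Fin n → Bool)

instance permMeasurableSpace (n : ℕ) : MeasurableSpace (Equiv.Perm (Fin n)) := ⊤

namespace Config

variable {n : ℕ} (c : Config n)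

def pole (i : Fin n) : Dir := c.1 i

/-- The source of the `i`-th source-destination pair. -/
def src (i : Fin (n / 2)) : Fin n := c.2.1 ⟨2 * i, by have := i.2; omega⟩

/-- The destination of the `i`-th source-destination pair. -/
def dst (i : Fin (n / 2)) : Fin n := c.2.1 ⟨2 * i + 1, by have := i.2; omega⟩

/-- The coin of the unordered pair `{i, j}`. -/
def zCoin (i j : Fin n) : Bool := c.2.2 (min i j) (max i j)

/-- The normal direction of the plane of two poles: one of the two points in which the great
circles of `i` and `j` intersect; the other one is its negative. It is symmetric in `i`, `j`. -/
def crossDir (i j : Fin n) : E3 :=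
  let w : E3 := WithLp.toLp 2
    (crossProduct (c.pole (min i j) : E3).ofLp (c.pole (max i j) : E3).ofLp)
  ‖w‖⁻¹ • w

/-- The selected intersection point `z_{ij}` of the great circles of `i` and `j`. -/
def z (i j : Fin n) : E3 := if c.zCoin i j then c.crossDir i j else -c.crossDir i j

/-- The great circle of `k` passes through the disk of radius `(2 + Δ) √(π / n)` around
`z_{ij}`. -/
def PassesThrough (Δ : ℝ) (k i j : Fin n) : Prop :=
  ∃ x : E3, OnGreatCircle (c.pole k) x ∧ geoDist x (c.z i j) ≤ (2 + Δ) * √(Real.pi / n)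

open Classical in
/-- Typical configurations, with the constants `κ₁`, `κ₂` of the `Θ(√n)` in their definition. -/
def Typical (Δ κ₁ κ₂ : ℝ) : Prop :=
  ∀ i j : Fin n, i ≠ j →
    κ₁ * √n ≤ ((Finset.univ.filter fun k => c.PassesThrough Δ k i j).card : ℝ) ∧
    ((Finset.univ.filter fun k => c.PassesThrough Δ k i j).card : ℝ) ≤ κ₂ * √n

end Config

/-! ### Lattice points -/

/-- A rule that places the lattice points: for every node it gives an orthonormal frame `(e, f)`
of the plane of its great circle, where `e` is the lattice point number zero and `f` fixes the
direction in which the lattice points are numbered. The rule may depend on the configuration. -/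
abbrev Placement (n : ℕ) : Type := Config n → Fin n → E3 × E3

structure Placement.Valid {n : ℕ} (pl : Placement n) : Prop where
  measurable : Measurable pl
  fst_mem : ∀ c v, OnGreatCircle (c.pole v) (pl c v).1
  snd_mem : ∀ c v, OnGreatCircle (c.pole v) (pl c v).2
  orthogonal : ∀ c v, inner ℝ (pl c v).1 (pl c v).2 = 0

/-- The lattice point number `a` of node `v`; the `m` lattice points are equidistant. -/
def latticePoint {n : ℕ} (m : ℕ) (pl : Placement n) (c : Config n) (v : Fin n) (a : ZMod m) : E3 :=
  Real.cos (2 * Real.pi * a.val / m) • (pl c v).1 + Real.sin (2 * Real.pi * a.val / m) • (pl c v).2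

/-- The number of the lattice point of `v` that is closest to the point `x` (some fixed choice
of it in case of a tie). -/
def nearestSite {n : ℕ} (m : ℕ) [NeZero m] (pl : Placement n) (c : Config n) (v : Fin n) (x : E3) :
    ZMod m :=
  (Finset.exists_min_image Finset.univ (fun a : ZMod m => geoDist (latticePoint m pl c v a) x)
    Finset.univ_nonempty).choose

/-! ### Probability space -/

/-- A rule that chooses an element of every non-empty set of nodes. When it is uniformly
distributed, the element chosen from a given set is uniformly distributed on this set. -/
abbrev Choice (n : ℕ) : Type :=
  (s : {s : Finset (Fin n) // s.Nonempty}) → {v : Fin n // v ∈ s.1}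

instance choiceNonempty (n : ℕ) : Nonempty (Choice n) :=
  ⟨fun s => ⟨s.2.choose, s.2.choose_spec⟩⟩

/-- The randomness of one node in one time-slot: its next step; its activity, its decision to
transmit when it is active, and its choice of a relay in sub-slot A; its activity and its choice
of a destination in sub-slot B. -/
abbrev NodeCoins (n : ℕ) : Type := Fin 3 × (Bool × Bool × Choice n) × (Bool × Choice n)

namespace NodeCoins

variable {n : ℕ} (x : NodeCoins n)

/-- The step of the natural random walk. -/
def step (m : ℕ) : ZMod m := ![0, 1, -1] x.1

def activeA : Bool := x.2.1.1

def sendA : Bool := x.2.1.2.1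

def choiceA : Choice n := x.2.1.2.2

def activeB : Bool := x.2.2.1

def choiceB : Choice n := x.2.2.2

end NodeCoins

/-- The uniform distribution on a finite type. -/
def unif (α : Type) [Fintype α] [Nonempty α] [MeasurableSpace α] : Measure α :=
  (PMF.uniformOfFintype α).toMeasure

instance unifIsProbabilityMeasure (α : Type) [Fintype α] [Nonempty α] [MeasurableSpace α] :
    IsProbabilityMeasure (unif α) := by
  unfold unif; infer_instance

def configLaw (n : ℕ) : Measure (Config n) :=
  (Measure.pi fun _ => poleLaw).prod
    ((unif (Equiv.Perm (Fin n))).prod (Measure.pi fun _ => Measure.pi fun _ => unif Bool))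

/-- All components are independent; a node is active with probability `p`, and an active source
decides to transmit with probability `α`. -/
def nodeCoinsLaw (n : ℕ) (p α : I) : Measure (NodeCoins n) :=
  (unif (Fin 3)).prod
    (((bernoulliMeasure true false p).prod ((bernoulliMeasure true false α).prod
        (unif (Choice n)))).prod
      ((bernoulliMeasure true false p).prod (unif (Choice n))))

instance nodeCoinsLawIsProbabilityMeasure (n : ℕ) (p α : I) :
    IsProbabilityMeasure (nodeCoinsLaw n p α) := by
  unfold nodeCoinsLaw; infer_instance

/-- An outcome: configuration, initial positions, and the coins of all time-slots and nodes. -/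
abbrev Outcome (n m : ℕ) : Type := Config n × (Fin n → ZMod m) × (ℕ → Fin n → NodeCoins n)

/-- The joint law: configuration, uniform initial positions and all coins are independent. -/
def law (n m : ℕ) [NeZero m] (p α : I) : Measure (Outcome n m) :=
  (configLaw n).prod ((Measure.pi fun _ => unif (ZMod m)).prod
    (Measure.infinitePi fun _ : ℕ => Measure.pi fun _ : Fin n => nodeCoinsLaw n p α))

/-! ### Motion of the nodes -/

/-- The number of the lattice point at which node `v` is in time-slot `t`. -/
def position {n m : ℕ} (ω : Outcome n m) : ℕ → Fin n → ZMod m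
  | 0, v => ω.2.1 v
  | t + 1, v => position ω t v + (ω.2.2 t v).step m

/-- Nodes `v` and `w` are neighbors in time-slot `t`. -/
def IsNeighbor {n m : ℕ} [NeZero m] (pl : Placement n) (ω : Outcome n m) (t : ℕ) (v w : Fin n) :
    Prop :=
  v ≠ w ∧ position ω t v = nearestSite m pl ω.1 v (ω.1.z v w) ∧
    position ω t w = nearestSite m pl ω.1 w (ω.1.z v w)

/-- What a communication policy sees of an outcome. -/
structure Realization (n : ℕ) where
  src : Fin (n / 2) → Fin n
  dst : Fin (n / 2) → Fin n
  /-- The point of the sphere at which a node is in a time-slot. -/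
  point : ℕ → Fin n → E3
  nbrs : ℕ → Fin n → Finset (Fin n)
  coins : ℕ → Fin n → NodeCoins n

open Classical in
def realization {n m : ℕ} [NeZero m] (pl : Placement n) (ω : Outcome n m) : Realization n where
  src := ω.1.src
  dst := ω.1.dst
  point t v := latticePoint m pl ω.1 v (position ω t v)
  nbrs t v := Finset.univ.filter fun w => IsNeighbor pl ω t v w
  coins := ω.2.2

/-! ### The relay policy

At most one packet leaves a source in a time-slot, so a packet of a given pair is identified with
the time-slot in which it leaves its source. Sources always have packets to send. -/

namespace Realization

variable {n : ℕ} (r : Realization n) (Δ : ℝ)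

/-- Relaxed protocol model: while the nodes in `T` transmit, the transmission from `v` to `w` is
successful in time-slot `t`. -/
def Success (t : ℕ) (T : Set (Fin n)) (v w : Fin n) : Prop :=
  ∀ k ∈ T, k ≠ v → (1 + Δ) * geoDist (r.point t v) (r.point t w) ≤
    geoDist (r.point t k) (r.point t w)

/-- In sub-slot A of time-slot `t` the node `v` is an active source with at least one neighbor
that decides to transmit, and `w` is the neighbor that it chooses. -/
def SendsA (t : ℕ) (v w : Fin n) : Prop :=
  (∃ i, v = r.src i) ∧ (r.coins t v).activeA = true ∧ (r.coins t v).sendA = true ∧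
    ∃ h : (r.nbrs t v).Nonempty, ((r.coins t v).choiceA ⟨r.nbrs t v, h⟩ : Fin n) = w

/-- In sub-slot A of time-slot `t` the source of pair `i` transmits a packet to `w`
successfully. -/
def HopA (t : ℕ) (i : Fin (n / 2)) (w : Fin n) : Prop :=
  r.SendsA t (r.src i) w ∧ r.Success Δ t {k | ∃ w', r.SendsA t k w'} (r.src i) w

/-- The queues of all nodes: `Q v i` lists the packets of pair `i` that node `v` carries, the
oldest one first. -/
abbrev Queues (n : ℕ) : Type := Fin n → Fin (n / 2) → List ℕ

open Classical in
/-- The queues after sub-slot A of time-slot `t`, where `Q` are the queues before it. -/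
def afterA (t : ℕ) (Q : Queues n) : Queues n := fun v i =>
  if r.HopA Δ t i v ∧ v ≠ r.dst i then Q v i ++ [t] else Q v i

open Classical in
/-- The neighbors of `v` in time-slot `t` that are destinations. -/
def dstNbrs (t : ℕ) (v : Fin n) : Finset (Fin n) :=
  (r.nbrs t v).filter fun w => ∃ i, w = r.dst i

/-- In sub-slot B of time-slot `t` the node `v` is active, chooses the destination of pair `i`
among its neighbors that are destinations, and has a packet for it; `Q` are the queues at this
time. -/
def SendsB (t : ℕ) (Q : Queues n) (v : Fin n) (i : Fin (n / 2)) : Prop :=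
  (r.coins t v).activeB = true ∧
    (∃ h : (r.dstNbrs t v).Nonempty,
      ((r.coins t v).choiceB ⟨r.dstNbrs t v, h⟩ : Fin n) = r.dst i) ∧
    Q v i ≠ []

/-- In sub-slot B of time-slot `t` the node `v` transmits a packet of pair `i` to its destination
successfully. -/
def HopB (t : ℕ) (Q : Queues n) (v : Fin n) (i : Fin (n / 2)) : Prop :=
  r.SendsB t Q v i ∧ r.Success Δ t {k | ∃ i', r.SendsB t Q k i'} v (r.dst i)

open Classical in
/-- The queues after sub-slot B of time-slot `t`, where `Q` are the queues before it. -/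
def afterB (t : ℕ) (Q : Queues n) : Queues n := fun v i =>
  if r.HopB Δ t Q v i then (Q v i).tail else Q v i

/-- The queues at the beginning of time-slot `t`. -/
def queues : ℕ → Queues n
  | 0 => fun _ _ => []
  | t + 1 => r.afterB Δ t (r.afterA Δ t (queues t))

/-- Under the relay policy, a packet of pair `i` leaves its source in time-slot `s`. -/
def RelayLeaves (i : Fin (n / 2)) (s : ℕ) : Prop := ∃ w, r.HopA Δ s i w

/-- Under the relay policy, the packet of pair `i` that left in time-slot `s` reaches its
destination in time-slot `t`: either from the source in sub-slot A or from a relay, at which it is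
the first packet of the queue, in sub-slot B. -/
def RelayArrives (i : Fin (n / 2)) (s t : ℕ) : Prop :=
  (s = t ∧ r.HopA Δ t i (r.dst i)) ∨
    ∃ v, r.HopB Δ t (r.afterA Δ t (r.queues Δ t)) v i ∧
      (r.afterA Δ t (r.queues Δ t) v i).head? = some s

end Realization

/-! ### The scheme and its delay -/

/-- Under the scheme, a packet of pair `i` leaves its source in time-slot `s`: under the relay
policy in typical configurations, in turn (one source per time-slot) in all others. -/
def Leaves {n m : ℕ} [NeZero m] (Δ κ₁ κ₂ : ℝ) (pl : Placement n) (ω : Outcome n m)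
    (i : Fin (n / 2)) (s : ℕ) : Prop :=
  (ω.1.Typical Δ κ₁ κ₂ ∧ (realization pl ω).RelayLeaves Δ i s) ∨
    (¬ ω.1.Typical Δ κ₁ κ₂ ∧ s % (n / 2) = i)

/-- The packet of pair `i` that left in time-slot `s` reaches its destination in time-slot `t`.
In configurations that are not typical the source transmits directly to the destination, and no
other node transmits at the same time. -/
def Arrives {n m : ℕ} [NeZero m] (Δ κ₁ κ₂ : ℝ) (pl : Placement n) (ω : Outcome n m)
    (i : Fin (n / 2)) (s t : ℕ) : Prop :=
  (ω.1.Typical Δ κ₁ κ₂ ∧ (realization pl ω).RelayArrives Δ i s t) ∨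
    (¬ ω.1.Typical Δ κ₁ κ₂ ∧ s = t)

open Classical in
/-- The delay of packet `j` (counted from zero, in the order of leaving the source) of pair `i`:
the number of time-slots from the one in which it leaves its source up to the one in which it
reaches its destination, both included; infinite if this never happens. -/
def packetDelay {n m : ℕ} [NeZero m] (Δ κ₁ κ₂ : ℝ) (pl : Placement n) (ω : Outcome n m)
    (i : Fin (n / 2)) (j : ℕ) : ℝ≥0∞ :=
  ⨅ (s : ℕ) (t : ℕ) (_ : Leaves Δ κ₁ κ₂ pl ω i s ∧ Nat.count (Leaves Δ κ₁ κ₂ pl ω i) s = j ∧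
    Arrives Δ κ₁ κ₂ pl ω i s t), ((t - s + 1 : ℕ) : ℝ≥0∞)

/-- The sample mean of the delay of pair `i`. -/
def pairDelay {n m : ℕ} [NeZero m] (Δ κ₁ κ₂ : ℝ) (pl : Placement n) (ω : Outcome n m)
    (i : Fin (n / 2)) : ℝ≥0∞ :=
  limsup (fun k : ℕ => (∑ j ∈ Finset.range k, packetDelay Δ κ₁ κ₂ pl ω i j) / k) atTop

/-- The average delay over all source-destination pairs. -/
def averageDelay {n m : ℕ} [NeZero m] (Δ κ₁ κ₂ : ℝ) (pl : Placement n) (ω : Outcome n m) : ℝ≥0∞ :=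
  2 / n * ∑ i, pairDelay Δ κ₁ κ₂ pl ω i

/-- The delay of the scheme in the network with `n` nodes and `m` lattice points per circle. -/
def schemeDelay (n m : ℕ) [NeZero m] (Δ κ₁ κ₂ : ℝ) (p α : I) (pl : Placement n) : ℝ≥0∞ :=
  ∫⁻ ω, averageDelay Δ κ₁ κ₂ pl ω ∂law n m p α

end

end GreatCircleNetwork

set_option linter.unusedSectionVars false

namespace GreatCircleNetwork

noncomputable section

/-! ### The heat kernel of the natural random walk on a cycle -/

/-! The positions of two nodes form a random walk on a torus of `m ^ 2 = n` sites, and the two nodes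
meet when this walk is at one prescribed site. The transition probabilities of a single node are `1
/ m + O(1 / √t)` (`abs_kern_sub_le`), those of a pair are products of two such terms, and the sum of
`1 / t` is a logarithm. So meetings of a pair have frequency `1 / n`, but they come in clusters of
about `log n`, and the clusters are about `n log n` slots apart. A Green operator with a cut-off of
order `n log n` makes this precise: applied to the indicator of a meeting it is `O(log n)`
everywhere (`green_meet_le`) and at least of order `log n` at the meeting itself
(`le_green_meet_self`).

Interference costs only constant factors. In a typical configuration `O(m)` circles come near a
given meeting point, and after mixing each of their nodes is near it with probability `O(1 / m)`, so
a fixed share of the meetings is undisturbed (`le_evolve_meetAlone`). A neighbor that is met alone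
is the only neighbor, so the random choices of the scheme are forced. For a fixed configuration the
geometry enters only through a finite table `Sites`; `sitesOf_describes` connects this table with
the scheme.

Upper bound. Every arrival at a queue is given the weight `1 + 1 / log n` and every service the
inverse weight. Since clusters have size `log n`, a Lyapunov function built from the Green operators
of arrivals and services stays bounded, and for small `α` it is contracted by a factor `1 - const /
(n log n)` per slot, from every state (`lyapunov_contracts`). Hence a queue that has just received a
packet stays busy for `O(n log n)` slots in the mean (`lintegral_busy_le`). The total waiting time
of the packets is at most the total length of the busy times that follow the arrivals
(`sum_tsum_mem_line_le`). A maximal ergodic inequality bounds the expected long-run mean by the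
stationary mean, and there `n` relays, each met with probability `1 / n`, give `O(n log n)` again
(`lintegral_load_le`). Passing from means over slots to means over packets costs a constant, since
every source sends in a positive share of the slots (`ae_eventually_tally_sends`). Configurations
that are not typical have delay at most one, so no probability estimate is needed for them.

Lower bound. In a stationary slot a packet goes from the source `s` to some relay `w` with
probability of constant order. The position of the destination `d` is then still uniform, so the
Green function for meetings of `w` and `d` starts at a small multiple of `log n`, and it grows by a
small multiple of `log n` in `c n log n` slots, whereas it is of order `log n` when the two meet. By
optional stopping the relay probably does not meet `d` in this time (`lintegral_meets_hit_le`,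
`pathLaw_late_ge`), and a packet never changes its relay. The reverse Fatou lemma carries this to
the long-run mean (`le_lintegral_lateMean`). A Chernoff bound for the number of circles through a
disk shows that configurations are typical with probability at least one half
(`exists_typical_set`). -/

/-- The probability that the natural random walk on `ZMod m` started at `0` is at `x` at time
`t`. -/
def kern (m : ℕ) : ℕ → ZMod m → ℝ
  | 0, x => if x = 0 then 1 else 0
  | t + 1, x => (kern m t x + kern m t (x - 1) + kern m t (x + 1)) / 3

lemma kern_nonneg (m t : ℕ) (x : ZMod m) : 0 ≤ kern m t x := by
  induction t generalizing x with
  | zero => unfold kern; split_ifs <;> norm_num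
  | succ t ih => unfold kern; have := ih x; have := ih (x - 1); have := ih (x + 1); positivity

lemma sum_kern (m t : ℕ) [NeZero m] : ∑ x, kern m t x = 1 := by
  induction t with
  | zero => simp [kern]
  | succ t ih =>
    have h1 : ∑ x, kern m t (x - 1) = 1 := by
      rw [← ih]; exact Fintype.sum_equiv (Equiv.subRight 1) _ _ (fun x => rfl)
    have h2 : ∑ x, kern m t (x + 1) = 1 := by
      rw [← ih]; exact Fintype.sum_equiv (Equiv.addRight 1) _ _ (fun x => rfl)
    simp only [kern]
    rw [← Finset.sum_div, Finset.sum_add_distrib, Finset.sum_add_distrib, ih, h1, h2]; norm_num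

/-- Periodicity allows any integer representative in place of the residue, so neighboring sites need
no case distinction at the ends of the cycle. -/
lemma cos_two_pi_mul_val (m : ℕ) [NeZero m] (k : ℕ) (a : ℤ) :
    Real.cos (2 * Real.pi * k * ((a : ZMod m).val : ℝ) / m) = Real.cos (2 * Real.pi * k * a / m) := by
  have hm : (m : ℝ) ≠ 0 := Nat.cast_ne_zero.2 (NeZero.ne m)
  have h : (((a : ZMod m).val : ℤ)) = a - m * (a / m) := by
    rw [ZMod.val_intCast]; have := Int.emod_add_mul_ediv a m; linarith
  have h' : ((a : ZMod m).val : ℝ) = a - m * ((a / m : ℤ) : ℝ) := by exact_mod_cast h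
  rw [h']
  have : 2 * Real.pi * k * (a - m * ((a / m : ℤ) : ℝ)) / m
      = 2 * Real.pi * k * a / m - ((k * (a / m) : ℤ) : ℝ) * (2 * Real.pi) := by
    push_cast; field_simp
  rw [this, Real.cos_sub_int_mul_two_pi]

/-- The sum telescopes: `2 sin (θ / 2) cos (kθ)` is the difference of the sines of `(k + 1/2) θ` and
`(k - 1/2) θ`. -/
lemma two_sin_mul_sum_cos (θ : ℝ) (N : ℕ) :
    2 * Real.sin (θ / 2) * ∑ k ∈ Finset.range N, Real.cos (k * θ)
      = Real.sin ((N - 1 / 2) * θ) + Real.sin (θ / 2) := by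
  induction N with
  | zero =>
    have : ((0 : ℕ) - 1 / 2 : ℝ) * θ = -(θ / 2) := by push_cast; ring
    rw [this, Real.sin_neg]; simp
  | succ N ih =>
    rw [Finset.sum_range_succ, mul_add, ih]
    have h1 : ((N + 1 : ℕ) - 1 / 2 : ℝ) * θ = N * θ + θ / 2 := by push_cast; ring
    have h2 : (N - 1 / 2 : ℝ) * θ = N * θ - θ / 2 := by ring
    rw [h1, h2, Real.sin_add, Real.sin_sub]; ring

lemma sum_cos_roots (m : ℕ) [NeZero m] (x : ZMod m) :
    ∑ k ∈ Finset.range m, Real.cos (2 * Real.pi * k * (x.val : ℝ) / m) = if x = 0 then (m : ℝ) else 0 := by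
  have hm : 0 < (m : ℝ) := Nat.cast_pos.2 (NeZero.pos m)
  split_ifs with hx
  · simp [hx]
  · have hv : 0 < (x.val : ℝ) := by
      have : x.val ≠ 0 := by rwa [Ne, ZMod.val_eq_zero]
      positivity
    have hlt : (x.val : ℝ) < m := by exact_mod_cast ZMod.val_lt x
    set θ : ℝ := 2 * Real.pi * x.val / m with hθ
    have h := two_sin_mul_sum_cos θ m
    have hs : 0 < Real.sin (θ / 2) := by
      apply Real.sin_pos_of_pos_of_lt_pi
      · have := Real.pi_pos; positivity
      · rw [hθ, div_div, div_lt_iff₀ (by positivity)]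
        nlinarith [Real.pi_pos]
    -- For a multiple of `2π / m` the two boundary sines cancel, while `sin (θ / 2)` does not
    -- vanish.
    have h2 : (m - 1 / 2 : ℝ) * θ = -(θ / 2) + (x.val : ℕ) * (2 * Real.pi) := by
      rw [hθ]; field_simp; ring
    rw [h2, Real.sin_add_nat_mul_two_pi, Real.sin_neg, neg_add_cancel] at h
    have h3 := (mul_eq_zero.1 h).resolve_left (by positivity)
    rw [← h3]
    refine Finset.sum_congr rfl fun k _ => ?_
    congr 1; rw [hθ]; ring

/-- The eigenvalues of the natural random walk. -/
def eig (m k : ℕ) : ℝ := 1 - 4 / 3 * Real.sin (Real.pi * k / m) ^ 2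

/-- The cosine characters diagonalize one step: the mean of `cos (a - 2b)`, `cos a` and `cos (a +
2b)` is `(1 + 2 cos 2b) / 3` times `cos a`, and this factor is `1 - 4/3 sin² b`. -/
lemma kern_eq_sum_eig (m t : ℕ) [NeZero m] (x : ZMod m) :
    kern m t x = (∑ k ∈ Finset.range m, eig m k ^ t *
      Real.cos (2 * Real.pi * k * (x.val : ℝ) / m)) / m := by
  have hm : (m : ℝ) ≠ 0 := Nat.cast_ne_zero.2 (NeZero.ne m)
  induction t generalizing x with
  | zero =>
    simp only [kern, pow_zero, one_mul, sum_cos_roots]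
    split_ifs <;> simp [hm]
  | succ t ih =>
    simp only [kern]
    rw [ih, ih, ih, ← add_div, ← add_div, ← Finset.sum_add_distrib, ← Finset.sum_add_distrib,
      div_right_comm]
    congr 1
    rw [Finset.sum_div]
    refine Finset.sum_congr rfl fun k _ => ?_
    have e0 : x = (((x.val : ℤ)) : ZMod m) := by simp
    have e1 : x - 1 = (((x.val : ℤ) - 1 : ℤ) : ZMod m) := by push_cast; simp
    have e2 : x + 1 = (((x.val : ℤ) + 1 : ℤ) : ZMod m) := by push_cast; simp
    rw [e1, e2, cos_two_pi_mul_val, cos_two_pi_mul_val]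
    have a1 : 2 * Real.pi * k * (((x.val : ℤ) - 1 : ℤ) : ℝ) / m
        = 2 * Real.pi * k * (x.val : ℝ) / m - 2 * (Real.pi * k / m) := by push_cast; ring
    have a2 : 2 * Real.pi * k * (((x.val : ℤ) + 1 : ℤ) : ℝ) / m
        = 2 * Real.pi * k * (x.val : ℝ) / m + 2 * (Real.pi * k / m) := by push_cast; ring
    rw [a1, a2, Real.cos_sub, Real.cos_add, Real.cos_two_mul, eig]
    have := Real.sin_sq_add_cos_sq (Real.pi * k / m)
    have hc : Real.cos (Real.pi * k / m) ^ 2 = 1 - Real.sin (Real.pi * k / m) ^ 2 := by linarith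
    rw [hc]; ring

lemma eig_zero (m : ℕ) : eig m 0 = 1 := by simp [eig]

/-- The holding probability keeps the spectrum above `-1/3`. The factor `2/3` cannot be improved:
where the sine is one, both sides equal `1/3`. -/
lemma abs_eig_le (m k : ℕ) : |eig m k| ≤ 1 - 2 / 3 * Real.sin (Real.pi * k / m) ^ 2 := by
  have h1 := Real.sin_sq_le_one (Real.pi * k / m)
  have h2 := sq_nonneg (Real.sin (Real.pi * k / m))
  rw [abs_le, eig]; constructor <;> linarith

lemma abs_eig_sub (m k : ℕ) (hm : 0 < m) (hk : k ≤ m) : |eig m (m - k)| = |eig m k| := by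
  have hm' : (m : ℝ) ≠ 0 := by positivity
  have : Real.pi * ((m - k : ℕ) : ℝ) / m = Real.pi - Real.pi * k / m := by
    rw [Nat.cast_sub hk]; field_simp
  rw [eig, this, Real.sin_pi_sub, eig]

lemma two_mul_div_le_sin (m k : ℕ) (hm : 0 < m) (hk : 2 * k ≤ m) :
    2 * (k : ℝ) / m ≤ Real.sin (Real.pi * k / m) := by
  have hm' : (0 : ℝ) < m := by exact_mod_cast hm
  have hk' : 2 * (k : ℝ) ≤ m := by exact_mod_cast hk
  have h := Real.mul_le_sin (x := Real.pi * k / m) (by have := Real.pi_pos; positivity)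
    (by rw [div_le_div_iff₀ hm' two_pos]; nlinarith [Real.pi_pos])
  refine le_trans (le_of_eq ?_) h
  have := Real.pi_pos.ne'
  field_simp

/-- Jordan's inequality for the sine turns the spectral gap into `8/3 (k / m) ^ 2`. The Gaussian
bound that results is weakened to a rational one, which can be summed by telescoping. -/
lemma abs_eig_pow_le (m t k : ℕ) (hm : 0 < m) (hk : 2 * k ≤ m) :
    |eig m k| ^ t ≤ 1 / (1 + 8 / 3 * t * (k / m) ^ 2) := by
  have hm' : (0 : ℝ) < m := by exact_mod_cast hm
  have h1 : |eig m k| ≤ 1 - 8 / 3 * ((k : ℝ) / m) ^ 2 := by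
    refine (abs_eig_le m k).trans ?_
    have h := two_mul_div_le_sin m k hm hk
    have h0 : 0 ≤ 2 * (k : ℝ) / m := by positivity
    have := pow_le_pow_left₀ h0 h 2
    have e : (2 * (k : ℝ) / m) ^ 2 = 4 * ((k : ℝ) / m) ^ 2 := by ring
    rw [e] at this; linarith
  set y := 8 / 3 * ((k : ℝ) / m) ^ 2 with hy
  have h2 : |eig m k| ≤ Real.exp (-y) := by
    have := Real.add_one_le_exp (-y); linarith
  have h3 : |eig m k| ^ t ≤ Real.exp (-(t * y)) := by
    have := pow_le_pow_left₀ (abs_nonneg _) h2 t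
    rwa [← Real.exp_nat_mul, mul_neg] at this
  refine h3.trans ?_
  have hty : 0 ≤ t * y := by positivity
  have e : 1 + 8 / 3 * (t : ℝ) * ((k : ℝ) / m) ^ 2 = 1 + t * y := by rw [hy]; ring
  rw [e, Real.exp_neg, one_div]
  exact inv_anti₀ (by positivity) (by have := Real.add_one_le_exp (t * y); linarith)

lemma sum_one_div_one_add_sq_le (b : ℝ) (hb : 0 < b) (N : ℕ) :
    ∑ j ∈ Finset.range N, 1 / (1 + (b * (j + 1)) ^ 2) ≤ 2 / b := by
  -- Since `(1 + x) ^ 2 ≤ 2 (1 + x ^ 2)`, each term is at most a difference of the values of `2 / (b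
  -- (1 + b j))` at consecutive `j`; the subtracted remainder is what lets the induction close.
  have key : ∀ N : ℕ, ∑ j ∈ Finset.range N, 1 / (1 + (b * (j + 1)) ^ 2)
      ≤ 2 / b * (1 - 1 / (1 + b * N)) := by
    intro N
    induction N with
    | zero => simp
    | succ N ih =>
      rw [Finset.sum_range_succ]
      have hN : 0 ≤ b * N := by positivity
      have h1 : 1 / (1 + (b * (N + 1)) ^ 2) ≤ 2 / ((1 + b * N) * (1 + b * (N + 1))) := by
        rw [div_le_div_iff₀ (by positivity) (by positivity)]
        nlinarith [sq_nonneg (b * N + b - 1), sq_nonneg b]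
      have h2 : 2 / ((1 + b * N) * (1 + b * (N + 1)))
          = 2 / b * (1 - 1 / (1 + b * (N + 1))) - 2 / b * (1 - 1 / (1 + b * N)) := by
        have : 1 + b * N ≠ 0 := by positivity
        have : 1 + b * (N + 1) ≠ 0 := by positivity
        field_simp; ring
      push_cast
      linarith
  refine (key N).trans ?_
  have : 0 ≤ 2 / b * (1 / (1 + b * N)) := by positivity
  linarith

lemma sum_abs_eig_pow_le (m t : ℕ) (hm : 0 < m) (ht : 0 < t) :
    ∑ k ∈ Finset.range (m - 1), |eig m (k + 1)| ^ t ≤ 3 * m / √t := by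
  have hm' : (0 : ℝ) < m := by exact_mod_cast hm
  have ht' : (0 : ℝ) < t := by exact_mod_cast ht
  set b : ℝ := √(8 / 3 * t) / m with hb
  have hb0 : 0 < b := by positivity
  set h := fun j : ℕ => 1 / (1 + (b * (j + 1)) ^ 2) with hh
  have hbsq : ∀ x : ℝ, (b * x) ^ 2 = 8 / 3 * t * (x / m) ^ 2 := by
    intro x
    rw [hb, mul_pow, div_pow, Real.sq_sqrt (by positivity), div_pow]; ring
  have hnn : ∀ j, 0 ≤ h j := fun j => by simp only [hh]; positivity
  -- Each frequency is charged to the nearer of the ends `0` and `m`; the second summand is the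
  -- first one read backwards, so both have the same sum.
  have hle : ∀ k ∈ Finset.range (m - 1), |eig m (k + 1)| ^ t ≤ h k + h (m - 1 - 1 - k) := by
    intro k hk
    rw [Finset.mem_range] at hk
    by_cases h2 : 2 * (k + 1) ≤ m
    · have := abs_eig_pow_le m t (k + 1) hm h2
      refine le_add_of_le_of_nonneg (this.trans (le_of_eq ?_)) (hnn _)
      simp only [hh]; rw [hbsq]; push_cast; rfl
    · rw [← abs_eig_sub m (k + 1) hm (by omega)]
      have := abs_eig_pow_le m t (m - (k + 1)) hm (by omega)
      refine le_add_of_nonneg_of_le (hnn _) (this.trans (le_of_eq ?_))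
      simp only [hh]; rw [hbsq]
      have e : m - (k + 1) = (m - 1 - 1 - k) + 1 := by omega
      rw [e]; push_cast; rfl
  refine (Finset.sum_le_sum hle).trans ?_
  rw [Finset.sum_add_distrib, Finset.sum_range_reflect]
  have h3 := sum_one_div_one_add_sq_le b hb0 (m - 1)
  have h4 : 2 / b + 2 / b ≤ 3 * m / √t := by
    have e : √(8 / 3 * (t : ℝ)) = √(8 / 3) * √t := Real.sqrt_mul (by norm_num) _
    have h5 : (4 : ℝ) / 3 ≤ √(8 / 3) := Real.le_sqrt_of_sq_le (by norm_num)
    have hst : 0 < √(t : ℝ) := Real.sqrt_pos.2 ht'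
    rw [← add_div, hb, e, div_div_eq_mul_div, div_le_div_iff₀ (by positivity) hst]
    have : 0 < (m : ℝ) * √t := by positivity
    nlinarith
  simp only [hh] at *
  linarith

/-- The zero frequency gives the uniform law and the others are estimated by their moduli. The
exponent one half matters: its square, for two nodes, gives the harmonic series. -/
lemma abs_kern_sub_le (m t : ℕ) [NeZero m] (ht : 0 < t) (x : ZMod m) :
    |kern m t x - 1 / m| ≤ 3 / √t := by
  have hm : 0 < m := NeZero.pos m
  have hm' : (0 : ℝ) < m := by exact_mod_cast hm
  have e : kern m t x - 1 / m = (∑ k ∈ Finset.range (m - 1), eig m (k + 1) ^ t *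
      Real.cos (2 * Real.pi * (k + 1 : ℕ) * (x.val : ℝ) / m)) / m := by
    rw [kern_eq_sum_eig, ← sub_div]
    congr 1
    obtain ⟨M, rfl⟩ : ∃ M, m = M + 1 := ⟨m - 1, by omega⟩
    rw [Finset.sum_range_succ']
    simp [eig_zero]
  rw [e, abs_div, abs_of_pos hm', div_le_iff₀ hm']
  calc _ ≤ ∑ k ∈ Finset.range (m - 1), |eig m (k + 1)| ^ t := by
        refine (Finset.abs_sum_le_sum_abs _ _).trans (Finset.sum_le_sum fun k _ => ?_)
        rw [abs_mul, abs_pow]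
        exact mul_le_of_le_one_right (by positivity) (Real.abs_cos_le_one _)
    _ ≤ 3 * m / √t := sum_abs_eig_pow_le m t hm ht
    _ = _ := by ring

lemma kern_le (m t : ℕ) [NeZero m] (ht : 0 < t) (x : ZMod m) : kern m t x ≤ 1 / m + 3 / √t := by
  have := (abs_le.1 (abs_kern_sub_le m t ht x)).2; linarith

lemma abs_kern_sub_le_of_mixed (m t : ℕ) [NeZero m] (ht : 36 * m ^ 2 ≤ t) (x : ZMod m) :
    |kern m t x - 1 / m| ≤ 1 / (2 * m) := by
  have hm : 0 < m := NeZero.pos m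
  have hm' : (0 : ℝ) < m := by exact_mod_cast hm
  have ht0 : 0 < t := lt_of_lt_of_le (by positivity) ht
  refine (abs_kern_sub_le m t ht0 x).trans ?_
  -- The constant `36` is chosen so that `3 / √t ≤ 3 / (6 m) = 1 / (2 m)`.
  have h : 6 * (m : ℝ) ≤ √t := Real.le_sqrt_of_sq_le (by
    have : ((36 * m ^ 2 : ℕ) : ℝ) ≤ t := by exact_mod_cast ht
    push_cast at this; nlinarith)
  rw [div_le_div_iff₀ (by linarith) (by positivity)]; linarith

lemma kern_le_of_mixed (m t : ℕ) [NeZero m] (ht : 36 * m ^ 2 ≤ t) (x : ZMod m) :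
    kern m t x ≤ 2 / m := by
  have hm' : (0 : ℝ) < m := by exact_mod_cast NeZero.pos m
  have h := (abs_le.1 (abs_kern_sub_le_of_mixed m t ht x)).2
  have e : (2 : ℝ) / m = 1 / m + 1 / (2 * m) + 1 / (2 * m) := by field_simp; norm_num
  have : (0 : ℝ) ≤ 1 / (2 * m) := by positivity
  linarith

lemma le_kern_of_mixed (m t : ℕ) [NeZero m] (ht : 36 * m ^ 2 ≤ t) (x : ZMod m) :
    1 / (2 * m) ≤ kern m t x := by
  have hm' : (0 : ℝ) < m := by exact_mod_cast NeZero.pos m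
  have h := (abs_le.1 (abs_kern_sub_le_of_mixed m t ht x)).1
  have e : (1 : ℝ) / m = 1 / (2 * m) + 1 / (2 * m) := by field_simp; norm_num
  linarith

/-- At an even time no spectral term at the origin is negative, so only the frequencies up to `m /
(2π √(2t))` are kept. By Bernoulli's inequality each of them still contributes `1 - 1/3`. -/
lemma le_kern_two_mul_zero (m t : ℕ) [NeZero m] (ht : 0 < t) :
    1 / (3 * Real.pi * √(2 * t : ℕ)) ≤ kern m (2 * t) 0 := by
  have hm : 0 < m := NeZero.pos m
  have hm' : (0 : ℝ) < m := by exact_mod_cast hm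
  have hpi := Real.pi_pos
  have hpi3 := Real.pi_gt_three
  have ht' : (1 : ℝ) ≤ ((2 * t : ℕ) : ℝ) := by exact_mod_cast (by omega : 1 ≤ 2 * t)
  set s : ℝ := √((2 * t : ℕ) : ℝ) with hs
  have hs1 : 1 ≤ s := Real.one_le_sqrt.2 ht'
  have hss : s ^ 2 = ((2 * t : ℕ) : ℝ) := Real.sq_sqrt (by linarith)
  set J : ℕ := ⌊(m : ℝ) / (2 * Real.pi * s)⌋₊ with hJ
  have hJle : (J : ℝ) ≤ m / (2 * Real.pi * s) := Nat.floor_le (by positivity)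
  have hJlt : m / (2 * Real.pi * s) < (J : ℝ) + 1 := Nat.lt_floor_add_one _
  have hJm : J + 1 ≤ m := by
    have : (J : ℝ) < m := by
      refine hJle.trans_lt ((div_lt_self hm' ?_)); nlinarith
    exact_mod_cast this
  have hnn : ∀ k, 0 ≤ eig m k ^ (2 * t) := fun k => (even_two_mul t).pow_nonneg _
  have hterm : ∀ k ∈ Finset.range (J + 1), (2 : ℝ) / 3 ≤ eig m k ^ (2 * t) := by
    intro k hk
    have hk' : (k : ℝ) ≤ J := by exact_mod_cast Nat.lt_succ_iff.1 (Finset.mem_range.1 hk)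
    have h1 : Real.sin (Real.pi * k / m) ^ 2 ≤ (Real.pi * k / m) ^ 2 := by
      rw [sq_le_sq]
      exact Real.abs_sin_le_abs
    have h2 : Real.pi * k / m ≤ 1 / (2 * s) := by
      have : (k : ℝ) ≤ m / (2 * Real.pi * s) := hk'.trans hJle
      calc Real.pi * k / m ≤ Real.pi * (m / (2 * Real.pi * s)) / m := by gcongr
        _ = 1 / (2 * s) := by field_simp
    have h3 : (Real.pi * k / m) ^ 2 ≤ 1 / (4 * s ^ 2) := by
      have := pow_le_pow_left₀ (by positivity) h2 2
      refine this.trans (le_of_eq ?_); rw [div_pow]; ring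
    have h4 : -(1 / (3 * s ^ 2)) ≥ -2 := by
      have : 1 / (3 * s ^ 2) ≤ 1 := by rw [div_le_one (by positivity)]; nlinarith
      linarith
    have h5 : 1 + (-(1 / (3 * s ^ 2))) ≤ eig m k := by
      rw [eig]
      have : 4 / 3 * (1 / (4 * s ^ 2)) = 1 / (3 * s ^ 2) := by field_simp
      nlinarith
    have h6 := one_add_mul_le_pow h4 (2 * t)
    have h7 : (0 : ℝ) ≤ 1 + (-(1 / (3 * s ^ 2))) := by
      have : 1 / (3 * s ^ 2) ≤ 1 := by rw [div_le_one (by positivity)]; nlinarith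
      linarith
    have h8 := pow_le_pow_left₀ h7 h5 (2 * t)
    refine le_trans ?_ (h6.trans h8)
    rw [← hss]; have : s ^ 2 ≠ 0 := by positivity
    field_simp; norm_num
  rw [kern_eq_sum_eig]
  have hsum : (J + 1 : ℕ) * ((2 : ℝ) / 3) ≤ ∑ k ∈ Finset.range m, eig m k ^ (2 * t) *
      Real.cos (2 * Real.pi * k * ((0 : ZMod m).val : ℝ) / m) := by
    calc _ = ∑ k ∈ Finset.range (J + 1), (2 : ℝ) / 3 := by simp
      _ ≤ ∑ k ∈ Finset.range (J + 1), eig m k ^ (2 * t) := Finset.sum_le_sum hterm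
      _ ≤ ∑ k ∈ Finset.range m, eig m k ^ (2 * t) :=
          Finset.sum_le_sum_of_subset_of_nonneg (Finset.range_mono hJm) fun k _ _ => hnn k
      _ = _ := by simp
  rw [le_div_iff₀ hm']
  refine le_trans ?_ hsum
  push_cast
  have : 1 / (3 * Real.pi * s) * m = (2 / 3) * (m / (2 * Real.pi * s)) := by field_simp
  rw [this]; linarith

/-! ### The joint motion of all nodes -/

section Evolution

variable {ι : Type} [Fintype ι] [DecidableEq ι] {m : ℕ} [NeZero m]

/-- The three steps of the natural random walk. -/
def stepVal (m : ℕ) (j : Fin 3) : ZMod m := ![0, 1, -1] j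

/-- The expectation of `f` after one step of all nodes. -/
def stepOp (f : (ι → ZMod m) → ℝ) (y : ι → ZMod m) : ℝ :=
  ∑ e : ι → Fin 3, (∏ _k : ι, (1 / 3 : ℝ)) * f fun k => y k + stepVal m (e k)

/-- The expectation of `f` after `t` steps of all nodes. -/
def evolve (t : ℕ) (f : (ι → ZMod m) → ℝ) (y : ι → ZMod m) : ℝ :=
  ∑ x : ι → ZMod m, (∏ k, kern m t (x k - y k)) * f x

lemma sum_stepVal_kern (t : ℕ) (z : ZMod m) :
    ∑ j : Fin 3, (1 / 3 : ℝ) * kern m t (z - stepVal m j) = kern m (t + 1) z := by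
  simp only [kern, stepVal, Fin.sum_univ_three]
  simp
  ring

lemma prod_sum_pi {α : Type} [Fintype α] (F : ι → α → ℝ) :
    ∏ k, ∑ b, F k b = ∑ x : ι → α, ∏ k, F k (x k) := by
  rw [Finset.prod_univ_sum, Fintype.piFinset_univ]

lemma stepOp_evolve (t : ℕ) (f : (ι → ZMod m) → ℝ) (y : ι → ZMod m) :
    stepOp (evolve t f) y = evolve (t + 1) f y := by
  simp only [stepOp, evolve, Finset.mul_sum]
  rw [Finset.sum_comm]
  refine Finset.sum_congr rfl fun x _ => ?_
  simp only [← mul_assoc, ← Finset.sum_mul, ← Finset.prod_mul_distrib]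
  congr 1
  rw [← prod_sum_pi (fun k j => 1 / 3 * kern m t (x k - (y k + stepVal m j)))]
  refine Finset.prod_congr rfl fun k _ => ?_
  rw [← sum_stepVal_kern]
  refine Finset.sum_congr rfl fun j _ => ?_
  rw [sub_sub]

lemma evolve_zero (f : (ι → ZMod m) → ℝ) (y : ι → ZMod m) : evolve 0 f y = f y := by
  unfold evolve
  rw [Finset.sum_eq_single y]
  · simp [kern]
  · intro x _ hx
    obtain ⟨k, hk⟩ := Function.ne_iff.1 hx
    rw [Finset.prod_eq_zero (Finset.mem_univ k), zero_mul]
    simp [kern, sub_eq_zero, hk]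
  · simp

lemma evolve_prod (t : ℕ) (F : ι → ZMod m → ℝ) (y : ι → ZMod m) :
    evolve t (fun x => ∏ k, F k (x k)) y = ∏ k, ∑ b, kern m t (b - y k) * F k b := by
  rw [prod_sum_pi (fun k b => kern m t (b - y k) * F k b)]
  unfold evolve
  refine Finset.sum_congr rfl fun x _ => ?_
  rw [Finset.prod_mul_distrib]

lemma sum_kern_sub (t : ℕ) (y : ZMod m) : ∑ b, kern m t (b - y) = 1 := by
  rw [← sum_kern m t]; exact Fintype.sum_equiv (Equiv.subRight y) _ _ (fun x => rfl)

lemma sum_kern_sub' (t : ℕ) (y : ZMod m) : ∑ b, kern m t (y - b) = 1 := by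
  rw [← sum_kern m t]; exact Fintype.sum_equiv (Equiv.subLeft y) _ _ (fun x => rfl)

lemma prod_kern_nonneg (t : ℕ) (x y : ι → ZMod m) : 0 ≤ ∏ k, kern m t (x k - y k) :=
  Finset.prod_nonneg fun _ _ => kern_nonneg _ _ _

lemma evolve_const (t : ℕ) (c : ℝ) (y : ι → ZMod m) : evolve t (fun _ => c) y = c := by
  unfold evolve
  rw [← Finset.sum_mul, ← prod_sum_pi (fun k b => kern m t (b - y k))]
  simp [sum_kern_sub]

lemma evolve_mono (t : ℕ) {f g : (ι → ZMod m) → ℝ} (h : ∀ x, f x ≤ g x) (y : ι → ZMod m) :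
    evolve t f y ≤ evolve t g y :=
  Finset.sum_le_sum fun x _ => mul_le_mul_of_nonneg_left (h x) (prod_kern_nonneg t x y)

lemma evolve_nonneg (t : ℕ) {f : (ι → ZMod m) → ℝ} (h : ∀ x, 0 ≤ f x) (y : ι → ZMod m) :
    0 ≤ evolve t f y :=
  Finset.sum_nonneg fun x _ => mul_nonneg (prod_kern_nonneg t x y) (h x)

lemma evolve_sum {κ : Type} (s : Finset κ) (t : ℕ) (f : κ → (ι → ZMod m) → ℝ) (y : ι → ZMod m) :
    evolve t (fun x => ∑ w ∈ s, f w x) y = ∑ w ∈ s, evolve t (f w) y := by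
  simp only [evolve, Finset.mul_sum]
  rw [Finset.sum_comm]

lemma sum_evolve (t : ℕ) (f : (ι → ZMod m) → ℝ) : ∑ y, evolve t f y = ∑ x, f x := by
  simp only [evolve]
  rw [Finset.sum_comm]
  refine Finset.sum_congr rfl fun x _ => ?_
  rw [← Finset.sum_mul, ← prod_sum_pi (fun k b => kern m t (x k - b))]
  simp [sum_kern_sub']

lemma stepOp_const (c : ℝ) (y : ι → ZMod m) : stepOp (fun _ => c) y = c := by
  have h := stepOp_evolve 0 (fun _ => c) y
  rwa [evolve_const, funext (evolve_zero fun _ => c)] at h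

lemma stepOp_add (f g : (ι → ZMod m) → ℝ) (y : ι → ZMod m) :
    stepOp (fun x => f x + g x) y = stepOp f y + stepOp g y := by
  simp only [stepOp, mul_add, Finset.sum_add_distrib]

lemma stepOp_const_mul (c : ℝ) (f : (ι → ZMod m) → ℝ) (y : ι → ZMod m) :
    stepOp (fun x => c * f x) y = c * stepOp f y := by
  simp only [stepOp, Finset.mul_sum]
  exact Finset.sum_congr rfl fun x _ => by ring

lemma stepOp_mono {f g : (ι → ZMod m) → ℝ} (h : ∀ x, f x ≤ g x) (y : ι → ZMod m) :
    stepOp f y ≤ stepOp g y :=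
  Finset.sum_le_sum fun x _ => mul_le_mul_of_nonneg_left (h _)
    (Finset.prod_nonneg fun _ _ => by norm_num)

lemma stepOp_sum {κ : Type} (s : Finset κ) (f : κ → (ι → ZMod m) → ℝ) (y : ι → ZMod m) :
    stepOp (fun x => ∑ w ∈ s, f w x) y = ∑ w ∈ s, stepOp (f w) y := by
  simp only [stepOp, Finset.mul_sum]
  rw [Finset.sum_comm]

/-- A truncated Green operator. -/
def green (L : ℕ) (f : (ι → ZMod m) → ℝ) (y : ι → ZMod m) : ℝ :=
  ∑ t ∈ Finset.range L, (1 - t / L : ℝ) * evolve t f y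

/-- Summation by parts. Because the weights decrease linearly by `1 / L`, the defect of the Green
equation is the mean of `f` over the whole horizon instead of its value at the end, and this mean is
controlled by mixing. -/
lemma stepOp_green (L : ℕ) (hL : 0 < L) (f : (ι → ZMod m) → ℝ) (y : ι → ZMod m) :
    stepOp (green L f) y
      = green L f y - f y + (∑ t ∈ Finset.range L, evolve (t + 1) f y) / L := by
  have hL' : (L : ℝ) ≠ 0 := by positivity
  have h1 : stepOp (green L f) y
      = ∑ t ∈ Finset.range L, (1 - t / L : ℝ) * evolve (t + 1) f y := by
    have : green L f = fun y => ∑ t ∈ Finset.range L, (1 - t / L : ℝ) * evolve t f y := rfl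
    rw [this, stepOp_sum]
    refine Finset.sum_congr rfl fun t _ => ?_
    rw [stepOp_const_mul, stepOp_evolve]
  -- A partial sum has one more boundary term, with factor `1 - M / L`; it disappears at `M = L`.
  have h2 : ∀ M : ℕ, ∑ t ∈ Finset.range M, (1 - t / L : ℝ) * evolve (t + 1) f y
      = ∑ t ∈ Finset.range M, (1 - t / L : ℝ) * evolve t f y - f y
        + (∑ t ∈ Finset.range M, evolve (t + 1) f y) / L + (1 - M / L : ℝ) * evolve M f y := by
    intro M
    induction M with
    | zero => simp [evolve_zero]
    | succ M ih =>
      rw [Finset.sum_range_succ, ih, Finset.sum_range_succ, Finset.sum_range_succ]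
      push_cast
      field_simp
      ring
  rw [h1, h2 L, div_self hL']
  simp [green]

lemma green_nonneg (L : ℕ) {f : (ι → ZMod m) → ℝ} (h : ∀ x, 0 ≤ f x) (y : ι → ZMod m) :
    0 ≤ green L f y := by
  refine Finset.sum_nonneg fun t ht => mul_nonneg ?_ (evolve_nonneg t h y)
  have h1 : (t : ℝ) ≤ L := by exact_mod_cast (Finset.mem_range.1 ht).le
  have := div_le_one_of_le₀ h1 (Nat.cast_nonneg L)
  linarith

lemma green_le (L : ℕ) {f : (ι → ZMod m) → ℝ} (h : ∀ x, 0 ≤ f x) (y : ι → ZMod m) :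
    green L f y ≤ ∑ t ∈ Finset.range L, evolve t f y := by
  refine Finset.sum_le_sum fun t _ => mul_le_of_le_one_left (evolve_nonneg t h y) ?_
  have : (0 : ℝ) ≤ t / L := by positivity
  linarith

/-! ### Meetings of two nodes -/

/-- The indicator of the event that node `u` is at `a` and node `v` at `b`. -/
def meet (u v : ι) (a b : ZMod m) (x : ι → ZMod m) : ℝ := if x u = a ∧ x v = b then 1 else 0

lemma meet_nonneg (u v : ι) (a b : ZMod m) (x : ι → ZMod m) : 0 ≤ meet u v a b x := by
  unfold meet; split_ifs <;> norm_num

lemma meet_le_one (u v : ι) (a b : ZMod m) (x : ι → ZMod m) : meet u v a b x ≤ 1 := by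
  unfold meet; split_ifs <;> norm_num

/-- The indicator of the event that node `u` is at `a`, node `v` at `b`, and no other node `k` is
in the set `S k`. -/
def meetAlone (u v : ι) (a b : ZMod m) (S : ι → Finset (ZMod m)) (x : ι → ZMod m) : ℝ :=
  if x u = a ∧ x v = b ∧ ∀ k, k ≠ u → k ≠ v → x k ∉ S k then 1 else 0

lemma meetAlone_nonneg (u v : ι) (a b : ZMod m) (S : ι → Finset (ZMod m)) (x : ι → ZMod m) :
    0 ≤ meetAlone u v a b S x := by
  unfold meetAlone; split_ifs <;> norm_num

lemma meetAlone_le_meet (u v : ι) (a b : ZMod m) (S : ι → Finset (ZMod m)) (x : ι → ZMod m) :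
    meetAlone u v a b S x ≤ meet u v a b x := by
  unfold meetAlone meet
  split_ifs with h1 h2
  · rfl
  · exact absurd ⟨h1.1, h1.2.1⟩ h2
  · norm_num
  · rfl

lemma meetAlone_empty (u v : ι) (a b : ZMod m) (x : ι → ZMod m) :
    meetAlone u v a b (fun _ => ∅) x = meet u v a b x := by
  simp [meetAlone, meet]

lemma meetAlone_eq_prod (u v : ι) (huv : u ≠ v) (a b : ZMod m) (S : ι → Finset (ZMod m))
    (x : ι → ZMod m) :
    meetAlone u v a b S x = ∏ k, (if k = u then (if x k = a then 1 else 0)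
      else if k = v then (if x k = b then 1 else 0) else (if x k ∈ S k then 0 else 1) : ℝ) := by
  unfold meetAlone
  split_ifs with h
  · obtain ⟨h1, h2, h3⟩ := h
    symm
    refine Finset.prod_eq_one fun k _ => ?_
    by_cases hu : k = u
    · simp [hu, h1]
    · by_cases hv : k = v
      · subst hv; simp [hu, h2]
      · simp [hu, hv, h3 k hu hv]
  · symm
    rw [Finset.prod_eq_zero_iff]
    by_contra hcon
    push Not at hcon
    refine h ⟨?_, ?_, fun k hu hv => ?_⟩
    · have := hcon u (Finset.mem_univ _); simp at this; exact this
    · have := hcon v (Finset.mem_univ _); simp [huv.symm] at this; exact this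
    · have := hcon k (Finset.mem_univ _); simp [hu, hv] at this; exact this

lemma evolve_meetAlone (t : ℕ) (u v : ι) (huv : u ≠ v) (a b : ZMod m) (S : ι → Finset (ZMod m))
    (y : ι → ZMod m) :
    evolve t (meetAlone u v a b S) y = kern m t (a - y u) * kern m t (b - y v) *
      ∏ k ∈ (Finset.univ.erase u).erase v, (1 - ∑ c ∈ S k, kern m t (c - y k)) := by
  have e : meetAlone u v a b S = fun x => ∏ k, (if k = u then (if x k = a then 1 else 0)
      else if k = v then (if x k = b then 1 else 0) else (if x k ∈ S k then 0 else 1) : ℝ) := by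
    funext x; exact meetAlone_eq_prod u v huv a b S x
  rw [e, evolve_prod t (fun k c => (if k = u then (if c = a then 1 else 0)
      else if k = v then (if c = b then 1 else 0) else (if c ∈ S k then 0 else 1) : ℝ)),
    ← Finset.mul_prod_erase Finset.univ _ (Finset.mem_univ u),
    ← Finset.mul_prod_erase _ _ (Finset.mem_erase.2 ⟨huv.symm, Finset.mem_univ v⟩), ← mul_assoc]
  congr 1
  · congr 1
    · simp
    · simp [huv.symm]
  · refine Finset.prod_congr rfl fun k hk => ?_
    simp only [Finset.mem_erase, Finset.mem_univ, and_true] at hk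
    simp only [hk.1, hk.2, if_false]
    rw [eq_sub_iff_add_eq]
    conv_rhs => rw [← sum_kern_sub t (y k)]
    have : ∑ c ∈ S k, kern m t (c - y k) = ∑ c, if c ∈ S k then kern m t (c - y k) else 0 := by
      simp
    rw [this, ← Finset.sum_add_distrib]
    refine Finset.sum_congr rfl fun c _ => ?_
    split_ifs <;> simp

lemma evolve_meet (t : ℕ) (u v : ι) (huv : u ≠ v) (a b : ZMod m) (y : ι → ZMod m) :
    evolve t (meet u v a b) y = kern m t (a - y u) * kern m t (b - y v) := by
  have e : meet u v a b = meetAlone u v a b (fun _ => ∅) := by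
    funext x; rw [meetAlone_empty]
  rw [e, evolve_meetAlone t u v huv]; simp

/-- The nodes move independently, so the probability is a product. After mixing, a node with sites
near the meeting point avoids them with probability at least `1 - 2B/m ≥ exp (-4B/m)`, where `4 * B
≤ m` is used, and there are at most `κ m` such nodes. -/
lemma le_evolve_meetAlone (t : ℕ) (ht : 36 * m ^ 2 ≤ t) (u v : ι) (huv : u ≠ v) (a b : ZMod m)
    (S : ι → Finset (ZMod m)) (B κ : ℝ) (hB : ∀ k, ((S k).card : ℝ) ≤ B)
    (hS : ((Finset.univ.filter fun k => (S k).Nonempty).card : ℝ) ≤ κ * m)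
    (hm : 4 * B ≤ m) (y : ι → ZMod m) :
    Real.exp (-(4 * B * κ)) / (4 * m ^ 2) ≤ evolve t (meetAlone u v a b S) y := by
  have hm0 : (0 : ℝ) < m := by exact_mod_cast NeZero.pos m
  have hB0 : 0 ≤ B := le_trans (by positivity) (hB u)
  rw [evolve_meetAlone t u v huv]
  have h1 := le_kern_of_mixed m t ht (a - y u)
  have h2 := le_kern_of_mixed m t ht (b - y v)
  have h12 : 1 / (4 * (m : ℝ) ^ 2) ≤ kern m t (a - y u) * kern m t (b - y v) := by
    calc 1 / (4 * (m : ℝ) ^ 2) = 1 / (2 * m) * (1 / (2 * m)) := by field_simp; norm_num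
      _ ≤ _ := mul_le_mul h1 h2 (by positivity) (kern_nonneg _ _ _)
  set q : ℝ := Real.exp (-(4 * B / m)) with hq
  have hfac : ∀ k, (if (S k).Nonempty then q else 1) ≤ 1 - ∑ c ∈ S k, kern m t (c - y k) := by
    intro k
    split_ifs with hne
    · have h3 : ∑ c ∈ S k, kern m t (c - y k) ≤ 2 * B / m := by
        calc _ ≤ ∑ c ∈ S k, (2 / m : ℝ) := Finset.sum_le_sum fun c _ => kern_le_of_mixed m t ht _
          _ = (S k).card * (2 / m) := by simp
          _ ≤ B * (2 / m) := by gcongr; exact hB k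
          _ = _ := by ring
      have h4 : 2 * B / m ≤ 1 / 2 := by rw [div_le_div_iff₀ hm0 two_pos]; linarith
      have h5 : q ≤ 1 - 2 * B / m := by
        set z := 2 * B / m with hz
        have hz0 : 0 ≤ z := by positivity
        have e : q = (Real.exp (2 * z))⁻¹ := by
          rw [hq, ← Real.exp_neg]; congr 1; rw [hz]; ring
        rw [e, inv_le_iff_one_le_mul₀ (Real.exp_pos _)]
        have := Real.add_one_le_exp (2 * z)
        nlinarith
      linarith
    · rw [Finset.not_nonempty_iff_eq_empty] at hne
      simp [hne]
  have h3 : Real.exp (-(4 * B * κ)) ≤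
      ∏ k ∈ (Finset.univ.erase u).erase v, (1 - ∑ c ∈ S k, kern m t (c - y k)) := by
    have hq0 : 0 < q := Real.exp_pos _
    have hq1 : q ≤ 1 := by
      rw [hq, Real.exp_le_one_iff]; have : 0 ≤ 4 * B / m := by positivity
      linarith
    calc Real.exp (-(4 * B * κ)) ≤ q ^ (Finset.univ.filter fun k => (S k).Nonempty).card := by
          rw [hq, ← Real.exp_nat_mul, Real.exp_le_exp]
          have : 4 * B / m * ((Finset.univ.filter fun k => (S k).Nonempty).card : ℝ)
              ≤ 4 * B / m * (κ * m) := by gcongr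
          have e : 4 * B / m * (κ * m) = 4 * B * κ := by field_simp
          linarith
      _ = ∏ k, (if (S k).Nonempty then q else 1) := by
          rw [Finset.prod_ite, Finset.prod_const, Finset.prod_const_one, mul_one]
      _ ≤ ∏ k ∈ (Finset.univ.erase u).erase v, (if (S k).Nonempty then q else 1) := by
          refine Finset.prod_le_prod_of_subset_of_le_one (Finset.subset_univ _) (fun k _ => ?_)
            fun k _ _ => ?_
          · split_ifs <;> positivity
          · split_ifs <;> linarith
      _ ≤ _ := by
          refine Finset.prod_le_prod (fun k _ => ?_) fun k _ => hfac k
          split_ifs <;> positivity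
  calc Real.exp (-(4 * B * κ)) / (4 * m ^ 2) = 1 / (4 * m ^ 2) * Real.exp (-(4 * B * κ)) := by ring
    _ ≤ _ := mul_le_mul h12 h3 (Real.exp_pos _).le
      (mul_nonneg (kern_nonneg _ _ _) (kern_nonneg _ _ _))

/-- The square of `1/m + 3/√t` is at most `2/m² + 18/t`, and the second part sums to a harmonic
number. Time zero is left out because the kernel bound needs positive time. -/
lemma sum_evolve_succ_meet_le (L : ℕ) (u v : ι) (huv : u ≠ v) (a b : ZMod m) (y : ι → ZMod m) :
    ∑ t ∈ Finset.range L, evolve (t + 1) (meet u v a b) y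
      ≤ 2 * L / m ^ 2 + 18 * (1 + Real.log L) := by
  have hm0 : (0 : ℝ) < m := by exact_mod_cast NeZero.pos m
  have h1 : ∀ t ∈ Finset.range L, evolve (t + 1) (meet u v a b) y
      ≤ 2 / m ^ 2 + 18 * ((t + 1 : ℕ) : ℝ)⁻¹ := by
    intro t _
    rw [evolve_meet _ u v huv]
    have ha := kern_le m (t + 1) (Nat.succ_pos t) (a - y u)
    have hb := kern_le m (t + 1) (Nat.succ_pos t) (b - y v)
    have ha0 := kern_nonneg m (t + 1) (a - y u)
    have hb0 := kern_nonneg m (t + 1) (b - y v)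
    set w : ℝ := 3 / √((t + 1 : ℕ) : ℝ) with hw
    have hw2 : w ^ 2 = 9 * ((t + 1 : ℕ) : ℝ)⁻¹ := by
      rw [hw, div_pow, Real.sq_sqrt (by positivity)]; ring
    calc _ ≤ (1 / m + w) * (1 / m + w) := mul_le_mul ha hb hb0 (ha0.trans ha)
      _ ≤ 2 * (1 / m) ^ 2 + 2 * w ^ 2 := by nlinarith [sq_nonneg (1 / (m : ℝ) - w)]
      _ = _ := by rw [hw2]; ring
  refine (Finset.sum_le_sum h1).trans ?_
  rw [Finset.sum_add_distrib, ← Finset.mul_sum]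
  have h2 := harmonic_le_one_add_log L
  have h3 : ((harmonic L : ℚ) : ℝ) = ∑ t ∈ Finset.range L, ((t + 1 : ℕ) : ℝ)⁻¹ := by
    simp [harmonic]
  rw [← h3]
  have h4 : ∑ t ∈ Finset.range L, (2 : ℝ) / m ^ 2 = 2 * L / m ^ 2 := by
    rw [Finset.sum_const, Finset.card_range, nsmul_eq_mul]; ring
  rw [h4]
  linarith

lemma sum_range_le_add_sum_succ (f : ℕ → ℝ) (hf : ∀ t, 0 ≤ f t) (L : ℕ) :
    ∑ t ∈ Finset.range L, f t ≤ f 0 + ∑ t ∈ Finset.range L, f (t + 1) := by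
  have := Finset.sum_range_succ' f L
  rw [Finset.sum_range_succ] at this
  linarith [hf L]

lemma green_meet_le (L : ℕ) (u v : ι) (huv : u ≠ v) (a b : ZMod m) (y : ι → ZMod m) :
    green L (meet u v a b) y ≤ 2 * L / m ^ 2 + 19 * (1 + Real.log L) := by
  have h0 := meet_nonneg (ι := ι) u v a b
  have h1 := green_le L h0 y
  have h2 := sum_range_le_add_sum_succ (fun t => evolve t (meet u v a b) y)
    (fun t => evolve_nonneg t h0 y) L
  have h3 := sum_evolve_succ_meet_le L u v huv a b y
  have h4 : evolve 0 (meet u v a b) y ≤ 1 := by rw [evolve_zero]; exact meet_le_one u v a b y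
  have h5 : 0 ≤ Real.log L := Real.log_natCast_nonneg L
  linarith

/-- Only the even times up to `L / 2` are kept. There the weight is at least `1/2`, and the product
of the two return probabilities is at least `1 / (180 (j + 1))` at time `2 (j + 1)`. -/
lemma le_green_meet_self (L : ℕ) (hL : 0 < L) (u v : ι) (huv : u ≠ v) (y : ι → ZMod m) :
    Real.log (L / 4) / 360 ≤ green L (meet u v (y u) (y v)) y := by
  set M := L / 4 with hM
  have hL0 : (0 : ℝ) < L := by exact_mod_cast hL
  have h0 := meet_nonneg (ι := ι) u v (y u) (y v)
  have hterm : ∀ j ∈ Finset.range M, (1 / 360 : ℝ) * ((j + 1 : ℕ) : ℝ)⁻¹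
      ≤ (1 - ((2 * (j + 1) : ℕ) : ℝ) / L) * evolve (2 * (j + 1)) (meet u v (y u) (y v)) y := by
    intro j hj
    have hj' : 4 * (j + 1) ≤ L := by rw [Finset.mem_range] at hj; omega
    have h1 : (1 : ℝ) / 2 ≤ 1 - ((2 * (j + 1) : ℕ) : ℝ) / L := by
      have : ((2 * (j + 1) : ℕ) : ℝ) / L ≤ 1 / 2 := by
        rw [div_le_div_iff₀ hL0 two_pos]
        have : ((4 * (j + 1) : ℕ) : ℝ) ≤ L := by exact_mod_cast hj'
        push_cast at this ⊢; linarith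
      linarith
    rw [evolve_meet _ u v huv, sub_self, sub_self]
    have h2 := le_kern_two_mul_zero m (j + 1) (Nat.succ_pos j)
    set s := √((2 * (j + 1) : ℕ) : ℝ) with hs
    have hs2 : s ^ 2 = 2 * ((j + 1 : ℕ) : ℝ) := by
      rw [hs, Real.sq_sqrt (by positivity)]; push_cast; ring
    have hs0 : 0 < s := Real.sqrt_pos.2 (by positivity)
    have hpi : Real.pi ^ 2 ≤ 10 := by nlinarith [Real.pi_gt_three, Real.pi_lt_d2]
    have h3 : (1 / 180 : ℝ) * ((j + 1 : ℕ) : ℝ)⁻¹ ≤ 1 / (3 * Real.pi * s) * (1 / (3 * Real.pi * s)) := by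
      have e : 1 / (3 * Real.pi * s) * (1 / (3 * Real.pi * s)) = 1 / (9 * Real.pi ^ 2 * s ^ 2) := by
        field_simp; norm_num
      rw [e, hs2, ← one_div, div_mul_div_comm]
      apply div_le_div₀ (by norm_num) (by norm_num) (by positivity)
      have : (0 : ℝ) < ((j + 1 : ℕ) : ℝ) := by positivity
      nlinarith
    have h4 := mul_le_mul h2 h2 (by positivity) (kern_nonneg _ _ _)
    calc _ = 1 / 2 * ((1 / 180 : ℝ) * ((j + 1 : ℕ) : ℝ)⁻¹) := by ring
      _ ≤ _ := mul_le_mul h1 (h3.trans h4) (by positivity) (by linarith)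
  have hinj : Set.InjOn (fun j => 2 * (j + 1)) (Finset.range M : Set ℕ) := by
    intro i _ j _ h; simp at h; exact h
  have h5 : ∑ j ∈ Finset.range M, (1 / 360 : ℝ) * ((j + 1 : ℕ) : ℝ)⁻¹
      ≤ green L (meet u v (y u) (y v)) y := by
    refine (Finset.sum_le_sum hterm).trans ?_
    rw [← Finset.sum_image (f := fun t : ℕ => (1 - (t : ℝ) / L) *
      evolve t (meet u v (y u) (y v)) y) hinj]
    refine Finset.sum_le_sum_of_subset_of_nonneg ?_ fun t ht _ => ?_
    · intro t ht
      simp only [Finset.mem_image, Finset.mem_range] at ht ⊢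
      omega
    · refine mul_nonneg ?_ (evolve_nonneg t h0 y)
      have h1 : (t : ℝ) ≤ L := by exact_mod_cast (Finset.mem_range.1 ht).le
      have := div_le_one_of_le₀ h1 (Nat.cast_nonneg L)
      linarith
  refine le_trans ?_ h5
  rw [← Finset.mul_sum]
  have h6 : ∑ j ∈ Finset.range M, ((j + 1 : ℕ) : ℝ)⁻¹ = ((harmonic M : ℚ) : ℝ) := by
    simp [harmonic]
  have h7 := log_add_one_le_harmonic M
  have h8 : Real.log (L / 4) ≤ Real.log (M + 1 : ℕ) := by
    refine Real.log_le_log (by positivity) ?_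
    have : L ≤ 4 * (M + 1) := by omega
    have : (L : ℝ) ≤ 4 * ((M + 1 : ℕ) : ℝ) := by exact_mod_cast this
    linarith
  rw [h6]
  linarith

lemma sum_inv_sqrt_le (L : ℕ) : ∑ t ∈ Finset.range L, 1 / √((t + 1 : ℕ) : ℝ) ≤ 2 * √L := by
  induction L with
  | zero => simp
  | succ L ih =>
    rw [Finset.sum_range_succ]
    set a := √(L : ℝ) with ha
    set b := √((L + 1 : ℕ) : ℝ) with hb
    have ha0 : 0 ≤ a := Real.sqrt_nonneg _
    have hb0 : 0 < b := Real.sqrt_pos.2 (by positivity)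
    have ha2 : a ^ 2 = L := Real.sq_sqrt (by positivity)
    have hb2 : b ^ 2 = L + 1 := by rw [hb, Real.sq_sqrt (by positivity)]; push_cast; ring
    have : 1 / b ≤ 2 * b - 2 * a := by
      rw [div_le_iff₀ hb0]; nlinarith [sq_nonneg (a - b)]
    linarith

lemma sum_kern_range_le (L : ℕ) (x : ZMod m) :
    ∑ t ∈ Finset.range L, kern m t x ≤ 1 + L / m + 6 * √L := by
  have h1 := sum_range_le_add_sum_succ (fun t => kern m t x) (fun t => kern_nonneg m t x) L
  have h2 : kern m 0 x ≤ 1 := by unfold kern; split_ifs <;> norm_num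
  have h3 : ∑ t ∈ Finset.range L, kern m (t + 1) x
      ≤ ∑ t ∈ Finset.range L, (1 / m + 3 * (1 / √((t + 1 : ℕ) : ℝ))) :=
    Finset.sum_le_sum fun t _ => (kern_le m (t + 1) (Nat.succ_pos t) x).trans (le_of_eq (by ring))
  rw [Finset.sum_add_distrib, ← Finset.mul_sum, Finset.sum_const, Finset.card_range,
    nsmul_eq_mul] at h3
  have h4 := sum_inv_sqrt_le L
  have e : (L : ℝ) * (1 / m) = L / m := by ring
  linarith

/-- Summing over the start of `v` replaces its factor by one, so what remains is the Green function
of a single walk. After division by `m` this beats the bound for the worst start of `v`, and the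
lower bound rests on that gain. -/
lemma sum_green_meet_update_le (L : ℕ) (u v : ι) (huv : u ≠ v) (a b : ZMod m) (y : ι → ZMod m) :
    ∑ c, green L (meet u v a b) (Function.update y v c) ≤ 1 + L / m + 6 * √L := by
  refine le_trans ?_ (sum_kern_range_le L (a - y u))
  refine (Finset.sum_le_sum fun c _ => green_le L (meet_nonneg u v a b) _).trans (le_of_eq ?_)
  rw [Finset.sum_comm]
  refine Finset.sum_congr rfl fun t _ => ?_
  simp only [evolve_meet t u v huv, Function.update_self, Function.update_of_ne huv]
  rw [← Finset.mul_sum, sum_kern_sub', mul_one]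

end Evolution

/-! ### A maximal ergodic inequality -/

section Ergodic

variable {Ω : Type*} [MeasurableSpace Ω]

/-- The mean of `f` over the first `N` points of the orbit of `ω`. -/
def orbitMean (θ : Ω → Ω) (f : Ω → ℝ≥0∞) (N : ℕ) (ω : Ω) : ℝ≥0∞ :=
  (∑ i ∈ Finset.range N, f (θ^[i] ω)) / N

lemma measurable_orbitSum {θ : Ω → Ω} (hθ : Measurable θ) {f : Ω → ℝ≥0∞} (hf : Measurable f)
    (N : ℕ) : Measurable fun ω => ∑ i ∈ Finset.range N, f (θ^[i] ω) :=
  Finset.measurable_sum _ fun i _ => hf.comp (hθ.iterate i)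

lemma measurable_limsup_orbitMean {θ : Ω → Ω} (hθ : Measurable θ) {f : Ω → ℝ≥0∞}
    (hf : Measurable f) : Measurable fun ω => limsup (fun N => orbitMean θ f N ω) atTop :=
  Measurable.limsup fun N => (measurable_orbitSum hθ hf N).div_const _

/-- Omitting the first value of a mean changes nothing in the limit if this value is finite. One
inequality suffices here: the limsup can only increase along the orbit. -/
lemma limsup_orbitMean_le_comp (θ : Ω → Ω) (f : Ω → ℝ≥0∞) (ω : Ω) (hω : f ω ≠ ∞) :
    limsup (fun N => orbitMean θ f N ω) atTop ≤ limsup (fun N => orbitMean θ f N (θ ω)) atTop := by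
  set g := limsup (fun N => orbitMean θ f N (θ ω)) atTop with hg
  rcases eq_or_ne g ∞ with h | hfin
  · rw [h]; exact le_top
  refine ENNReal.le_of_forall_pos_le_add fun ε hε _ => ?_
  have hε2 : (0 : ℝ≥0∞) < ε / 2 := by simpa using hε.ne'
  have h1 : ∀ᶠ N in atTop, orbitMean θ f N (θ ω) < g + ε / 2 :=
    eventually_lt_of_limsup_lt (ENNReal.lt_add_right hfin hε2.ne')
  have h2 : ∀ᶠ N : ℕ in atTop, f ω / ((N + 1 : ℕ) : ℝ≥0∞) ≤ ε / 2 := by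
    have h3 : Tendsto (fun N : ℕ => f ω / ((N + 1 : ℕ) : ℝ≥0∞)) atTop (nhds 0) := by
      have h4 : Tendsto (fun N : ℕ => ((N + 1 : ℕ) : ℝ≥0∞)) atTop (nhds ∞) :=
        ENNReal.tendsto_nat_nhds_top.comp (tendsto_add_atTop_nat 1)
      have := ENNReal.Tendsto.const_div (a := f ω) h4 (Or.inr hω)
      simpa using this
    exact h3.eventually_le_const hε2
  have h5 : ∀ᶠ N in atTop, orbitMean θ f (N + 1) ω ≤ g + ε := by
    filter_upwards [h1, h2] with N hN1 hN2
    unfold orbitMean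
    rw [Finset.sum_range_succ', ENNReal.add_div, add_comm]
    calc _ ≤ ε / 2 + orbitMean θ f N (θ ω) := by
          refine add_le_add hN2 ?_
          unfold orbitMean
          refine ENNReal.div_le_div (le_of_eq ?_) (by exact_mod_cast Nat.le_succ N)
          exact Finset.sum_congr rfl fun i _ => by rw [Function.iterate_succ_apply]
      _ ≤ ε / 2 + (g + ε / 2) := by gcongr
      _ = g + ε := by rw [add_left_comm, ENNReal.add_halves]
  refine limsup_le_of_le (h := ?_)
  have := (eventually_atTop.1 h5)
  obtain ⟨N₀, h6⟩ := this
  filter_upwards [eventually_ge_atTop (N₀ + 1)] with N hN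
  obtain ⟨k, rfl⟩ : ∃ k, N = k + 1 := ⟨N - 1, by omega⟩
  exact h6 k (by omega)

/-- The orbit is cut into blocks of length at most `K` on which the mean of `f` is at least the
level `c`, a truncated and slightly lowered copy of the limsup. The points of `B K`, from which no
such block starts, are charged the upper bound `M` of `c`, and their measure tends to zero as `K`
grows. -/
lemma lintegral_limsup_orbitMean_le_of_finite {μ : Measure Ω} [IsProbabilityMeasure μ] {θ : Ω → Ω}
    (hθ : MeasurePreserving θ μ μ) {f : Ω → ℝ≥0∞} (hf : Measurable f) (hfin : ∀ ω, f ω ≠ ∞) :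
    ∫⁻ ω, limsup (fun N => orbitMean θ f N ω) atTop ∂μ ≤ ∫⁻ ω, f ω ∂μ := by
  set g := fun ω => limsup (fun N => orbitMean θ f N ω) atTop with hg
  have hgm : Measurable g := measurable_limsup_orbitMean hθ.measurable hf
  have hginv : ∀ j ω, g ω ≤ g (θ^[j] ω) := by
    intro j
    induction j with
    | zero => intro ω; exact le_rfl
    | succ j ih =>
      intro ω
      rw [Function.iterate_succ_apply]
      exact (limsup_orbitMean_le_comp θ f ω (hfin ω)).trans (ih _)
  -- The truncation at `M` keeps the charge of exceptional points finite. Subtracting `ε` puts the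
  -- level strictly below the limsup where it is positive, so that every point has a good block of
  -- some length.
  have key : ∀ (M : ℕ) (ε : NNReal), 0 < ε →
      ∫⁻ ω, (min (g ω) M - ε) ∂μ ≤ ∫⁻ ω, f ω ∂μ := by
    intro M ε hε
    set c : Ω → ℝ≥0∞ := fun ω => min (g ω) M - ε with hc
    have hcm : Measurable c := (hgm.min measurable_const).sub_const _
    have hcM : ∀ ω, c ω ≤ M := fun ω => tsub_le_self.trans (min_le_right _ _)
    have hcinv : ∀ j ω, c ω ≤ c (θ^[j] ω) := fun j ω =>
      tsub_le_tsub_right (min_le_min_right _ (hginv j ω)) _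
    set B : ℕ → Set Ω := fun K => {ω | ∀ n ∈ Finset.Icc 1 K,
      ∑ i ∈ Finset.range n, f (θ^[i] ω) < n * c ω} with hB
    have hBm : ∀ K, MeasurableSet (B K) := by
      intro K
      have : B K = ⋂ n ∈ Finset.Icc 1 K,
          {ω | ∑ i ∈ Finset.range n, f (θ^[i] ω) < n * c ω} := by
        ext ω; simp [hB]
      rw [this]
      exact Finset.measurableSet_biInter _ fun n _ =>
        measurableSet_lt (measurable_orbitSum hθ.measurable hf n) (hcm.const_mul _)
    have hBanti : Antitone B := by
      intro K K' hK ω hω n hn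
      exact hω n (Finset.Icc_subset_Icc_right hK hn)
    have hBempty : ⋂ K, B K = ∅ := by
      rw [Set.eq_empty_iff_forall_notMem]
      intro ω hω
      rw [Set.mem_iInter] at hω
      have hall : ∀ n, 1 ≤ n → ∑ i ∈ Finset.range n, f (θ^[i] ω) < n * c ω := fun n hn =>
        hω n n (Finset.mem_Icc.2 ⟨hn, le_rfl⟩)
      have hc0 : c ω ≠ 0 := by
        intro h
        have := hall 1 le_rfl
        rw [h, mul_zero] at this
        exact not_lt_zero this
      have hmin : min (g ω) M ≠ 0 := by
        intro h; apply hc0; simp only [hc]; rw [h]; simp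
      have hlt : c ω < g ω := by
        refine lt_of_lt_of_le (ENNReal.sub_lt_self ?_ hmin ?_) (min_le_left _ _)
        · exact ne_top_of_le_ne_top (ENNReal.natCast_ne_top M) (min_le_right _ _)
        · exact_mod_cast hε.ne'
      have hfr := frequently_lt_of_lt_limsup (h := hlt)
      obtain ⟨n, hn1, hn2⟩ := (hfr.and_eventually (eventually_ge_atTop 1)).exists
      have := hall n hn2
      have hn0 : (n : ℝ≥0∞) ≠ 0 := by exact_mod_cast (by omega : n ≠ 0)
      rw [mul_comm, ← ENNReal.div_lt_iff (Or.inl hn0) (Or.inl (ENNReal.natCast_ne_top n))] at this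
      exact lt_asymm this hn1
    -- Greedy covering of the first `L` points of the orbit; the incomplete block at the end
    -- accounts for `K * M`.
    have hpt : ∀ (K L : ℕ) (ω : Ω), L * c ω ≤
        ∑ i ∈ Finset.range L, (f (θ^[i] ω) + (B K).indicator (fun _ => (M : ℝ≥0∞)) (θ^[i] ω))
          + K * M := by
      intro K L
      induction L using Nat.strong_induction_on with
      | _ L ih =>
        intro ω
        by_cases hLK : L ≤ K
        · refine le_trans ?_ le_add_self
          exact mul_le_mul' (by exact_mod_cast hLK) (hcM ω)
        · have hstep : ∀ n, 1 ≤ n → n ≤ L → n * c ω ≤ ∑ i ∈ Finset.range n,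
              (f (θ^[i] ω) + (B K).indicator (fun _ => (M : ℝ≥0∞)) (θ^[i] ω)) →
              L * c ω ≤ ∑ i ∈ Finset.range L,
                (f (θ^[i] ω) + (B K).indicator (fun _ => (M : ℝ≥0∞)) (θ^[i] ω)) + K * M := by
            intro n hn1 hnL h
            have h2 := ih (L - n) (by omega) (θ^[n] ω)
            have e : L = n + (L - n) := by omega
            have h3 : (L : ℝ≥0∞) * c ω = n * c ω + ((L - n : ℕ) : ℝ≥0∞) * c ω := by
              rw [← add_mul, ← Nat.cast_add, ← e]
            rw [h3]
            conv_rhs => rw [e, Finset.sum_range_add, add_assoc]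
            refine add_le_add h (le_trans ?_ (h2.trans (le_of_eq ?_)))
            · gcongr; exact hcinv n ω
            · congr 1
              refine Finset.sum_congr rfl fun i _ => ?_
              rw [← Function.iterate_add_apply, add_comm i n]
          by_cases hω : ω ∈ B K
          · refine hstep 1 le_rfl (by omega) ?_
            simp only [Finset.range_one, Finset.sum_singleton, Function.iterate_zero, id]
            rw [Set.indicator_of_mem hω]
            simpa using (hcM ω).trans le_add_self
          · simp only [hB, Set.mem_ofPred_eq, not_forall, not_lt] at hω
            obtain ⟨n, hn, hle⟩ := hω
            rw [Finset.mem_Icc] at hn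
            refine hstep n hn.1 (by omega) (hle.trans ?_)
            exact Finset.sum_le_sum fun i _ => le_self_add
    have hmass : ∀ (K L : ℕ), (L : ℝ≥0∞) * ∫⁻ ω, c ω ∂μ
        ≤ L * (∫⁻ ω, f ω ∂μ + M * μ (B K)) + K * M := by
      intro K L
      have hind : Measurable ((B K).indicator fun _ => (M : ℝ≥0∞)) :=
        measurable_const.indicator (hBm K)
      calc (L : ℝ≥0∞) * ∫⁻ ω, c ω ∂μ = ∫⁻ ω, L * c ω ∂μ := (lintegral_const_mul _ hcm).symm
        _ ≤ ∫⁻ ω, (∑ i ∈ Finset.range L,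
            (f (θ^[i] ω) + (B K).indicator (fun _ => (M : ℝ≥0∞)) (θ^[i] ω)) + K * M) ∂μ :=
            lintegral_mono fun ω => hpt K L ω
        _ = ∑ i ∈ Finset.range L, (∫⁻ ω, f (θ^[i] ω) ∂μ +
              ∫⁻ ω, (B K).indicator (fun _ => (M : ℝ≥0∞)) (θ^[i] ω) ∂μ) + K * M := by
            rw [lintegral_add_right _ measurable_const, lintegral_const, measure_univ, mul_one,
              lintegral_finsetSum]
            · congr 1
              refine Finset.sum_congr rfl fun i _ => ?_
              exact lintegral_add_left (hf.comp (hθ.measurable.iterate i)) _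
            · exact fun i _ => (hf.comp (hθ.measurable.iterate i)).add
                (hind.comp (hθ.measurable.iterate i))
        _ = _ := by
            congr 1
            rw [Finset.sum_congr rfl fun i _ => by
              rw [(hθ.iterate i).lintegral_comp hf, (hθ.iterate i).lintegral_comp hind,
                lintegral_indicator_const (hBm K)]]
            simp [mul_add]
    have hK : ∀ K : ℕ, ∫⁻ ω, c ω ∂μ ≤ ∫⁻ ω, f ω ∂μ + M * μ (B K) := by
      intro K
      have h1 : ∀ L : ℕ, 0 < L → ∫⁻ ω, c ω ∂μ ≤ ∫⁻ ω, f ω ∂μ + M * μ (B K) + (K * M) / (L : ℝ≥0∞) := by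
        intro L hL
        have hL0 : (L : ℝ≥0∞) ≠ 0 := by exact_mod_cast hL.ne'
        have hLt := ENNReal.natCast_ne_top L
        have := hmass K L
        rw [mul_comm, ← ENNReal.le_div_iff_mul_le (Or.inl hL0) (Or.inl hLt), ENNReal.add_div,
          mul_div_assoc, mul_comm, ENNReal.div_mul_cancel hL0 hLt] at this
        exact this
      have h2 : Tendsto (fun L : ℕ => ∫⁻ ω, f ω ∂μ + M * μ (B K) + (K * M) / (L : ℝ≥0∞)) atTop
          (nhds (∫⁻ ω, f ω ∂μ + M * μ (B K) + 0)) := by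
        refine Tendsto.const_add _ ?_
        have := ENNReal.Tendsto.const_div (a := (K : ℝ≥0∞) * M) ENNReal.tendsto_nat_nhds_top
          (Or.inr (ENNReal.mul_ne_top (ENNReal.natCast_ne_top K) (ENNReal.natCast_ne_top M)))
        simpa using this
      rw [add_zero] at h2
      exact ge_of_tendsto h2 ((eventually_gt_atTop 0).mono h1)
    have h3 : Tendsto (fun K => ∫⁻ ω, f ω ∂μ + M * μ (B K)) atTop
        (nhds (∫⁻ ω, f ω ∂μ + M * 0)) := by
      refine Tendsto.const_add _ (ENNReal.Tendsto.const_mul ?_ (Or.inr (ENNReal.natCast_ne_top M)))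
      have := tendsto_measure_iInter_atTop (μ := μ) (fun K => (hBm K).nullMeasurableSet) hBanti
        ⟨0, measure_ne_top _ _⟩
      rwa [hBempty, measure_empty] at this
    rw [mul_zero, add_zero] at h3
    exact ge_of_tendsto' h3 hK
  have h1 : ∀ M : ℕ, ∫⁻ ω, min (g ω) M ∂μ ≤ ∫⁻ ω, f ω ∂μ := by
    intro M
    refine ENNReal.le_of_forall_pos_le_add fun ε hε _ => ?_
    calc ∫⁻ ω, min (g ω) M ∂μ ≤ ∫⁻ ω, ((min (g ω) M - ε) + ε) ∂μ :=
          lintegral_mono fun ω => le_tsub_add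
      _ = ∫⁻ ω, (min (g ω) M - ε) ∂μ + ε := by
          rw [lintegral_add_right _ measurable_const]; simp
      _ ≤ _ := add_le_add_left (key M ε hε) _
  have h2 : ∀ ω, g ω = ⨆ M : ℕ, min (g ω) M := by
    intro ω
    refine le_antisymm ?_ (iSup_le fun M => min_le_left _ _)
    have : (⨆ M : ℕ, min (g ω) (M : ℝ≥0∞)) = min (g ω) (⨆ M : ℕ, (M : ℝ≥0∞)) := by
      exact (inf_iSup_eq _ _).symm
    rw [this, ENNReal.iSup_natCast, min_eq_left le_top]
  calc ∫⁻ ω, g ω ∂μ = ∫⁻ ω, ⨆ M : ℕ, min (g ω) M ∂μ := lintegral_congr h2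
    _ = ⨆ M : ℕ, ∫⁻ ω, min (g ω) M ∂μ := by
        refine lintegral_iSup (fun M => hgm.min measurable_const) ?_
        intro M M' hM ω
        exact min_le_min_left _ (by exact_mod_cast hM)
    _ ≤ _ := iSup_le h1

/-- The upper mean of a non-negative function along the orbits of a measure preserving map has at
most the integral of the function. -/
theorem lintegral_limsup_orbitMean_le {μ : Measure Ω} [IsProbabilityMeasure μ] {θ : Ω → Ω}
    (hθ : MeasurePreserving θ μ μ) {f : Ω → ℝ≥0∞} (hf : Measurable f) :
    ∫⁻ ω, limsup (fun N => orbitMean θ f N ω) atTop ∂μ ≤ ∫⁻ ω, f ω ∂μ := by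
  by_cases hinf : ∫⁻ ω, f ω ∂μ = ∞
  · rw [hinf]; exact le_top
  -- An integrable function is infinite only on a null set, and the preimages of this set under all
  -- iterates are null as well.
  set f' : Ω → ℝ≥0∞ := fun ω => if f ω = ∞ then 0 else f ω with hf'
  have hf'm : Measurable f' := Measurable.ite (hf (measurableSet_singleton ∞)) measurable_const hf
  have hae : ∀ᵐ ω ∂μ, f ω = f' ω := by
    filter_upwards [ae_lt_top hf hinf] with ω hω
    simp [hf', hω.ne]
  have hall : ∀ᵐ ω ∂μ, ∀ i : ℕ, f (θ^[i] ω) = f' (θ^[i] ω) :=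
    ae_all_iff.2 fun i => (hθ.iterate i).quasiMeasurePreserving.ae hae
  have h := lintegral_limsup_orbitMean_le_of_finite hθ hf'm
    (fun ω => by simp only [hf']; split_ifs <;> simp_all)
  rw [lintegral_congr_ae hae]
  refine le_trans (le_of_eq (lintegral_congr_ae ?_)) h
  filter_upwards [hall] with ω hω
  simp only [orbitMean, hω]

end Ergodic

/-! ### Sequences of independent coins -/

section Coins

variable {X : Type*} [MeasurableSpace X]

/-- Prepend an element to a sequence. -/
def seqCons (p : X × (ℕ → X)) : ℕ → X := fun t => Nat.casesOn t p.1 p.2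

lemma measurable_seqCons : Measurable (seqCons (X := X)) := by
  refine measurable_pi_iff.2 fun t => ?_
  cases t with
  | zero => exact measurable_fst
  | succ t => exact (measurable_pi_apply t).comp measurable_snd

lemma map_seqCons (ν : Measure X) [IsProbabilityMeasure ν] :
    (ν.prod (Measure.infinitePi fun _ : ℕ => ν)).map seqCons = Measure.infinitePi fun _ => ν := by
  refine Measure.eq_infinitePi _ fun s t ht => ?_
  rw [Measure.map_apply measurable_seqCons (MeasurableSet.pi (Finset.countable_toSet s)
    fun i _ => ht i)]
  classical
  -- The cylinder is rewritten over an initial segment of indices, from which coordinate zero can be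
  -- split off.
  set t' : ℕ → Set X := fun i => if i ∈ s then t i else Set.univ with ht'
  set N := s.sup id + 1 with hN
  have hmem : ∀ i ∈ s, i < N := fun i hi => Nat.lt_succ_of_le (Finset.le_sup (f := id) hi)
  have hset : seqCons ⁻¹' (Set.pi s t)
      = t' 0 ×ˢ Set.pi (Finset.range N : Set ℕ) fun i => t' (i + 1) := by
    ext ⟨a, b⟩
    simp only [Set.mem_preimage, Set.mem_pi, Set.mem_prod, Finset.mem_coe, Finset.mem_range, ht']
    constructor
    · intro h
      refine ⟨?_, fun i _ => ?_⟩
      · split_ifs with h0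
        · exact h 0 h0
        · trivial
      · split_ifs with h0
        · exact h (i + 1) h0
        · trivial
    · rintro ⟨h0, h1⟩ i hi
      cases i with
      | zero => simpa [hi, seqCons] using h0
      | succ i =>
        have := h1 i (by have := hmem _ hi; omega)
        simpa [hi, seqCons] using this
  have ht'm : ∀ i, MeasurableSet (t' i) := fun i => by
    simp only [ht']; split_ifs
    · exact ht i
    · exact MeasurableSet.univ
  rw [hset, Measure.prod_prod, Measure.infinitePi_pi _ (fun i _ => ht'm _)]
  have e : ν (t' 0) * ∏ i ∈ Finset.range N, ν (t' (i + 1)) = ∏ i ∈ Finset.range (N + 1), ν (t' i) := by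
    rw [Finset.prod_range_succ' _ N, mul_comm]
  rw [e]
  have hsub : s ⊆ Finset.range (N + 1) := fun i hi => Finset.mem_range.2 (by
    have := hmem i hi; omega)
  rw [← Finset.prod_subset hsub (f := fun i => ν (t' i))]
  · exact Finset.prod_congr rfl fun i hi => by simp [ht', hi]
  · intro i _ hi; simp [ht', hi]

lemma measurePreserving_seqCons (ν : Measure X) [IsProbabilityMeasure ν] :
    MeasurePreserving seqCons (ν.prod (Measure.infinitePi fun _ : ℕ => ν))
      (Measure.infinitePi fun _ => ν) := ⟨measurable_seqCons, map_seqCons ν⟩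

/-- Conditioning on the first coin. This is the form of the Markov property on which the inductions
over time rely. -/
lemma lintegral_infinitePi_eq (ν : Measure X) [IsProbabilityMeasure ν] {F : (ℕ → X) → ℝ≥0∞}
    (hF : Measurable F) :
    ∫⁻ ω, F ω ∂(Measure.infinitePi fun _ => ν)
      = ∫⁻ ξ, ∫⁻ ω, F (seqCons (ξ, ω)) ∂(Measure.infinitePi fun _ => ν) ∂ν := by
  rw [← (measurePreserving_seqCons ν).lintegral_comp hF]
  exact lintegral_prod _ (hF.comp measurable_seqCons).aemeasurable

variable {S : Type*} (next : S → X → S)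

/-- The states visited from `x` when the coins are `ω`. -/
def orbit : ℕ → S → (ℕ → X) → S
  | 0, x, _ => x
  | t + 1, x, ω => orbit t (next x (ω 0)) fun k => ω (k + 1)

/-- The product of the weights `ρ` along the first `t` steps. -/
def orbitWeight (ρ : S → X → ℝ≥0∞) : ℕ → S → (ℕ → X) → ℝ≥0∞
  | 0, _, _ => 1
  | t + 1, x, ω => ρ x (ω 0) * orbitWeight ρ t (next x (ω 0)) fun k => ω (k + 1)

lemma orbit_succ (t : ℕ) (x : S) (ω : ℕ → X) :
    orbit next (t + 1) x ω = next (orbit next t x ω) (ω t) := by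
  induction t generalizing x ω with
  | zero => rfl
  | succ t ih =>
    rw [orbit, ih]; rfl

lemma orbit_seqCons (t : ℕ) (x : S) (ξ : X) (ω : ℕ → X) :
    orbit next (t + 1) x (seqCons (ξ, ω)) = orbit next t (next x ξ) ω := rfl

lemma orbitWeight_eq_prod (ρ : S → X → ℝ≥0∞) (t : ℕ) (x : S) (ω : ℕ → X) :
    orbitWeight next ρ t x ω = ∏ u ∈ Finset.range t, ρ (orbit next u x ω) (ω u) := by
  induction t generalizing x ω with
  | zero => rfl
  | succ t ih =>
    rw [orbitWeight, ih, Finset.prod_range_succ', mul_comm]; rfl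

variable [Countable X] [MeasurableSingletonClass X]

/-- A function of finitely many coins is measurable. -/
lemma measurable_of_head_tail {Y : Type*} [MeasurableSpace Y] {F : X → (ℕ → X) → Y}
    (hF : ∀ ξ, Measurable (F ξ)) : Measurable fun ω : ℕ → X => F (ω 0) fun k => ω (k + 1) := by
  have h1 : Measurable fun p : X × (ℕ → X) => F p.1 p.2 := measurable_from_prod_countable_right hF
  have h2 : Measurable fun ω : ℕ → X => (ω 0, fun k => ω (k + 1)) := (measurable_pi_apply 0).prodMk
    (measurable_pi_iff.2 fun k => measurable_pi_apply (k + 1))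
  exact h1.comp h2

lemma measurable_orbit_comp {Y : Type*} [MeasurableSpace Y] (t : ℕ) (x : S) (F : S → Y) :
    Measurable fun ω => F (orbit next t x ω) := by
  induction t generalizing x with
  | zero => exact measurable_const (a := F x)
  | succ t ih =>
    exact measurable_of_head_tail (F := fun ξ ω => F (orbit next t (next x ξ) ω))
      fun ξ => ih (next x ξ)

lemma measurable_orbitWeight (ρ : S → X → ℝ≥0∞) (t : ℕ) (x : S) :
    Measurable fun ω => orbitWeight next ρ t x ω := by
  induction t generalizing x with
  | zero => exact measurable_const
  | succ t ih =>
    exact measurable_of_head_tail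
      (F := fun ξ ω => ρ x ξ * orbitWeight next ρ t (next x ξ) ω) fun ξ =>
        (ih (next x ξ)).const_mul _

/-- Exponential decay of multiplicative functionals from a one-step estimate. -/
lemma lintegral_orbitWeight_le (ν : Measure X) [IsProbabilityMeasure ν] (ρ : S → X → ℝ≥0∞)
    (φ : S → ℝ≥0∞) (r : ℝ≥0∞) (h : ∀ x, ∫⁻ ξ, ρ x ξ * φ (next x ξ) ∂ν ≤ r * φ x) (t : ℕ) (x : S) :
    ∫⁻ ω, orbitWeight next ρ t x ω * φ (orbit next t x ω) ∂(Measure.infinitePi fun _ => ν)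
      ≤ r ^ t * φ x := by
  induction t generalizing x with
  | zero => simp [orbitWeight, orbit]
  | succ t ih =>
    have hmeas : ∀ t x, Measurable fun ω => orbitWeight next ρ t x ω * φ (orbit next t x ω) :=
      fun t x => (measurable_orbitWeight next ρ t x).mul (measurable_orbit_comp next t x φ)
    rw [lintegral_infinitePi_eq ν (hmeas (t + 1) x)]
    calc _ = ∫⁻ ξ, ρ x ξ * ∫⁻ ω, orbitWeight next ρ t (next x ξ) ω *
            φ (orbit next t (next x ξ) ω) ∂(Measure.infinitePi fun _ => ν) ∂ν := by
          refine lintegral_congr fun ξ => ?_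
          rw [← lintegral_const_mul _ (hmeas t (next x ξ))]
          refine lintegral_congr fun ω => ?_
          rw [orbit_seqCons, ← mul_assoc]; rfl
      _ ≤ ∫⁻ ξ, ρ x ξ * (r ^ t * φ (next x ξ)) ∂ν :=
          lintegral_mono fun ξ => mul_le_mul_right (ih (next x ξ)) _
      _ = r ^ t * ∫⁻ ξ, ρ x ξ * φ (next x ξ) ∂ν := by
          have hm : Measurable fun ξ => ρ x ξ * φ (next x ξ) := measurable_of_countable _
          rw [← lintegral_const_mul _ hm]
          exact lintegral_congr fun ξ => by ring
      _ ≤ r ^ t * (r * φ x) := mul_le_mul_right (h x) _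
      _ = _ := by rw [pow_succ, mul_assoc]

/-- The motion of the state together with its future coins. -/
def orbitShift (p : S × (ℕ → X)) : S × (ℕ → X) := (next p.1 (p.2 0), fun k => p.2 (k + 1))

lemma orbitShift_iterate (t : ℕ) (p : S × (ℕ → X)) :
    (orbitShift next)^[t] p = (orbit next t p.1 p.2, fun k => p.2 (k + t)) := by
  induction t generalizing p with
  | zero => rfl
  | succ t ih =>
    rw [Function.iterate_succ_apply, ih]
    simp only [orbitShift]
    refine Prod.ext rfl ?_
    funext k
    show p.2 (k + t + 1) = p.2 (k + (t + 1))
    rfl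

variable [MeasurableSpace S] [Countable S] [MeasurableSingletonClass S]

/-- The state does not depend on its next coin, every fixed coin preserves `μ`, and after this coin
is removed the remaining sequence is again independent. Thus state and future coins form a
stationary process, to which the ergodic inequality applies. -/
lemma measurePreserving_orbitShift (μ : Measure S) [IsProbabilityMeasure μ] (ν : Measure X)
    [IsProbabilityMeasure ν] (h : ∀ ξ, MeasurePreserving (fun x => next x ξ) μ μ) :
    MeasurePreserving (orbitShift next) (μ.prod (Measure.infinitePi fun _ : ℕ => ν))
      (μ.prod (Measure.infinitePi fun _ => ν)) := by
  have hm : Measurable (orbitShift next (X := X)) := by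
    refine measurable_from_prod_countable_right fun x => ?_
    refine Measurable.prodMk ?_ (measurable_pi_iff.2 fun k => measurable_pi_apply (k + 1))
    exact (measurable_of_countable (fun ξ => next x ξ)).comp (measurable_pi_apply 0)
  refine ⟨hm, Measure.ext fun A hA => ?_⟩
  rw [Measure.map_apply hm hA]
  have hA' := hm hA
  rw [Measure.prod_apply hA', Measure.prod_apply hA]
  set P := Measure.infinitePi fun _ : ℕ => ν with hP
  have h1 : ∀ x, P (Prod.mk x ⁻¹' (orbitShift next ⁻¹' A))
      = ∫⁻ ξ, P (Prod.mk (next x ξ) ⁻¹' A) ∂ν := by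
    intro x
    have hmx : MeasurableSet (Prod.mk x ⁻¹' (orbitShift next ⁻¹' A)) := measurable_prodMk_left hA'
    rw [← lintegral_indicator_one hmx, lintegral_infinitePi_eq ν (measurable_one.indicator hmx)]
    refine lintegral_congr fun ξ => ?_
    rw [← lintegral_indicator_one (measurable_prodMk_left hA)]
    rfl
  simp_rw [h1]
  have hm2 : Measurable fun x => P (Prod.mk x ⁻¹' A) := measurable_of_countable _
  rw [lintegral_lintegral_swap]
  · calc _ = ∫⁻ ξ, ∫⁻ x, P (Prod.mk x ⁻¹' A) ∂μ ∂ν :=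
          lintegral_congr fun ξ => (h ξ).lintegral_comp hm2
      _ = _ := by simp
  · exact (measurable_of_countable _).aemeasurable

end Coins

/-! ### The coins of one time-slot -/

section Slot

variable {n m : ℕ} [NeZero m]

/-- The coins of a node other than the one for its step. -/
abbrev RestCoins (n : ℕ) : Type := (Bool × Bool × Choice n) × (Bool × Choice n)

def restLaw (n : ℕ) (p α : I) : Measure (RestCoins n) :=
  ((bernoulliMeasure true false p).prod ((bernoulliMeasure true false α).prod
        (unif (Choice n)))).prod
      ((bernoulliMeasure true false p).prod (unif (Choice n)))

instance restLawIsProbabilityMeasure (n : ℕ) (p α : I) : IsProbabilityMeasure (restLaw n p α) := by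
  unfold restLaw; infer_instance

/-- The law of the coins of all nodes in one time-slot. -/
def slotLaw (n : ℕ) (p α : I) : Measure (Fin n → NodeCoins n) :=
  Measure.pi fun _ : Fin n => nodeCoinsLaw n p α

instance slotLawIsProbabilityMeasure (n : ℕ) (p α : I) : IsProbabilityMeasure (slotLaw n p α) := by
  unfold slotLaw; infer_instance

/-- The positions of all nodes after a step. -/
def move (x : Fin n → ZMod m) (ξ : Fin n → NodeCoins n) : Fin n → ZMod m :=
  fun v => x v + (ξ v).step m

lemma unif_singleton (α : Type) [Fintype α] [Nonempty α] [MeasurableSpace α]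
    [MeasurableSingletonClass α] (a : α) : unif α {a} = (Fintype.card α : ℝ≥0∞)⁻¹ := by
  rw [unif, PMF.toMeasure_apply_singleton _ _ (measurableSet_singleton a)]
  simp

lemma lintegral_steps_eq (φ : (Fin n → ZMod m) → ℝ) (hφ : ∀ x, 0 ≤ φ x) (x : Fin n → ZMod m) :
    ∫⁻ e, ENNReal.ofReal (φ fun v => x v + stepVal m (e v))
      ∂(Measure.pi fun _ : Fin n => unif (Fin 3)) = ENNReal.ofReal (stepOp φ x) := by
  rw [lintegral_fintype, stepOp, ENNReal.ofReal_sum_of_nonneg]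
  · refine Finset.sum_congr rfl fun e _ => ?_
    have h1 : (Measure.pi fun _ : Fin n => unif (Fin 3)) {e} = ENNReal.ofReal (∏ _k : Fin n, (1 / 3)) := by
      rw [Measure.pi_singleton, ENNReal.ofReal_prod_of_nonneg (fun _ _ => by norm_num)]
      refine Finset.prod_congr rfl fun k _ => ?_
      rw [unif_singleton, ENNReal.ofReal_div_of_pos (by norm_num)]
      simp
    rw [h1, mul_comm, ← ENNReal.ofReal_mul (Finset.prod_nonneg fun _ _ => by norm_num)]
  · exact fun e _ => mul_nonneg (Finset.prod_nonneg fun _ _ => by norm_num) (hφ _)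

/-- Within a slot the steps are independent of all other decisions, so the expectation factorizes
into a mean over decisions and one step of the motion. -/
lemma lintegral_slot_eq (p α : I) (R : (Fin n → RestCoins n) → ℝ) (hR : ∀ q, 0 ≤ R q)
    (φ : (Fin n → ZMod m) → ℝ) (hφ : ∀ x, 0 ≤ φ x) (x : Fin n → ZMod m) :
    ∫⁻ ξ, ENNReal.ofReal (R fun v => (ξ v).2) * ENNReal.ofReal (φ (move x ξ)) ∂(slotLaw n p α)
      = ENNReal.ofReal ((∫ q, R q ∂(Measure.pi fun _ => restLaw n p α)) * stepOp φ x) := by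
  have hmp := measurePreserving_arrowProdEquivProdArrow (Fin 3) (RestCoins n) (Fin n)
    (fun _ => unif (Fin 3)) (fun _ => restLaw n p α)
  have h1 : slotLaw n p α = Measure.pi fun _ : Fin n => (unif (Fin 3)).prod (restLaw n p α) := rfl
  have hF : Measurable fun y : (Fin n → Fin 3) × (Fin n → RestCoins n) =>
      ENNReal.ofReal (R y.2) * ENNReal.ofReal (φ fun v => x v + stepVal m (y.1 v)) :=
    measurable_of_countable _
  have h2 := hmp.lintegral_comp hF
  rw [h1]
  refine Eq.trans (Eq.trans rfl h2) ?_
  rw [lintegral_prod _ hF.aemeasurable]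
  have hRm : Measurable fun q => ENNReal.ofReal (R q) := measurable_of_countable _
  have h3 : ∀ e : Fin n → Fin 3, ∫⁻ q, ENNReal.ofReal (R q) * ENNReal.ofReal (φ fun v => x v +
      stepVal m (e v)) ∂(Measure.pi fun _ => restLaw n p α)
      = (∫⁻ q, ENNReal.ofReal (R q) ∂(Measure.pi fun _ => restLaw n p α)) *
        ENNReal.ofReal (φ fun v => x v + stepVal m (e v)) := fun e => lintegral_mul_const _ hRm
  simp only [h3]
  rw [lintegral_const_mul _ (measurable_of_countable _), lintegral_steps_eq φ hφ,
    ← ofReal_integral_eq_lintegral_ofReal Integrable.of_finite (ae_of_all _ hR),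
    ← ENNReal.ofReal_mul (integral_nonneg hR)]

lemma lintegral_move_eq (p α : I) (φ : (Fin n → ZMod m) → ℝ) (hφ : ∀ x, 0 ≤ φ x)
    (x : Fin n → ZMod m) :
    ∫⁻ ξ, ENNReal.ofReal (φ (move x ξ)) ∂(slotLaw n p α) = ENNReal.ofReal (stepOp φ x) := by
  have := lintegral_slot_eq p α (fun _ => 1) (fun _ => zero_le_one) φ hφ x
  simpa using this

lemma pi_pair_event {X : Type*} [MeasurableSpace X] (μ : Measure X) [IsProbabilityMeasure μ]
    (u v : Fin n) (huv : u ≠ v) (U V : Set X) :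
    (Measure.pi fun _ : Fin n => μ) {q | q u ∈ U ∧ q v ∈ V} = μ U * μ V := by
  have h1 : {q : Fin n → X | q u ∈ U ∧ q v ∈ V}
      = Set.pi Set.univ fun k => if k = u then U else if k = v then V else Set.univ := by
    ext q
    simp only [Set.mem_ofPred_eq, Set.mem_pi, Set.mem_univ, true_implies]
    constructor
    · rintro ⟨h1, h2⟩ k
      by_cases hu : k = u
      · subst hu; simpa using h1
      · by_cases hv : k = v
        · subst hv; simpa [hu] using h2
        · simp [hu, hv]
    · intro h
      have h2 := h u
      have h3 := h v
      simp [huv.symm] at h2 h3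
      exact ⟨h2, h3⟩
  rw [h1, Measure.pi_pi, ← Finset.mul_prod_erase Finset.univ _ (Finset.mem_univ u),
    ← Finset.mul_prod_erase _ _ (Finset.mem_erase.2 ⟨huv.symm, Finset.mem_univ v⟩),
    Finset.prod_eq_one]
  · simp [huv.symm]
  · intro k hk
    simp only [Finset.mem_erase, Finset.mem_univ, and_true] at hk
    simp [hk.1, hk.2]

lemma bernoulli_true (p : I) : bernoulliMeasure true false p {true} = ENNReal.ofReal p := by
  rw [bernoulliMeasure_apply p (by simp), ENNReal.ofReal]
  simp only [Set.mem_singleton_iff, Bool.false_eq_true, if_true, if_false, ENNReal.coe_inj]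
  exact NNReal.eq (by simp [p.2.1])

lemma bernoulli_false (p : I) :
    bernoulliMeasure true false p {false} = ENNReal.ofReal (1 - p) := by
  rw [bernoulliMeasure_apply p (by simp), ENNReal.ofReal]
  simp only [Set.mem_singleton_iff, Bool.true_eq_false, if_true, if_false, ENNReal.coe_inj]
  exact NNReal.eq (by simp [p.2.2])

lemma restLaw_sendA (p α : I) :
    restLaw n p α {q | q.1.2.1 = true} = ENNReal.ofReal α := by
  have h : {q : RestCoins n | q.1.2.1 = true}
      = (Set.univ ×ˢ ({true} ×ˢ Set.univ)) ×ˢ Set.univ := by ext; simp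
  rw [h, restLaw, Measure.prod_prod, Measure.prod_prod, Measure.prod_prod, bernoulli_true]
  simp

lemma restLaw_activeA_sendA (p α : I) :
    restLaw n p α {q | q.1.1 = true ∧ q.1.2.1 = true} = ENNReal.ofReal (p * α) := by
  have h : {q : RestCoins n | q.1.1 = true ∧ q.1.2.1 = true}
      = ({true} ×ˢ ({true} ×ˢ Set.univ)) ×ˢ Set.univ := by ext; simp
  rw [h, restLaw, Measure.prod_prod, Measure.prod_prod, Measure.prod_prod, bernoulli_true,
    bernoulli_true, ENNReal.ofReal_mul p.2.1]
  simp

lemma restLaw_not_activeA (p α : I) :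
    restLaw n p α {q | q.1.1 = false} = ENNReal.ofReal (1 - p) := by
  have h : {q : RestCoins n | q.1.1 = false} = ({false} ×ˢ Set.univ) ×ˢ Set.univ := by ext; simp
  rw [h, restLaw, Measure.prod_prod, Measure.prod_prod, bernoulli_false]
  simp

lemma restLaw_activeB (p α : I) :
    restLaw n p α {q | q.2.1 = true} = ENNReal.ofReal p := by
  have h : {q : RestCoins n | q.2.1 = true} = Set.univ ×ˢ ({true} ×ˢ Set.univ) := by ext; simp
  rw [h, restLaw, Measure.prod_prod, Measure.prod_prod, bernoulli_true]
  simp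

lemma restLaw_not_activeB (p α : I) :
    restLaw n p α {q | q.2.1 = false} = ENNReal.ofReal (1 - p) := by
  have h : {q : RestCoins n | q.2.1 = false} = Set.univ ×ˢ ({false} ×ˢ Set.univ) := by ext; simp
  rw [h, restLaw, Measure.prod_prod, Measure.prod_prod, bernoulli_false]
  simp

open Classical in
lemma integral_pair_event (p α : I) (u v : Fin n) (huv : u ≠ v) (P Q : RestCoins n → Prop)
    (a b : ℝ) (ha : 0 ≤ a) (hb : 0 ≤ b) (hP : restLaw n p α {q | P q} = ENNReal.ofReal a)
    (hQ : restLaw n p α {q | Q q} = ENNReal.ofReal b) :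
    ∫ q, (if P (q u) ∧ Q (q v) then (1 : ℝ) else 0) ∂(Measure.pi fun _ : Fin n => restLaw n p α)
      = a * b := by
  have h1 : (fun q : Fin n → RestCoins n => if P (q u) ∧ Q (q v) then (1 : ℝ) else 0)
      = Set.indicator {q | q u ∈ {q | P q} ∧ q v ∈ {q | Q q}} 1 := by
    funext q; simp [Set.indicator]
  rw [h1, integral_indicator_one (Set.Countable.measurableSet (Set.to_countable _)), measureReal_def,
    pi_pair_event (restLaw n p α) u v huv, hP, hQ, ENNReal.toReal_mul, ENNReal.toReal_ofReal ha,
    ENNReal.toReal_ofReal hb]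

open Classical in
lemma integral_single_event (p α : I) (u : Fin n) (P : RestCoins n → Prop)
    (a : ℝ) (ha : 0 ≤ a) (hP : restLaw n p α {q | P q} = ENNReal.ofReal a) :
    ∫ q, (if P (q u) then (1 : ℝ) else 0) ∂(Measure.pi fun _ : Fin n => restLaw n p α) = a := by
  have h1 : (fun q : Fin n → RestCoins n => if P (q u) then (1 : ℝ) else 0)
      = Set.indicator (Function.eval u ⁻¹' {q | P q}) 1 := by
    funext q; simp [Set.indicator]
  have hm : MeasurableSet {q : RestCoins n | P q} := Set.Countable.measurableSet (Set.to_countable _)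
  rw [h1, integral_indicator_one (Set.Countable.measurableSet (Set.to_countable _)), measureReal_def,
    (measurePreserving_eval (fun _ : Fin n => restLaw n p α) u).measure_preimage
      hm.nullMeasurableSet, hP, ENNReal.toReal_ofReal ha]

/-! ### Drift -/

lemma stepOp_lyapunov (L : ℕ) (hL : 0 < L) (M H : (Fin n → ZMod m) → ℝ) (a b K : ℝ)
    (x : Fin n → ZMod m) :
    stepOp (fun x => 1 + a * green L M x + b * (K - green L H x)) x
      = 1 + a * green L M x + b * (K - green L H x)
        + a * ((∑ t ∈ Finset.range L, evolve (t + 1) M x) / L - M x)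
        + b * (H x - (∑ t ∈ Finset.range L, evolve (t + 1) H x) / L) := by
  have e : (fun x : Fin n → ZMod m => 1 + a * green L M x + b * (K - green L H x))
      = fun x => (1 + b * K) + (a * green L M x + (-b) * green L H x) := by funext x; ring
  rw [e, stepOp_add, stepOp_const, stepOp_add, stepOp_const_mul, stepOp_const_mul,
    stepOp_green L hL, stepOp_green L hL]
  ring

/-- The function `φ` is contracted on average by the weights `1 + A M - y H`, when meetings `M` are
rare and services `H` are frequent. -/
lemma lyapunov_contracts (L : ℕ) (hL : 0 < L) (M H : (Fin n → ZMod m) → ℝ) (A y Φ K bM bH : ℝ)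
    (hM : ∀ x, 0 ≤ M x) (hH : ∀ x, 0 ≤ H x) (hA : 0 ≤ A) (hy : 0 ≤ y) (hΦ : 0 < Φ)
    (hK : ∀ x, green L H x ≤ K)
    (hφ : ∀ x, 1 + A * Φ * green L M x + y * (K - green L H x) ≤ Φ)
    (heM : ∀ x, (∑ t ∈ Finset.range L, evolve (t + 1) M x) / L ≤ bM)
    (heH : ∀ x, bH ≤ (∑ t ∈ Finset.range L, evolve (t + 1) H x) / L)
    (hnet : 0 ≤ y * bH - A * Φ * bM) (x : Fin n → ZMod m) :
    (1 + A * M x - y * H x) *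
        stepOp (fun x => 1 + A * Φ * green L M x + y * (K - green L H x)) x
      ≤ (1 - (y * bH - A * Φ * bM) / Φ) * (1 + A * Φ * green L M x + y * (K - green L H x)) := by
  set φ := fun x => 1 + A * Φ * green L M x + y * (K - green L H x) with hφd
  have h1 : ∀ x, 1 ≤ φ x := fun x => by
    have := green_nonneg L hM x
    have := hK x
    have h3 : 0 ≤ A * Φ * green L M x := by positivity
    have h4 : 0 ≤ y * (K - green L H x) := mul_nonneg hy (by linarith)
    simp only [hφd]; linarith
  have h2 : 1 ≤ stepOp φ x := by
    have := stepOp_mono h1 x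
    rwa [stepOp_const] at this
  have h3 : stepOp φ x ≤ Φ := by
    have := stepOp_mono hφ x
    rwa [stepOp_const] at this
  have h4 : stepOp φ x = φ x + A * Φ * ((∑ t ∈ Finset.range L, evolve (t + 1) M x) / L - M x)
        + y * (H x - (∑ t ∈ Finset.range L, evolve (t + 1) H x) / L) :=
    stepOp_lyapunov L hL M H (A * Φ) y K x
  -- The two local terms of the drift cancel against the weights: `-A Φ M` absorbs the gain from
  -- meetings because `stepOp φ ≤ Φ`, and `+y H` is absorbed by the loss from services because
  -- `stepOp φ ≥ 1`. Only the means over the horizon remain.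
  have h5 : A * M x * stepOp φ x ≤ A * M x * Φ :=
    mul_le_mul_of_nonneg_left h3 (mul_nonneg hA (hM x))
  have h6 : y * H x * 1 ≤ y * H x * stepOp φ x :=
    mul_le_mul_of_nonneg_left h2 (mul_nonneg hy (hH x))
  have h7 : A * Φ * ((∑ t ∈ Finset.range L, evolve (t + 1) M x) / L) ≤ A * Φ * bM :=
    mul_le_mul_of_nonneg_left (heM x) (by positivity)
  have h8 : y * bH ≤ y * ((∑ t ∈ Finset.range L, evolve (t + 1) H x) / L) :=
    mul_le_mul_of_nonneg_left (heH x) hy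
  -- An additive decrease becomes a contraction factor because `φ` is at most `Φ`.
  have h9 : (y * bH - A * Φ * bM) / Φ * φ x ≤ y * bH - A * Φ * bM := by
    rw [div_mul_eq_mul_div, div_le_iff₀ hΦ]
    exact mul_le_mul_of_nonneg_left (hφ x) hnet
  calc (1 + A * M x - y * H x) * stepOp φ x
      = stepOp φ x + A * M x * stepOp φ x - y * H x * stepOp φ x := by ring
    _ ≤ φ x - (y * bH - A * Φ * bM) := by rw [h4] at h5 h6 ⊢; linarith
    _ ≤ _ := by linarith

/-! ### Hitting probabilities -/

/-- Optional stopping, by induction on the time left: `g` plus `b` times the remaining time is a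
supermartingale until `A` is hit, where it is at least `γ`. -/
lemma lintegral_hit_le (p α : I) (A : Set (Fin n → ZMod m)) (g : (Fin n → ZMod m) → ℝ)
    (hg : ∀ x, 0 ≤ g x) (γ b : ℝ) (hb : 0 ≤ b) (hγ : ∀ x ∈ A, γ ≤ g x)
    (hstep : ∀ x, stepOp g x ≤ g x + b) (T : ℕ) (x : Fin n → ZMod m) :
    ENNReal.ofReal γ * (Measure.infinitePi fun _ => slotLaw n p α)
        {ω | ∃ t ≤ T, orbit move t x ω ∈ A} ≤ ENNReal.ofReal (g x + T * b) := by
  set P := Measure.infinitePi fun _ : ℕ => slotLaw n p α with hP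
  have hmeas : ∀ T x, MeasurableSet {ω : ℕ → Fin n → NodeCoins n | ∃ t ≤ T, orbit move t x ω ∈ A} := by
    intro T x
    have : {ω : ℕ → Fin n → NodeCoins n | ∃ t ≤ T, orbit move t x ω ∈ A}
        = ⋃ t ∈ Finset.range (T + 1), {ω | orbit move t x ω ∈ A} := by
      ext ω; simp
    rw [this]
    refine Finset.measurableSet_biUnion _ fun t _ => ?_
    exact measurableSet_setOfPred.2 (measurable_orbit_comp move t x (fun y => y ∈ A))
  induction T generalizing x with
  | zero =>
    by_cases hx : x ∈ A
    · refine le_trans (mul_le_of_le_one_right' prob_le_one) (ENNReal.ofReal_le_ofReal ?_)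
      have := hγ x hx; simpa using this
    · have : {ω : ℕ → Fin n → NodeCoins n | ∃ t ≤ 0, orbit move t x ω ∈ A} = ∅ := by
        ext ω; simp [orbit, hx]
      rw [this]; simp
  | succ T ih =>
    by_cases hx : x ∈ A
    · refine le_trans (mul_le_of_le_one_right' prob_le_one) (ENNReal.ofReal_le_ofReal ?_)
      have := hγ x hx
      have : (0 : ℝ) ≤ ((T + 1 : ℕ) : ℝ) * b := by positivity
      linarith
    · rw [← lintegral_indicator_one (hmeas (T + 1) x),
        lintegral_infinitePi_eq _ (measurable_one.indicator (hmeas (T + 1) x)),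
        ← lintegral_const_mul _ (measurable_of_countable _)]
      calc _ = ∫⁻ ξ, ENNReal.ofReal γ * P {ω | ∃ t ≤ T, orbit move t (move x ξ) ω ∈ A}
              ∂slotLaw n p α := by
            refine lintegral_congr fun ξ => ?_
            rw [← lintegral_indicator_one (hmeas T (move x ξ))]
            congr 1
            refine lintegral_congr fun ω => ?_
            have : seqCons (ξ, ω) ∈ {ω | ∃ t ≤ T + 1, orbit move t x ω ∈ A}
                ↔ ω ∈ {ω | ∃ t ≤ T, orbit move t (move x ξ) ω ∈ A} := by
              simp only [Set.mem_ofPred_eq]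
              constructor
              · rintro ⟨t, ht, h⟩
                cases t with
                | zero => exact absurd h hx
                | succ t => exact ⟨t, by omega, h⟩
              · rintro ⟨t, ht, h⟩
                exact ⟨t + 1, by omega, h⟩
            by_cases h : ω ∈ {ω | ∃ t ≤ T, orbit move t (move x ξ) ω ∈ A}
            · rw [Set.indicator_of_mem h, Set.indicator_of_mem (this.2 h)]; rfl
            · rw [Set.indicator_of_notMem h, Set.indicator_of_notMem (fun h' => h (this.1 h'))]
        _ ≤ ∫⁻ ξ, ENNReal.ofReal (g (move x ξ) + T * b) ∂slotLaw n p α :=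
            lintegral_mono fun ξ => ih (move x ξ)
        _ = ENNReal.ofReal (stepOp (fun x => g x + T * b) x) :=
            lintegral_move_eq p α (fun x => g x + T * b)
              (fun x => add_nonneg (hg x) (by positivity)) x
        _ ≤ _ := by
            apply ENNReal.ofReal_le_ofReal
            rw [stepOp_add, stepOp_const]
            have := hstep x
            push_cast; linarith

end Slot

/-! ### Meeting sites -/

/-- For every two nodes `v`, `w`, the site of `v` at which it can meet `w`, and the sites at which
other nodes are close to the meeting point. -/
structure Sites (n m : ℕ) where
  site : Fin n → Fin n → ZMod m
  near : Fin n → Fin n → Fin n → Finset (ZMod m)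

namespace Sites

/-- The bound `B` on the sites of one node and the bound `κ m` on the number of nodes together make
undisturbed meetings frequent. The last field concerns two nodes that `v` can meet at one and the
same site: it forces a node met alone to be the only neighbor. -/
structure Good {n m : ℕ} (N : Sites n m) (B κ : ℝ) : Prop where
  card_near : ∀ v w k, v ≠ w → ((N.near v w k).card : ℝ) ≤ B
  card_passing : ∀ v w, v ≠ w →
    ((Finset.univ.filter fun k => (N.near v w k).Nonempty).card : ℝ) ≤ κ * m
  mem_near : ∀ v w w', v ≠ w → v ≠ w' → w ≠ w' → N.site v w = N.site v w' →
    N.site w' v ∈ N.near v w w'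

section

variable {n m : ℕ} [NeZero m] (N : Sites n m)

/-- Nodes `v` and `w` meet. -/
def Meets (v w : Fin n) (x : Fin n → ZMod m) : Prop := x v = N.site v w ∧ x w = N.site w v

/-- Nodes `v` and `w` meet and no other node is close to them. -/
def MeetsAlone (v w : Fin n) (x : Fin n → ZMod m) : Prop :=
  x v = N.site v w ∧ x w = N.site w v ∧ ∀ k, k ≠ v → k ≠ w → x k ∉ N.near v w k

/-- Source `s` may hand a packet over to `v`. -/
def Arr (s v : Fin n) (x : Fin n → ZMod m) (ξ : Fin n → NodeCoins n) : Prop :=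
  N.Meets s v x ∧ (ξ s).sendA = true

/-- Node `v` hands the first packet of its queue over to the destination `d`, if it has one. -/
def Srv (v d : Fin n) (x : Fin n → ZMod m) (ξ : Fin n → NodeCoins n) : Prop :=
  N.MeetsAlone v d x ∧ (ξ v).activeB = true ∧ (ξ d).activeB = false

/-- Source `s` hands a packet over to `w`. -/
def Hop (s w : Fin n) (x : Fin n → ZMod m) (ξ : Fin n → NodeCoins n) : Prop :=
  N.MeetsAlone s w x ∧ ((ξ s).activeA = true ∧ (ξ s).sendA = true) ∧ (ξ w).activeA = false

lemma MeetsAlone.meets {N : Sites n m} {v w : Fin n} {x : Fin n → ZMod m}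
    (h : N.MeetsAlone v w x) : N.Meets v w x := ⟨h.1, h.2.1⟩

open Classical in
lemma meet_eq (v w : Fin n) (x : Fin n → ZMod m) :
    meet v w (N.site v w) (N.site w v) x = if N.Meets v w x then 1 else 0 := by
  unfold meet Meets; congr

open Classical in
lemma meetAlone_eq (v w : Fin n) (x : Fin n → ZMod m) :
    meetAlone v w (N.site v w) (N.site w v) (N.near v w) x
      = if N.MeetsAlone v w x then 1 else 0 := by
  unfold meetAlone MeetsAlone; congr

lemma MeetsAlone.unique {N : Sites n m} {B κ : ℝ} (hN : N.Good B κ) {s w w' : Fin n}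
    (hw : s ≠ w) (hw' : s ≠ w') {x : Fin n → ZMod m} (h : N.MeetsAlone s w x)
    (h' : N.Meets s w' x) : w' = w := by
  by_contra hne
  refine h.2.2 w' (Ne.symm hw') hne ?_
  rw [h'.2]
  exact hN.mem_near s w w' hw hw' (Ne.symm hne) (h.1.symm.trans h'.1)

open Classical in
/-- The number of slots among the first `t` in which `A` holds. -/
def tally (A : (Fin n → ZMod m) → (Fin n → NodeCoins n) → Prop) (x : Fin n → ZMod m)
    (ω : ℕ → Fin n → NodeCoins n) (t : ℕ) : ℕ :=
  ((Finset.range t).filter fun u => A (orbit move u x ω) (ω u)).card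

/-- More packets for `d` may have arrived at `v` from `s` up to time `t` than could leave before
`t`. -/
def Busy (s v d : Fin n) (x : Fin n → ZMod m) (ω : ℕ → Fin n → NodeCoins n) (t : ℕ) : Prop :=
  tally (N.Srv v d) x ω t < tally (N.Arr s v) x ω (t + 1)

open Classical in
lemma prod_ite_tally (A : (Fin n → ZMod m) → (Fin n → NodeCoins n) → Prop) (x : Fin n → ZMod m)
    (ω : ℕ → Fin n → NodeCoins n) (t : ℕ) (r : ℝ≥0∞) :
    ∏ u ∈ Finset.range t, (if A (orbit move u x ω) (ω u) then r else 1) = r ^ tally A x ω t := by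
  rw [Finset.prod_ite, Finset.prod_const, Finset.prod_const_one, mul_one, tally]

open Classical in
lemma tally_succ_le (A : (Fin n → ZMod m) → (Fin n → NodeCoins n) → Prop) (x : Fin n → ZMod m)
    (ω : ℕ → Fin n → NodeCoins n) (t : ℕ) : tally A x ω (t + 1) ≤ tally A x ω t + 1 := by
  unfold tally
  rw [Finset.range_add_one, Finset.filter_insert]
  split_ifs
  · exact Finset.card_insert_le _ _
  · omega

/-! ### Bounds with logarithmic horizon -/

/-- The horizon of the truncated Green operators. -/
def horizon (n : ℕ) : ℕ := n * ⌈Real.log n⌉₊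

end

section

variable {n m : ℕ} [NeZero m]

lemma log_horizon_le (hn : 72 ≤ Real.log n) :
    Real.log (horizon n) ≤ 2 * Real.log n ∧ 0 < horizon n ∧
      (horizon n : ℝ) ≤ 2 * (n * Real.log n) ∧ n * Real.log n ≤ (horizon n : ℝ) := by
  have hn0 : 0 < n := by
    rcases Nat.eq_zero_or_pos n with h | h
    · subst h; norm_num at hn
    · exact h
  have hn0' : (0 : ℝ) < n := by exact_mod_cast hn0
  have h1 : Real.log n ≤ (⌈Real.log n⌉₊ : ℝ) := Nat.le_ceil _
  have h2 : (⌈Real.log n⌉₊ : ℝ) < Real.log n + 1 := Nat.ceil_lt_add_one (by linarith)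
  have h3 : ⌈Real.log n⌉₊ ≤ n := by
    rw [Nat.ceil_le]
    have := Real.log_le_sub_one_of_pos hn0'
    linarith
  have h4 : (0 : ℝ) < (⌈Real.log n⌉₊ : ℝ) := by linarith
  have h4' : 0 < ⌈Real.log n⌉₊ := by exact_mod_cast h4
  have h3' : (⌈Real.log n⌉₊ : ℝ) ≤ n := by exact_mod_cast h3
  refine ⟨?_, Nat.mul_pos hn0 h4', ?_, ?_⟩
  · unfold horizon
    push_cast
    rw [Real.log_mul hn0'.ne' h4.ne']
    have := Real.log_le_log h4 h3'
    linarith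
  · unfold horizon; push_cast; nlinarith
  · unfold horizon; push_cast; nlinarith

lemma green_meet_le_log (hnm : n = m ^ 2) (hn : 72 ≤ Real.log n) (u v : Fin n) (huv : u ≠ v)
    (a b : ZMod m) (y : Fin n → ZMod m) :
    green (horizon n) (meet u v a b) y ≤ 61 * Real.log n := by
  obtain ⟨h1, h2, h3, h4⟩ := log_horizon_le hn
  have h := green_meet_le (horizon n) u v huv a b y
  have hn0 : (0 : ℝ) < m ^ 2 := by have : 0 < m := NeZero.pos m; positivity
  have e : (n : ℝ) = m ^ 2 := by exact_mod_cast hnm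
  have h5 : 2 * (horizon n : ℝ) / m ^ 2 ≤ 4 * Real.log n := by
    rw [div_le_iff₀ hn0, ← e]; linarith
  linarith

lemma mean_evolve_meet_le (hnm : n = m ^ 2) (hn : 72 ≤ Real.log n) (u v : Fin n) (huv : u ≠ v)
    (a b : ZMod m) (y : Fin n → ZMod m) :
    (∑ t ∈ Finset.range (horizon n), evolve (t + 1) (meet u v a b) y) / horizon n ≤ 56 / n := by
  obtain ⟨h1, h2, h3, h4⟩ := log_horizon_le hn
  have h := sum_evolve_succ_meet_le (horizon n) u v huv a b y
  have hn0 : (0 : ℝ) < n := by rw [hnm]; have : 0 < m := NeZero.pos m; positivity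
  have e : (m : ℝ) ^ 2 = n := by rw [hnm]; push_cast; rfl
  have h2' : (0 : ℝ) < horizon n := by exact_mod_cast h2
  rw [div_le_div_iff₀ h2' hn0]
  rw [e] at h
  have h5 := mul_le_mul_of_nonneg_right h hn0.le
  rw [add_mul, div_mul_cancel₀ _ hn0.ne'] at h5
  nlinarith

lemma le_mean_evolve (hnm : n = m ^ 2) (hn : 72 ≤ Real.log n) (f : (Fin n → ZMod m) → ℝ)
    (hf : ∀ x, 0 ≤ f x) (c : ℝ) (hc0 : 0 ≤ c) (hc : ∀ t, 36 * m ^ 2 ≤ t → ∀ y, c ≤ evolve t f y)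
    (y : Fin n → ZMod m) :
    c / 2 ≤ (∑ t ∈ Finset.range (horizon n), evolve (t + 1) f y) / horizon n := by
  obtain ⟨h1, h2, h3, h4⟩ := log_horizon_le hn
  have h2' : (0 : ℝ) < horizon n := by exact_mod_cast h2
  rw [div_le_div_iff₀ two_pos h2']
  -- The first `36 m² = 36 n` slots, before mixing, make up at most half of the horizon; this is the
  -- reason for the assumption `72 ≤ log n`.
  have h5 : 72 * n ≤ horizon n := by
    have : (72 * n : ℝ) ≤ horizon n := by
      have : (0 : ℝ) ≤ n := by positivity
      nlinarith
    exact_mod_cast this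
  have h6 : ∑ t ∈ (Finset.range (horizon n)).filter (fun t => 36 * m ^ 2 ≤ t), c
      ≤ ∑ t ∈ Finset.range (horizon n), evolve (t + 1) f y := by
    refine le_trans (Finset.sum_le_sum fun t ht => hc (t + 1) (by
      have := (Finset.mem_filter.1 ht).2; omega) y) ?_
    exact Finset.sum_le_sum_of_subset_of_nonneg (Finset.filter_subset _ _)
      fun t _ _ => evolve_nonneg _ hf y
  have h7 : (Finset.range (horizon n)).filter (fun t => 36 * m ^ 2 ≤ t)
      = Finset.Ico (36 * m ^ 2) (horizon n) := by
    ext t; simp [and_comm]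
  rw [h7, Finset.sum_const, Nat.card_Ico, nsmul_eq_mul] at h6
  have h8 : (horizon n : ℝ) ≤ 2 * ((horizon n - 36 * m ^ 2 : ℕ) : ℝ) := by
    have : horizon n ≤ 2 * (horizon n - 36 * m ^ 2) := by omega
    exact_mod_cast this
  nlinarith

end

/-! ### Queues are short -/

variable {n m : ℕ} [NeZero m] (N : Sites n m)

lemma evolve_meetAlone_ge {B κ : ℝ} (hN : N.Good B κ) (hm : 4 * B ≤ m) (v d : Fin n)
    (hvd : v ≠ d) (t : ℕ) (ht : 36 * m ^ 2 ≤ t) (y : Fin n → ZMod m) :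
    Real.exp (-(4 * B * κ)) / (4 * m ^ 2)
      ≤ evolve t (meetAlone v d (N.site v d) (N.site d v) (N.near v d)) y :=
  le_evolve_meetAlone t ht v d hvd _ _ _ B κ (fun k => hN.card_near v d k hvd)
    (hN.card_passing v d hvd) hm y

/-- The threshold of the sending probability below which queues are stable. -/
def alphaBound (p B κ : ℝ) : ℝ :=
  min (1 / 122) (p * (1 - p) * Real.exp (-(4 * B * κ)) / 300000)

open Classical in
/-- The weight of a time-slot: arrivals multiply by `1 + 1 / log n` and services divide by it. -/
def queueWeight (s v d : Fin n) (x : Fin n → ZMod m) (ξ : Fin n → NodeCoins n) : ℝ≥0∞ :=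
  (if N.Arr s v x ξ then ENNReal.ofReal (1 + 1 / Real.log n) else 1) *
    (if N.Srv v d x ξ then (ENNReal.ofReal (1 + 1 / Real.log n))⁻¹ else 1)

-- The last slot adds at most one arrival, so in a busy slot the arrivals before it are at least as
-- many as the services before it, and the product of the weights is at least one.
open Classical in
lemma indicator_busy_le (s v d : Fin n) (hn : 0 < Real.log n) (x : Fin n → ZMod m)
    (ω : ℕ → Fin n → NodeCoins n) (t : ℕ) :
    (if N.Busy s v d x ω t then (1 : ℝ≥0∞) else 0)
      ≤ orbitWeight move (N.queueWeight s v d) t x ω := by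
  split_ifs with h
  · rw [orbitWeight_eq_prod]
    unfold queueWeight
    rw [Finset.prod_mul_distrib, prod_ite_tally (N.Arr s v), prod_ite_tally (N.Srv v d)]
    have h1 := tally_succ_le (N.Arr s v) x ω t
    unfold Busy at h
    set r := ENNReal.ofReal (1 + 1 / Real.log n) with hr
    have hr1 : 1 ≤ r := by
      rw [hr, ENNReal.one_le_ofReal]; have : 0 < 1 / Real.log n := by positivity
      linarith
    have hle : tally (N.Srv v d) x ω t ≤ tally (N.Arr s v) x ω t := by omega
    calc (1 : ℝ≥0∞) = r ^ tally (N.Srv v d) x ω t * r⁻¹ ^ tally (N.Srv v d) x ω t := by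
          rw [← mul_pow, ENNReal.mul_inv_cancel (by positivity) (by simp [hr]), one_pow]
      _ ≤ _ := by gcongr
  · exact zero_le

/-- A majorant of `queueWeight` that is affine in the coins. -/
def queueMajorant (s v d : Fin n) (x : Fin n → ZMod m) (q : Fin n → RestCoins n) : ℝ :=
  1 + 1 / Real.log n * meet s v (N.site s v) (N.site v s) x *
      (if (q s).1.2.1 = true then 1 else 0)
    - 1 / (Real.log n + 1) * meetAlone v d (N.site v d) (N.site d v) (N.near v d) x *
      (if (q v).2.1 = true ∧ (q d).2.1 = false then 1 else 0)

lemma queueMajorant_nonneg (hn : 0 < Real.log n) (s v d : Fin n) (x : Fin n → ZMod m)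
    (q : Fin n → RestCoins n) : 0 ≤ N.queueMajorant s v d x q := by
  unfold queueMajorant
  have h1 := meet_nonneg s v (N.site s v) (N.site v s) x
  have h2 := (meetAlone_le_meet v d (N.site v d) (N.site d v) (N.near v d) x).trans
    (meet_le_one _ _ _ _ _)
  have h2' := meetAlone_nonneg v d (N.site v d) (N.site d v) (N.near v d) x
  have h3 : 1 / (Real.log n + 1) ≤ 1 := by
    rw [div_le_one (by linarith)]; linarith
  have h4 : (0 : ℝ) ≤ if (q s).1.2.1 = true then 1 else 0 := by split_ifs <;> norm_num
  have h5 : (if (q v).2.1 = true ∧ (q d).2.1 = false then 1 else 0 : ℝ) ≤ 1 := by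
    split_ifs <;> norm_num
  have h5' : (0 : ℝ) ≤ (if (q v).2.1 = true ∧ (q d).2.1 = false then 1 else 0 : ℝ) := by
    split_ifs <;> norm_num
  have h6 : 0 ≤ 1 / Real.log n * meet s v (N.site s v) (N.site v s) x *
      (if (q s).1.2.1 = true then 1 else 0 : ℝ) := by positivity
  have h7 : 1 / (Real.log n + 1) * meetAlone v d (N.site v d) (N.site d v) (N.near v d) x ≤ 1 :=
    mul_le_one₀ h3 h2' h2
  have h8 := mul_le_one₀ h7 h5' h5
  linarith

/-- The inverse weight equals `1 - 1 / (log n + 1)`. If an arrival and a service coincide, the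
product is one, which the affine expression still dominates. Being affine, it can be averaged
without regard to the dependence between the two events. -/
lemma queueWeight_le (hn : 0 < Real.log n) (s v d : Fin n) (x : Fin n → ZMod m)
    (ξ : Fin n → NodeCoins n) :
    N.queueWeight s v d x ξ ≤ ENNReal.ofReal (N.queueMajorant s v d x fun k => (ξ k).2) := by
  classical
  unfold queueWeight queueMajorant
  rw [meet_eq, meetAlone_eq]
  set l := Real.log n with hl
  have e2 : (ENNReal.ofReal (1 + 1 / l))⁻¹ = ENNReal.ofReal (1 - 1 / (l + 1)) := by
    rw [← ENNReal.ofReal_inv_of_pos (by positivity)]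
    congr 1
    field_simp
    ring
  have hA : N.Arr s v x ξ ↔ N.Meets s v x ∧ (ξ s).2.1.2.1 = true := Iff.rfl
  have hS : N.Srv v d x ξ ↔ N.MeetsAlone v d x ∧ (ξ v).2.2.1 = true ∧ (ξ d).2.2.1 = false := Iff.rfl
  have h3 : 1 / (l + 1) ≤ 1 / l := one_div_le_one_div_of_le hn (by linarith)
  by_cases h1 : N.Arr s v x ξ <;> by_cases h2 : N.Srv v d x ξ
  · rw [if_pos h1, if_pos h2, if_pos (hA.1 h1).1, if_pos (hA.1 h1).2, if_pos (hS.1 h2).1,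
      if_pos (hS.1 h2).2, ENNReal.mul_inv_cancel (by positivity) (by simp),
      ENNReal.one_le_ofReal]
    linarith
  · rw [if_pos h1, if_neg h2, if_pos (hA.1 h1).1, if_pos (hA.1 h1).2]
    have : (if N.MeetsAlone v d x then (1 : ℝ) else 0) *
        (if (ξ v).2.2.1 = true ∧ (ξ d).2.2.1 = false then 1 else 0) = 0 := by
      rw [hS, not_and_or] at h2
      rcases h2 with h2 | h2 <;> simp [h2]
    rw [mul_assoc (1 / (l + 1)), this]; simp
  · rw [if_neg h1, if_pos h2, if_pos (hS.1 h2).1, if_pos (hS.1 h2).2, e2]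
    have : (if N.Meets s v x then (1 : ℝ) else 0) *
        (if (ξ s).2.1.2.1 = true then 1 else 0) = 0 := by
      rw [hA, not_and_or] at h1
      rcases h1 with h1 | h1 <;> simp [h1]
    rw [mul_assoc (1 / l), this]; simp
  · rw [if_neg h1, if_neg h2]
    have t1 : (if N.MeetsAlone v d x then (1 : ℝ) else 0) *
        (if (ξ v).2.2.1 = true ∧ (ξ d).2.2.1 = false then 1 else 0) = 0 := by
      rw [hS, not_and_or] at h2
      rcases h2 with h2 | h2 <;> simp [h2]
    have t2 : (if N.Meets s v x then (1 : ℝ) else 0) *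
        (if (ξ s).2.1.2.1 = true then 1 else 0) = 0 := by
      rw [hA, not_and_or] at h1
      rcases h1 with h1 | h1 <;> simp [h1]
    rw [mul_assoc (1 / l), mul_assoc (1 / (l + 1)), t1, t2]; simp

lemma integral_queueMajorant (p α : I) (s v d : Fin n) (hvd : v ≠ d) (x : Fin n → ZMod m) :
    ∫ q, N.queueMajorant s v d x q ∂(Measure.pi fun _ => restLaw n p α)
      = 1 + α / Real.log n * meet s v (N.site s v) (N.site v s) x
        - p * (1 - p) / (Real.log n + 1) *
          meetAlone v d (N.site v d) (N.site d v) (N.near v d) x := by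
  have h1 := integral_single_event p α s (fun q : RestCoins n => q.1.2.1 = true) α α.2.1
    (restLaw_sendA p α)
  have h2 := integral_pair_event p α v d hvd (fun q : RestCoins n => q.2.1 = true)
    (fun q => q.2.1 = false) p (1 - p) p.2.1 (by have := p.2.2; linarith) (restLaw_activeB p α)
    (restLaw_not_activeB p α)
  unfold queueMajorant
  rw [integral_sub Integrable.of_finite Integrable.of_finite,
    integral_add Integrable.of_finite Integrable.of_finite, integral_const_mul, integral_const_mul]
  have e1 : ∫ q : Fin n → RestCoins n, (if (q s).1.2.1 = true then (1 : ℝ) else 0)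
      ∂(Measure.pi fun _ => restLaw n p α) = α := by convert h1
  have e2 : ∫ q : Fin n → RestCoins n, (if (q v).2.1 = true ∧ (q d).2.1 = false then (1 : ℝ) else 0)
      ∂(Measure.pi fun _ => restLaw n p α) = p * (1 - p) := by convert h2
  rw [e1, e2]
  simp
  ring

/-- The expected time during which a queue is busy. -/
lemma lintegral_busy_le {B κ : ℝ} (hN : N.Good B κ) (hm : 4 * B ≤ m) (hnm : n = m ^ 2)
    (hn : 72 ≤ Real.log n) (p α : I) (hp0 : 0 < p) (hp1 : p < 1)
    (hα : (α : ℝ) ≤ alphaBound p B κ) (s v d : Fin n) (hsv : s ≠ v) (hvd : v ≠ d)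
    (x : Fin n → ZMod m) :
    ∑' t, (Measure.infinitePi fun _ => slotLaw n p α) {ω | N.Busy s v d x ω t}
      ≤ ENNReal.ofReal (1000000 / (p * (1 - p) * Real.exp (-(4 * B * κ))) * (n * Real.log n)) := by
  have hp0' : (0 : ℝ) < p := hp0
  have hp1' : (p : ℝ) < 1 := hp1
  set l := Real.log n with hl
  have hl0 : 0 < l := by linarith
  have hn0 : (0 : ℝ) < n := by rw [hnm]; have : 0 < m := NeZero.pos m; positivity
  have em : (m : ℝ) ^ 2 = n := by rw [hnm]; push_cast; rfl
  set E := Real.exp (-(4 * B * κ)) with hE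
  have hE0 : 0 < E := Real.exp_pos _
  set Q : ℝ := p * (1 - p) with hQ
  have hQ0 : 0 < Q := mul_pos hp0' (by linarith)
  have hQ1 : Q ≤ 1 := by rw [hQ]; nlinarith
  have hα1 : (α : ℝ) ≤ 1 / 122 := hα.trans (min_le_left _ _)
  have hα2 : (α : ℝ) ≤ Q * E / 300000 := hα.trans (min_le_right _ _)
  have hα0 : (0 : ℝ) ≤ α := α.2.1
  set L := horizon n with hL
  have hL0 : 0 < L := (log_horizon_le hn).2.1
  set M := meet s v (N.site s v) (N.site v s) with hM
  set H := meetAlone v d (N.site v d) (N.site d v) (N.near v d) with hH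
  have hM0 : ∀ x, 0 ≤ M x := meet_nonneg _ _ _ _
  have hH0 : ∀ x, 0 ≤ H x := meetAlone_nonneg _ _ _ _ _
  have hgM : ∀ x, green L M x ≤ 61 * l := green_meet_le_log hnm hn s v hsv _ _
  have hgH : ∀ x, green L H x ≤ 61 * l := by
    intro x
    refine le_trans ?_ (green_meet_le_log hnm hn v d hvd (N.site v d) (N.site d v) x)
    refine Finset.sum_le_sum fun t ht => mul_le_mul_of_nonneg_left
      (evolve_mono t (meetAlone_le_meet _ _ _ _ _) x) ?_
    have h1 : (t : ℝ) ≤ L := by exact_mod_cast (Finset.mem_range.1 ht).le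
    have := div_le_one_of_le₀ h1 (Nat.cast_nonneg L)
    linarith
  set A : ℝ := α / l with hA
  set y : ℝ := Q / (l + 1) with hy
  have hA0 : 0 ≤ A := by positivity
  have hy0 : 0 < y := by positivity
  -- Here `124 = 1 + 62 + 61`: the condition `α ≤ 1/122` makes `124 · 61 · α = 7564 α` at most `62`,
  -- and the service term is at most `61`.
  have hφ : ∀ x, 1 + A * 124 * green L M x + y * (61 * l - green L H x) ≤ 124 := by
    intro x
    have h1 : A * 124 * green L M x ≤ A * 124 * (61 * l) :=
      mul_le_mul_of_nonneg_left (hgM x) (by positivity)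
    have h2 : A * 124 * (61 * l) = α * 7564 := by rw [hA]; field_simp; ring
    have h3 : y * (61 * l - green L H x) ≤ y * (61 * l) :=
      mul_le_mul_of_nonneg_left (by linarith [green_nonneg L hH0 x]) hy0.le
    have h4 : y * (61 * l) ≤ 61 := by
      rw [hy, div_mul_eq_mul_div, div_le_iff₀ (by linarith)]; nlinarith
    linarith
  have heM : ∀ x, (∑ t ∈ Finset.range L, evolve (t + 1) M x) / L ≤ 56 / n :=
    mean_evolve_meet_le hnm hn s v hsv _ _
  have heH : ∀ x, E / (8 * n) ≤ (∑ t ∈ Finset.range L, evolve (t + 1) H x) / L := by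
    intro x
    have := le_mean_evolve hnm hn H hH0 (E / (4 * m ^ 2)) (by positivity)
      (fun t ht y => N.evolve_meetAlone_ge hN hm v d hvd t ht y) x
    refine le_trans (le_of_eq ?_) this
    rw [em]; field_simp; norm_num
  -- The services give a drift of at least `Q E / (16 n log n)`, and the second condition on `α`
  -- lets the arrivals consume at most half of it.
  have hnet : Q * E / (32 * (n * l)) ≤ y * (E / (8 * n)) - A * 124 * (56 / n) := by
    have h1 : Q * E / (16 * (n * l)) ≤ y * (E / (8 * n)) := by
      rw [hy, div_mul_div_comm]
      apply div_le_div₀ (by positivity) le_rfl (by positivity)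
      nlinarith
    have h2 : A * 124 * (56 / n) ≤ Q * E / (32 * (n * l)) := by
      have : A * 124 * (56 / n) = α * 6944 / (n * l) := by rw [hA]; field_simp; ring
      rw [this, div_le_div_iff₀ (by positivity) (by positivity)]
      have : 0 < (n : ℝ) * l := by positivity
      nlinarith [mul_pos hQ0 hE0]
    have h3 : Q * E / (16 * (n * l)) = Q * E / (32 * (n * l)) + Q * E / (32 * (n * l)) := by
      field_simp; norm_num
    linarith
  have hnet0 : 0 < Q * E / (32 * (n * l)) := by positivity
  set net := y * (E / (8 * n)) - A * 124 * (56 / n) with hnetd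
  set φ := fun x => 1 + A * 124 * green L M x + y * (61 * l - green L H x) with hφd
  have hcon : ∀ x, (1 + A * M x - y * H x) * stepOp φ x ≤ (1 - net / 124) * φ x :=
    fun x => lyapunov_contracts L hL0 M H A y 124 (61 * l) (56 / n) (E / (8 * n)) hM0 hH0 hA0
      hy0.le (by norm_num) hgH hφ heM heH (by linarith) x
  have hφ1 : ∀ x, 1 ≤ φ x := fun x => by
    have h3 : 0 ≤ A * 124 * green L M x := mul_nonneg (by positivity) (green_nonneg L hM0 x)
    have h4 : 0 ≤ y * (61 * l - green L H x) := mul_nonneg hy0.le (by linarith [hgH x])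
    simp only [hφd]; linarith
  -- The factor cannot be negative, since by the contraction it bounds a non-negative quantity after
  -- multiplication with a positive one.
  have hlam0 : 0 ≤ 1 - net / 124 := by
    have h1 := hcon x
    have h2 : 0 ≤ (1 + A * M x - y * H x) * stepOp φ x := by
      refine mul_nonneg ?_ ?_
      · have h3 : H x ≤ 1 := (meetAlone_le_meet _ _ _ _ _ x).trans (meet_le_one _ _ _ _ x)
        have h4 : y ≤ 1 := by rw [hy, div_le_one (by linarith)]; linarith
        have h5 : y * H x ≤ 1 := mul_le_one₀ h4 (hH0 x) h3
        have h6 : 0 ≤ A * M x := mul_nonneg hA0 (hM0 x)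
        linarith
      · have := stepOp_mono hφ1 x
        rw [stepOp_const] at this
        linarith
    by_contra hneg
    push Not at hneg
    have := mul_neg_of_neg_of_pos hneg (lt_of_lt_of_le one_pos (hφ1 x))
    linarith
  have hone : ∀ x, ∫⁻ ξ, N.queueWeight s v d x ξ * ENNReal.ofReal (φ (move x ξ)) ∂(slotLaw n p α)
      ≤ ENNReal.ofReal (1 - net / 124) * ENNReal.ofReal (φ x) := by
    intro x
    calc _ ≤ ∫⁻ ξ, ENNReal.ofReal (N.queueMajorant s v d x fun k => (ξ k).2) *
            ENNReal.ofReal (φ (move x ξ)) ∂(slotLaw n p α) :=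
          lintegral_mono fun ξ => mul_le_mul_left (N.queueWeight_le hl0 s v d x ξ) _
      _ = ENNReal.ofReal ((1 + A * M x - y * H x) * stepOp φ x) := by
          rw [lintegral_slot_eq p α _ (N.queueMajorant_nonneg hl0 s v d x) φ
            (fun x => zero_le_one.trans (hφ1 x)), N.integral_queueMajorant p α s v d hvd x]
      _ ≤ _ := by
          rw [← ENNReal.ofReal_mul hlam0]
          exact ENNReal.ofReal_le_ofReal (hcon x)
  have hdecay : ∀ t, (Measure.infinitePi fun _ => slotLaw n p α) {ω | N.Busy s v d x ω t}
      ≤ ENNReal.ofReal (1 - net / 124) ^ t * ENNReal.ofReal 124 := by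
    intro t
    classical
    have hmeasW := measurable_orbitWeight move (N.queueWeight s v d) t x
    calc _ ≤ (Measure.infinitePi fun _ => slotLaw n p α)
            {ω | 1 ≤ orbitWeight move (N.queueWeight s v d) t x ω} := by
          refine measure_mono fun ω hω => ?_
          have := N.indicator_busy_le s v d hl0 x ω t
          have hω' : N.Busy s v d x ω t := hω
          rw [if_pos hω'] at this
          exact this
      _ ≤ ∫⁻ ω, orbitWeight move (N.queueWeight s v d) t x ω
            ∂(Measure.infinitePi fun _ => slotLaw n p α) := by
          have := mul_meas_ge_le_lintegral (μ := Measure.infinitePi fun _ => slotLaw n p α)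
            hmeasW 1
          rwa [one_mul] at this
      _ ≤ ∫⁻ ω, orbitWeight move (N.queueWeight s v d) t x ω *
            ENNReal.ofReal (φ (orbit move t x ω)) ∂(Measure.infinitePi fun _ => slotLaw n p α) := by
          refine lintegral_mono fun ω => le_mul_of_one_le_right' ?_
          rw [ENNReal.one_le_ofReal]; exact hφ1 _
      _ ≤ ENNReal.ofReal (1 - net / 124) ^ t * ENNReal.ofReal (φ x) :=
          lintegral_orbitWeight_le move (slotLaw n p α) (N.queueWeight s v d)
            (fun x => ENNReal.ofReal (φ x)) _ hone t x
      _ ≤ _ := by gcongr; exact hφ x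
  refine (ENNReal.tsum_le_tsum hdecay).trans ?_
  rw [ENNReal.tsum_mul_right, ENNReal.tsum_geometric]
  have e1 : 1 - ENNReal.ofReal (1 - net / 124) = ENNReal.ofReal (net / 124) := by
    rw [← ENNReal.ofReal_one, ← ENNReal.ofReal_sub _ hlam0]; congr 1; ring
  have hnetpos : 0 < net := lt_of_lt_of_le hnet0 hnet
  rw [e1, ← ENNReal.ofReal_inv_of_pos (by positivity), ← ENNReal.ofReal_mul (by positivity)]
  apply ENNReal.ofReal_le_ofReal
  -- One factor `124` bounds the Lyapunov function at the start, the other comes from the rate in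
  -- the geometric series.
  have h1 : (net / 124)⁻¹ * 124 = 15376 / net := by field_simp; norm_num
  rw [h1]
  calc 15376 / net ≤ 15376 / (Q * E / (32 * (n * l))) := by gcongr
    _ = 492032 / (Q * E) * (n * l) := by field_simp; norm_num
    _ ≤ _ := by gcongr; norm_num

end Sites

namespace Sites

variable {n m : ℕ} [NeZero m] (N : Sites n m)

/-! ### Throughput -/

/-- Source `s` hands a packet over to some node. -/
def Sends (s : Fin n) (x : Fin n → ZMod m) (ξ : Fin n → NodeCoins n) : Prop :=
  ∃ w, s ≠ w ∧ N.Hop s w x ξ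

/-- The number of nodes that `s` meets alone. -/
def aloneCount (s : Fin n) (x : Fin n → ZMod m) : ℝ :=
  ∑ w ∈ Finset.univ.erase s, meetAlone s w (N.site s w) (N.site w s) (N.near s w) x

lemma aloneCount_nonneg (s : Fin n) (x : Fin n → ZMod m) : 0 ≤ N.aloneCount s x :=
  Finset.sum_nonneg fun _ _ => meetAlone_nonneg _ _ _ _ _ _

lemma sum_meetAlone_mul_eq {B κ : ℝ} (hN : N.Good B κ) {s w : Fin n} (hw : s ≠ w)
    {x : Fin n → ZMod m} (h : N.MeetsAlone s w x) (f : Fin n → ℝ) :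
    ∑ w ∈ Finset.univ.erase s, meetAlone s w (N.site s w) (N.site w s) (N.near s w) x * f w
      = f w := by
  classical
  rw [Finset.sum_eq_single w]
  · rw [meetAlone_eq, if_pos h, one_mul]
  · intro w' hw' hne
    rw [meetAlone_eq, if_neg, zero_mul]
    intro h'
    exact hne (h.unique hN hw (Finset.ne_of_mem_erase hw').symm h'.meets)
  · intro hne
    exact absurd (Finset.mem_erase.2 ⟨hw.symm, Finset.mem_univ w⟩) hne

lemma aloneCount_le_one {B κ : ℝ} (hN : N.Good B κ) (s : Fin n) (x : Fin n → ZMod m) :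
    N.aloneCount s x ≤ 1 := by
  classical
  by_cases h : ∃ w, s ≠ w ∧ N.MeetsAlone s w x
  · obtain ⟨w, hw, h⟩ := h
    have := N.sum_meetAlone_mul_eq hN hw h fun _ => 1
    simp only [mul_one] at this
    exact this.le
  · push Not at h
    unfold aloneCount
    rw [Finset.sum_eq_zero]
    · norm_num
    · intro w hw
      rw [meetAlone_eq, if_neg (h w (Finset.ne_of_mem_erase hw).symm)]

/-- Each of the `n - 1` possible partners contributes order `1 / n`, so a node is alone with some
partner with probability of constant order. -/
lemma le_evolve_aloneCount {B κ : ℝ} (hN : N.Good B κ) (hm : 4 * B ≤ m) (hnm : n = m ^ 2)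
    (hn2 : 2 ≤ n) (s : Fin n) (t : ℕ) (ht : 36 * m ^ 2 ≤ t) (y : Fin n → ZMod m) :
    Real.exp (-(4 * B * κ)) / 8 ≤ evolve t (N.aloneCount s) y := by
  have hn0 : (0 : ℝ) < n := by rw [hnm]; have : 0 < m := NeZero.pos m; positivity
  have em : (m : ℝ) ^ 2 = n := by rw [hnm]; push_cast; rfl
  unfold aloneCount
  rw [evolve_sum (Finset.univ.erase s) t
    (fun w => meetAlone s w (N.site s w) (N.site w s) (N.near s w)) y]
  have h1 : ∑ w ∈ Finset.univ.erase s, Real.exp (-(4 * B * κ)) / (4 * m ^ 2)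
      ≤ ∑ w ∈ Finset.univ.erase s,
        evolve t (meetAlone s w (N.site s w) (N.site w s) (N.near s w)) y :=
    Finset.sum_le_sum fun w hw =>
      N.evolve_meetAlone_ge hN hm s w (Finset.ne_of_mem_erase hw).symm t ht y
  refine le_trans ?_ h1
  rw [Finset.sum_const, Finset.card_erase_of_mem (Finset.mem_univ s), Finset.card_univ,
    Fintype.card_fin, nsmul_eq_mul, em]
  have h2 : (n : ℝ) / 2 ≤ ((n - 1 : ℕ) : ℝ) := by
    rw [Nat.cast_sub (by omega)]
    have : (2 : ℝ) ≤ n := by exact_mod_cast hn2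
    push_cast; linarith
  have hE := Real.exp_pos (-(4 * B * κ))
  calc Real.exp (-(4 * B * κ)) / 8 = (n : ℝ) / 2 * (Real.exp (-(4 * B * κ)) / (4 * n)) := by
        field_simp; norm_num
    _ ≤ _ := by gcongr

/-- The weight of a time-slot: every departure of a packet multiplies by `1 - 1 / L`. -/
def sendMajorant (L : ℕ) (s : Fin n) (x : Fin n → ZMod m) (q : Fin n → RestCoins n) : ℝ :=
  1 - 1 / L * ∑ w ∈ Finset.univ.erase s,
    meetAlone s w (N.site s w) (N.site w s) (N.near s w) x *
      (if ((q s).1.1 = true ∧ (q s).1.2.1 = true) ∧ (q w).1.1 = false then 1 else 0)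

lemma sendMajorant_nonneg {B κ : ℝ} (hN : N.Good B κ) (L : ℕ) (s : Fin n)
    (x : Fin n → ZMod m) (q : Fin n → RestCoins n) : 0 ≤ N.sendMajorant L s x q := by
  have h1 : ∑ w ∈ Finset.univ.erase s,
      meetAlone s w (N.site s w) (N.site w s) (N.near s w) x *
      (if ((q s).1.1 = true ∧ (q s).1.2.1 = true) ∧ (q w).1.1 = false then 1 else 0) ≤ 1 := by
    refine le_trans (Finset.sum_le_sum fun w _ => ?_) (N.aloneCount_le_one hN s x)
    refine mul_le_of_le_one_right (meetAlone_nonneg _ _ _ _ _ _) ?_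
    split_ifs <;> norm_num
  have h2 : 0 ≤ ∑ w ∈ Finset.univ.erase s,
      meetAlone s w (N.site s w) (N.site w s) (N.near s w) x *
      (if ((q s).1.1 = true ∧ (q s).1.2.1 = true) ∧ (q w).1.1 = false then (1 : ℝ) else 0) := by
    refine Finset.sum_nonneg fun w _ => mul_nonneg (meetAlone_nonneg _ _ _ _ _ _) ?_
    split_ifs <;> norm_num
  have h3 : (1 : ℝ) / L ≤ 1 := by
    rcases Nat.eq_zero_or_pos L with h | h
    · simp [h]
    · rw [div_le_one (by exact_mod_cast h)]; exact_mod_cast h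
  have h4 := mul_le_one₀ h3 h2 h1
  unfold sendMajorant
  linarith

-- At most one summand of the majorant is non-zero, as the node that is met alone is unique; hence
-- the affine expression is exact.
open Classical in
lemma sendWeight_eq {B κ : ℝ} (hN : N.Good B κ) (L : ℕ) (s : Fin n)
    (x : Fin n → ZMod m) (ξ : Fin n → NodeCoins n) :
    (if N.Sends s x ξ then 1 - 1 / (L : ℝ) else 1) = N.sendMajorant L s x fun k => (ξ k).2 := by
  unfold sendMajorant
  split_ifs with h
  · obtain ⟨w, hw, h⟩ := h
    have h2 : ((ξ s).2.1.1 = true ∧ (ξ s).2.1.2.1 = true) ∧ (ξ w).2.1.1 = false := h.2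
    rw [N.sum_meetAlone_mul_eq hN hw h.1]
    simp [h2]
  · rw [Finset.sum_eq_zero]
    · simp
    · intro w hw
      rw [meetAlone_eq]
      by_cases h1 : N.MeetsAlone s w x
      · rw [if_neg (c := _ ∧ _), mul_zero]
        intro h2
        exact h ⟨w, (Finset.ne_of_mem_erase hw).symm, h1, h2⟩
      · rw [if_neg h1, zero_mul]

lemma integral_sendMajorant (p α : I) (L : ℕ) (s : Fin n) (x : Fin n → ZMod m) :
    ∫ q, N.sendMajorant L s x q ∂(Measure.pi fun _ => restLaw n p α)
      = 1 - p * α * (1 - p) / L * N.aloneCount s x := by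
  classical
  unfold sendMajorant
  rw [integral_sub Integrable.of_finite Integrable.of_finite, integral_const_mul,
    integral_finsetSum _ fun _ _ => Integrable.of_finite]
  have h2 : ∀ w ∈ Finset.univ.erase s, ∫ q : Fin n → RestCoins n,
      meetAlone s w (N.site s w) (N.site w s) (N.near s w) x *
      (if ((q s).1.1 = true ∧ (q s).1.2.1 = true) ∧ (q w).1.1 = false then (1 : ℝ) else 0)
        ∂(Measure.pi fun _ => restLaw n p α)
      = meetAlone s w (N.site s w) (N.site w s) (N.near s w) x * (p * α * (1 - p)) := by
    intro w hw
    have h := integral_pair_event p α s w (Finset.ne_of_mem_erase hw).symm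
      (fun q : RestCoins n => q.1.1 = true ∧ q.1.2.1 = true)
      (fun q => q.1.1 = false) (p * α) (1 - p) (mul_nonneg p.2.1 α.2.1)
      (by have := p.2.2; linarith) (restLaw_activeA_sendA p α) (restLaw_not_activeA p α)
    have e : ∫ q : Fin n → RestCoins n,
        (if ((q s).1.1 = true ∧ (q s).1.2.1 = true) ∧ (q w).1.1 = false then (1 : ℝ) else 0)
        ∂(Measure.pi fun _ => restLaw n p α) = p * α * (1 - p) := by convert h
    rw [integral_const_mul, e]
  rw [Finset.sum_congr rfl h2, ← Finset.sum_mul, aloneCount]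
  simp
  ring

/-- A Chernoff bound for dependent slots: every departure gets the weight `1 - 1 / L`, and
`lyapunov_contracts` without arrivals shows that the mean weight decays exponentially. Few
departures would leave the weight large, so Markov's inequality and the Borel-Cantelli lemma give a
linear rate. -/
lemma ae_eventually_tally_sends {B κ : ℝ} (hN : N.Good B κ) (hm : 4 * B ≤ m) (hnm : n = m ^ 2)
    (hn : 72 ≤ Real.log n) (p α : I) (hp0 : 0 < p) (hp1 : p < 1) (hα : 0 < α) (s : Fin n)
    (x : Fin n → ZMod m) :
    ∀ᵐ ω ∂(Measure.infinitePi fun _ => slotLaw n p α), ∀ᶠ S : ℕ in atTop,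
      p * α * (1 - p) * Real.exp (-(4 * B * κ)) / 128 * S ≤ (tally (N.Sends s) x ω S : ℝ) := by
  classical
  have hp0' : (0 : ℝ) < p := hp0
  have hp1' : (p : ℝ) < 1 := hp1
  have hα' : (0 : ℝ) < α := hα
  have hα1 : (α : ℝ) ≤ 1 := α.2.2
  have hn0 : (0 : ℝ) < n := by rw [hnm]; have : 0 < m := NeZero.pos m; positivity
  set E := Real.exp (-(4 * B * κ)) with hE
  have hE0 : 0 < E := Real.exp_pos _
  set Q : ℝ := p * α * (1 - p) with hQ
  have hQ0 : 0 < Q := mul_pos (mul_pos hp0' hα') (by linarith)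
  have hQ1 : Q ≤ 1 := by
    have : (p : ℝ) * α ≤ 1 := mul_le_one₀ hp1'.le hα'.le hα1
    exact mul_le_one₀ this (by linarith) (by linarith)
  set L := horizon n with hL
  obtain ⟨_, hL0, _, hLn⟩ := log_horizon_le hn
  have hn2 : 2 ≤ n := by
    have h1 := Real.log_le_sub_one_of_pos hn0
    have : (2 : ℝ) ≤ n := by linarith
    exact_mod_cast this
  have hL2 : (2 : ℝ) ≤ L := by
    have : (2 : ℝ) ≤ n := by exact_mod_cast hn2
    nlinarith
  have hL0' : (0 : ℝ) < L := by linarith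
  set H := N.aloneCount s with hH
  have hH0 : ∀ x, 0 ≤ H x := N.aloneCount_nonneg s
  have hH1 : ∀ x, H x ≤ 1 := N.aloneCount_le_one hN s
  -- The trivial bound for the Green function is enough, since the weight of one departure differs
  -- from one only by `1 / L`.
  have hgH : ∀ x, green L H x ≤ L := by
    intro x
    refine (green_le L hH0 x).trans ?_
    calc _ ≤ ∑ t ∈ Finset.range L, (1 : ℝ) := Finset.sum_le_sum fun t _ => by
          have := evolve_mono t hH1 x
          rwa [evolve_const] at this
      _ = L := by simp
  have heH : ∀ x, E / 16 ≤ (∑ t ∈ Finset.range L, evolve (t + 1) H x) / L := by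
    intro x
    have := le_mean_evolve hnm hn H hH0 (E / 8) (by positivity)
      (fun t ht y => N.le_evolve_aloneCount hN hm hnm hn2 s t ht y) x
    linarith
  have hφ : ∀ x, 1 + 0 * 2 * green L (fun _ => 0) x + Q / L * (L - green L H x) ≤ 2 := by
    intro x
    have h1 : Q / L * (L - green L H x) ≤ Q / L * L :=
      mul_le_mul_of_nonneg_left (by linarith [green_nonneg L hH0 x]) (by positivity)
    rw [div_mul_cancel₀ _ hL0'.ne'] at h1
    linarith
  set φ := fun x => 1 + 0 * 2 * green L (fun _ => 0) x + Q / L * (L - green L H x) with hφd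
  have hnet : Q / L * (E / 16) - 0 * 2 * 0 = Q * E / (16 * L) := by field_simp; ring
  have hcon : ∀ x, (1 + 0 * 0 - Q / L * H x) * stepOp φ x
      ≤ (1 - (Q / L * (E / 16) - 0 * 2 * 0) / 2) * φ x :=
    fun x => lyapunov_contracts L hL0 (fun _ => 0) H 0 (Q / L) 2 L 0 (E / 16) (fun _ => le_rfl) hH0
      le_rfl (by positivity) two_pos hgH hφ (fun x => by simp [evolve_const]) heH
      (by rw [hnet]; positivity) x
  have hφ1 : ∀ x, 1 ≤ φ x := fun x => by
    have h4 : 0 ≤ Q / L * (L - green L H x) := mul_nonneg (by positivity) (by linarith [hgH x])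
    simp only [hφd]; linarith
  set lam := 1 - (Q / L * (E / 16) - 0 * 2 * 0) / 2 with hlam
  have hE1 : E ≤ 8 := by
    have := N.le_evolve_aloneCount hN hm hnm hn2 s (36 * m ^ 2) le_rfl x
    have h2 := evolve_mono (36 * m ^ 2) hH1 x
    rw [evolve_const] at h2
    linarith
  have hlam0 : 0 ≤ lam := by
    rw [hlam, hnet]
    have : Q * E / (16 * L) ≤ 1 := by
      rw [div_le_one (by positivity)]; nlinarith
    linarith
  set ρ : (Fin n → ZMod m) → (Fin n → NodeCoins n) → ℝ≥0∞ := fun x ξ =>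
    if N.Sends s x ξ then ENNReal.ofReal (1 - 1 / L) else 1 with hρ
  have hone : ∀ x, ∫⁻ ξ, ρ x ξ * ENNReal.ofReal (φ (move x ξ)) ∂(slotLaw n p α)
      ≤ ENNReal.ofReal lam * ENNReal.ofReal (φ x) := by
    intro x
    have e : ∀ ξ, ρ x ξ = ENNReal.ofReal (N.sendMajorant L s x fun k => (ξ k).2) := by
      intro ξ
      rw [← N.sendWeight_eq hN, hρ]
      by_cases h : N.Sends s x ξ
      · simp only [if_pos h]
      · simp only [if_neg h, ENNReal.ofReal_one]
    simp only [e]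
    rw [lintegral_slot_eq p α _ (N.sendMajorant_nonneg hN L s x) φ
      (fun x => zero_le_one.trans (hφ1 x)), N.integral_sendMajorant p α L s x,
      ← ENNReal.ofReal_mul hlam0]
    apply ENNReal.ofReal_le_ofReal
    have := hcon x
    simpa using this
  -- With fewer than `c S` departures the weight is at least `exp (-2 c S / L) = exp (-Q E S / (64
  -- L))`, while its mean is at most `2 exp (-Q E S / (32 L))`. Half of the rate is left for
  -- summability.
  set c := Q * E / 128 with hc
  have hdecay : ∀ S : ℕ, (Measure.infinitePi fun _ => slotLaw n p α)
      {ω | (tally (N.Sends s) x ω S : ℝ) < c * S}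
      ≤ ENNReal.ofReal (2 * Real.exp (-(Q * E / (64 * L))) ^ S) := by
    intro S
    set b := ENNReal.ofReal (Real.exp (-(2 * c * S / L))) with hb
    have hmeasW := measurable_orbitWeight move ρ S x
    have h1 : (Measure.infinitePi fun _ => slotLaw n p α)
        {ω | (tally (N.Sends s) x ω S : ℝ) < c * S}
        ≤ (Measure.infinitePi fun _ => slotLaw n p α) {ω | b ≤ orbitWeight move ρ S x ω} := by
      refine measure_mono fun ω hω => ?_
      have hω' : (tally (N.Sends s) x ω S : ℝ) < c * S := hω
      have h2 : orbitWeight move ρ S x ω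
          = ENNReal.ofReal ((1 - 1 / L) ^ tally (N.Sends s) x ω S) := by
        rw [orbitWeight_eq_prod, hρ, prod_ite_tally (N.Sends s), ENNReal.ofReal_pow]
        have : 1 / (L : ℝ) ≤ 1 := by rw [div_le_one hL0']; linarith
        linarith
      show b ≤ orbitWeight move ρ S x ω
      rw [h2, hb]
      apply ENNReal.ofReal_le_ofReal
      have h3 : Real.exp (-(2 / L)) ≤ 1 - 1 / L := by
        have h4 : (1 : ℝ) / L ≤ 1 / 2 := one_div_le_one_div_of_le two_pos hL2
        have e : Real.exp (-(2 / (L : ℝ))) = (Real.exp (2 * (1 / L)))⁻¹ := by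
          rw [← Real.exp_neg]; congr 1; ring
        rw [e, inv_le_iff_one_le_mul₀ (Real.exp_pos _)]
        have h5 := Real.add_one_le_exp (2 * (1 / (L : ℝ)))
        have h6 : 0 < 1 / (L : ℝ) := by positivity
        nlinarith
      calc Real.exp (-(2 * c * S / L)) ≤ Real.exp (tally (N.Sends s) x ω S * (-(2 / L))) := by
            apply Real.exp_le_exp.2
            have e : 2 * c * (S : ℝ) / L = c * S * (2 / L) := by ring
            rw [e]
            have : 0 < 2 / (L : ℝ) := by positivity
            nlinarith
        _ = Real.exp (-(2 / L)) ^ tally (N.Sends s) x ω S := Real.exp_nat_mul _ _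
        _ ≤ _ := pow_le_pow_left₀ (Real.exp_pos _).le h3 _
    have h2 : b * (Measure.infinitePi fun _ => slotLaw n p α) {ω | b ≤ orbitWeight move ρ S x ω}
        ≤ ENNReal.ofReal (2 * lam ^ S) := by
      calc _ ≤ ∫⁻ ω, orbitWeight move ρ S x ω ∂(Measure.infinitePi fun _ => slotLaw n p α) :=
            mul_meas_ge_le_lintegral hmeasW b
        _ ≤ ∫⁻ ω, orbitWeight move ρ S x ω * ENNReal.ofReal (φ (orbit move S x ω))
              ∂(Measure.infinitePi fun _ => slotLaw n p α) := by
            refine lintegral_mono fun ω => le_mul_of_one_le_right' ?_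
            rw [ENNReal.one_le_ofReal]; exact hφ1 _
        _ ≤ ENNReal.ofReal lam ^ S * ENNReal.ofReal (φ x) :=
            lintegral_orbitWeight_le move (slotLaw n p α) ρ
              (fun x => ENNReal.ofReal (φ x)) _ hone S x
        _ ≤ ENNReal.ofReal lam ^ S * ENNReal.ofReal 2 := by gcongr; exact hφ x
        _ = _ := by
            rw [← ENNReal.ofReal_pow hlam0, ← ENNReal.ofReal_mul (by positivity), mul_comm]
    have hb0 : b ≠ 0 := by rw [hb]; simp [Real.exp_pos]
    have hbt : b ≠ ∞ := by rw [hb]; simp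
    refine h1.trans ?_
    rw [mul_comm, ← ENNReal.le_div_iff_mul_le (Or.inl hb0) (Or.inl hbt)] at h2
    refine h2.trans ?_
    rw [hb, ← ENNReal.ofReal_div_of_pos (Real.exp_pos _)]
    apply ENNReal.ofReal_le_ofReal
    rw [div_le_iff₀ (Real.exp_pos _), mul_assoc]
    refine mul_le_mul_of_nonneg_left ?_ two_pos.le
    have h3 : lam ≤ Real.exp (-(Q * E / (32 * L))) := by
      have := Real.add_one_le_exp (-(Q * E / (32 * L)))
      refine le_trans (le_of_eq ?_) this
      rw [hlam, hnet]; field_simp; ring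
    calc lam ^ S ≤ Real.exp (-(Q * E / (32 * L))) ^ S := pow_le_pow_left₀ hlam0 h3 S
      _ = _ := by
        rw [← Real.exp_nat_mul, ← Real.exp_nat_mul, ← Real.exp_add]
        congr 1
        rw [hc]; field_simp; ring
  have hsum : ∑' S : ℕ, (Measure.infinitePi fun _ => slotLaw n p α)
      {ω | (tally (N.Sends s) x ω S : ℝ) < c * S} ≠ ∞ := by
    refine ne_top_of_le_ne_top ?_ (ENNReal.tsum_le_tsum hdecay)
    have hs : Summable fun S : ℕ => 2 * Real.exp (-(Q * E / (64 * L))) ^ S := by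
      refine Summable.mul_left _ (summable_geometric_of_lt_one (Real.exp_pos _).le ?_)
      rw [Real.exp_lt_one_iff]
      have : 0 < Q * E / (64 * L) := by positivity
      linarith
    rw [← ENNReal.ofReal_tsum_of_nonneg (fun S => by positivity) hs]
    exact ENNReal.ofReal_ne_top
  filter_upwards [ae_eventually_notMem hsum] with ω hω
  filter_upwards [hω] with S hS
  exact not_lt.1 hS

end Sites

/-! ### The stationary start -/

section Start

variable {n m : ℕ} [NeZero m]

/-- The law of the initial positions. -/
def startLaw (n m : ℕ) [NeZero m] : Measure (Fin n → ZMod m) := Measure.pi fun _ => unif (ZMod m)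

instance startLawIsProbabilityMeasure (n m : ℕ) [NeZero m] :
    IsProbabilityMeasure (startLaw n m) := by
  unfold startLaw; infer_instance

/-- The law of the initial positions and of all coins. -/
def pathLaw (n m : ℕ) [NeZero m] (p α : I) :
    Measure ((Fin n → ZMod m) × (ℕ → Fin n → NodeCoins n)) :=
  (startLaw n m).prod (Measure.infinitePi fun _ : ℕ => slotLaw n p α)

instance pathLawIsProbabilityMeasure (n m : ℕ) [NeZero m] (p α : I) :
    IsProbabilityMeasure (pathLaw n m p α) := by
  unfold pathLaw; infer_instance

lemma startLaw_singleton (x : Fin n → ZMod m) : startLaw n m {x} = ((m : ℝ≥0∞)⁻¹) ^ n := by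
  rw [startLaw, Measure.pi_singleton]
  simp [unif_singleton, ZMod.card]

lemma lintegral_startLaw (f : (Fin n → ZMod m) → ℝ≥0∞) :
    ∫⁻ x, f x ∂(startLaw n m) = (∑ x, f x) * ((m : ℝ≥0∞)⁻¹) ^ n := by
  rw [lintegral_fintype, Finset.sum_mul]
  exact Finset.sum_congr rfl fun x _ => by rw [startLaw_singleton]

lemma measurePreserving_move (ξ : Fin n → NodeCoins n) :
    MeasurePreserving (fun x => move x ξ) (startLaw n m) (startLaw n m) := by
  refine ⟨measurable_of_countable _, Measure.ext_of_singleton fun y => ?_⟩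
  rw [Measure.map_apply (measurable_of_countable _) (measurableSet_singleton y)]
  have : (fun x => move x ξ) ⁻¹' {y} = {fun v => y v - (ξ v).step m} := by
    ext x
    simp only [Set.mem_preimage, Set.mem_singleton_iff, move, funext_iff, eq_sub_iff_add_eq]
  rw [this, startLaw_singleton, startLaw_singleton]

lemma measurePreserving_orbitShift_move (p α : I) :
    MeasurePreserving (orbitShift move) (pathLaw n m p α) (pathLaw n m p α) :=
  measurePreserving_orbitShift move _ _ measurePreserving_move

/-- Exchanging the coordinate `d` of `x` with the extra value `c` is an involution of the pairs `(x,
c)`. -/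
lemma sum_update (d : Fin n) (F : (Fin n → ZMod m) → ℝ≥0∞) :
    ∑ x, ∑ c, F (Function.update x d c) = m * ∑ x, F x := by
  rw [← Fintype.sum_prod_type']
  let e : (Fin n → ZMod m) × ZMod m ≃ (Fin n → ZMod m) × ZMod m :=
    { toFun := fun q => (Function.update q.1 d q.2, q.1 d)
      invFun := fun q => (Function.update q.1 d q.2, q.1 d)
      left_inv := fun q => by simp
      right_inv := fun q => by simp }
  rw [Fintype.sum_equiv e (fun q => F (Function.update q.1 d q.2)) (fun q => F q.1) fun q => rfl,
    Fintype.sum_prod_type]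
  simp [ZMod.card, Finset.mul_sum]

lemma lintegral_startLaw_update (d : Fin n) (F : (Fin n → ZMod m) → ℝ≥0∞) :
    ∫⁻ x, F x ∂(startLaw n m)
      = ∫⁻ x, (∑ c, F (Function.update x d c)) * (m : ℝ≥0∞)⁻¹ ∂(startLaw n m) := by
  have hm0 : (m : ℝ≥0∞) ≠ 0 := Nat.cast_ne_zero.2 (NeZero.ne m)
  rw [lintegral_startLaw, lintegral_startLaw, ← Finset.sum_mul, sum_update, mul_comm (m : ℝ≥0∞),
    mul_assoc (∑ x, F x), ENNReal.mul_inv_cancel hm0 (ENNReal.natCast_ne_top m), mul_one]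

/-- The mean of a function of the initial positions. -/
lemma lintegral_startLaw_ofReal_ge (f : (Fin n → ZMod m) → ℝ) (hf : ∀ x, 0 ≤ f x) (t : ℕ) (c : ℝ)
    (h : ∀ y, c ≤ evolve t f y) :
    ENNReal.ofReal c ≤ ∫⁻ x, ENNReal.ofReal (f x) ∂(startLaw n m) := by
  -- The uniform law is stationary, so `f` may be replaced by its evolution, taken after mixing.
  have h1 : ∑ x, ENNReal.ofReal (f x) = ∑ x, ENNReal.ofReal (evolve t f x) := by
    rw [← ENNReal.ofReal_sum_of_nonneg fun x _ => hf x,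
      ← ENNReal.ofReal_sum_of_nonneg fun x _ => evolve_nonneg t hf x, sum_evolve]
  rw [lintegral_startLaw, h1, ← lintegral_startLaw]
  calc ENNReal.ofReal c = ∫⁻ _, ENNReal.ofReal c ∂(startLaw n m) := by simp
    _ ≤ _ := lintegral_mono fun x => ENNReal.ofReal_le_ofReal (h x)

end Start

namespace Sites

variable {n m : ℕ} [NeZero m] (N : Sites n m)

lemma startLaw_meets (s w : Fin n) (hsw : s ≠ w) :
    startLaw n m {x | N.Meets s w x} = (m : ℝ≥0∞)⁻¹ * (m : ℝ≥0∞)⁻¹ := by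
  have := pi_pair_event (unif (ZMod m)) s w hsw {N.site s w} {N.site w s}
  rw [unif_singleton, unif_singleton, ZMod.card] at this
  exact this

/-! ### Late meetings -/

/-- Optional stopping with the Green function for meetings of `w` and `d`, which is at least `log (L
/ 4) / 360` when they meet. Whether `s` and `w` meet at the start does not involve `d`, so the
starting value can be averaged over the position of `d`; the last factor is the probability that `s`
and `w` meet. -/
lemma lintegral_meets_hit_le (p α : I) (s w d : Fin n) (hsw : s ≠ w) (hsd : s ≠ d) (hwd : w ≠ d)
    (L T : ℕ) (hL : 0 < L) :
    ENNReal.ofReal (Real.log (L / 4) / 360) * pathLaw n m p α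
        {q | N.Meets s w q.1 ∧ ∃ t ≤ T, N.Meets w d (orbit move t q.1 q.2)}
      ≤ ENNReal.ofReal ((1 + L / m + 6 * √L) / m
          + T * ((2 * L / m ^ 2 + 18 * (1 + Real.log L)) / L)) *
        ((m : ℝ≥0∞)⁻¹ * (m : ℝ≥0∞)⁻¹) := by
  classical
  have hm0 : (0 : ℝ) < m := by exact_mod_cast NeZero.pos m
  set γ := Real.log (L / 4) / 360 with hγ
  set b := (2 * L / m ^ 2 + 18 * (1 + Real.log L)) / L with hb
  have hlogL : 0 ≤ Real.log L := Real.log_natCast_nonneg L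
  have hb0 : 0 ≤ b := by positivity
  set f := meet w d (N.site w d) (N.site d w) with hf
  have hf0 : ∀ x, 0 ≤ f x := meet_nonneg _ _ _ _
  set P := Measure.infinitePi fun _ : ℕ => slotLaw n p α with hP
  set hit : (Fin n → ZMod m) → Set (ℕ → Fin n → NodeCoins n) := fun x =>
    {ω | ∃ t ≤ T, orbit move t x ω ∈ {x | N.Meets w d x}} with hhit
  have hhitm : ∀ x, MeasurableSet (hit x) := by
    intro x
    have : hit x = ⋃ t ∈ Finset.range (T + 1), {ω | orbit move t x ω ∈ {x | N.Meets w d x}} := by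
      ext ω; simp [hhit]
    rw [this]
    refine Finset.measurableSet_biUnion _ fun t _ => ?_
    exact measurableSet_setOfPred.2 (measurable_orbit_comp move t x (fun y => y ∈ {x | N.Meets w d x}))
  have h1 : ∀ x, ENNReal.ofReal γ * P (hit x) ≤ ENNReal.ofReal (green L f x + T * b) := by
    refine lintegral_hit_le p α {x | N.Meets w d x} (green L f) (green_nonneg L hf0) γ b hb0 ?_ ?_ T
    · intro x hx
      have hx' : N.Meets w d x := hx
      have := le_green_meet_self L hL w d hwd x
      rw [hx'.1, hx'.2] at this
      exact this
    · intro x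
      rw [stepOp_green L hL]
      have h2 := sum_evolve_succ_meet_le L w d hwd (N.site w d) (N.site d w) x
      have h3 : (∑ t ∈ Finset.range L, evolve (t + 1) f x) / L ≤ b := by
        rw [hb]; gcongr
      linarith [hf0 x]
  have hset : MeasurableSet {q : (Fin n → ZMod m) × (ℕ → Fin n → NodeCoins n) |
      N.Meets s w q.1 ∧ ∃ t ≤ T, N.Meets w d (orbit move t q.1 q.2)} := by
    refine measurableSet_setOfPred.2 (measurable_from_prod_countable_right fun x => ?_)
    by_cases hx : N.Meets s w x
    · simpa [hx] using measurableSet_setOfPred.1 (hhitm x)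
    · simp [hx]
  have hprod : pathLaw n m p α
      {q | N.Meets s w q.1 ∧ ∃ t ≤ T, N.Meets w d (orbit move t q.1 q.2)}
      = ∫⁻ x, (if N.Meets s w x then P (hit x) else 0) ∂(startLaw n m) := by
    rw [pathLaw, Measure.prod_apply hset]
    refine lintegral_congr fun x => ?_
    split_ifs with hx
    · congr 1; ext ω; simp [hx, hhit]
    · have : (Prod.mk x ⁻¹' {q : (Fin n → ZMod m) × (ℕ → Fin n → NodeCoins n) |
          N.Meets s w q.1 ∧ ∃ t ≤ T, N.Meets w d (orbit move t q.1 q.2)}) = ∅ := by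
        ext ω; simp [hx]
      rw [this, measure_empty]
  -- This independence from the coordinate `d` is where `s ≠ d` and `w ≠ d` are used.
  have hupd : ∀ x c, N.Meets s w (Function.update x d c) ↔ N.Meets s w x := by
    intro x c
    simp [Meets, Function.update_of_ne hsd, Function.update_of_ne hwd]
  rw [hprod, ← lintegral_const_mul _ (measurable_of_countable _)]
  calc _ ≤ ∫⁻ x, (if N.Meets s w x then ENNReal.ofReal (green L f x + T * b) else 0)
          ∂(startLaw n m) := by
        refine lintegral_mono fun x => ?_
        show ENNReal.ofReal γ * (if N.Meets s w x then P (hit x) else 0) ≤ _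
        split_ifs
        · exact h1 x
        · simp
    _ = ∫⁻ x, (∑ c, if N.Meets s w (Function.update x d c) then
          ENNReal.ofReal (green L f (Function.update x d c) + T * b) else 0) * (m : ℝ≥0∞)⁻¹
          ∂(startLaw n m) := lintegral_startLaw_update d _
    _ ≤ ∫⁻ x, {x | N.Meets s w x}.indicator (fun _ => ENNReal.ofReal ((1 + L / m + 6 * √L) / m
          + T * b)) x ∂(startLaw n m) := by
        refine lintegral_mono fun x => ?_
        simp only [hupd]
        by_cases hx : N.Meets s w x
        · rw [Set.indicator_of_mem (show x ∈ {x | N.Meets s w x} from hx)]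
          simp only [hx, if_true]
          rw [← ENNReal.ofReal_sum_of_nonneg fun c _ => add_nonneg (green_nonneg L hf0 _)
            (by positivity)]
          have e : (m : ℝ≥0∞)⁻¹ = ENNReal.ofReal ((m : ℝ)⁻¹) := by
            rw [ENNReal.ofReal_inv_of_pos hm0, ENNReal.ofReal_natCast]
          rw [e, ← ENNReal.ofReal_mul' (by positivity)]
          apply ENNReal.ofReal_le_ofReal
          rw [Finset.sum_add_distrib]
          have h4 := sum_green_meet_update_le L w d hwd (N.site w d) (N.site d w) x
          rw [Finset.sum_const, Finset.card_univ, ZMod.card, nsmul_eq_mul]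
          calc _ ≤ ((1 + L / m + 6 * √L) + m * (T * b)) * (m : ℝ)⁻¹ := by gcongr
            _ = _ := by field_simp
        · rw [Set.indicator_of_notMem (show x ∉ {x | N.Meets s w x} from hx)]
          simp [hx]
    _ = _ := by
        rw [lintegral_indicator_const (measurableSet_setOfPred.2 (measurable_of_countable _)),
          N.startLaw_meets s w hsw]

lemma pathLaw_hop_ge {B κ : ℝ} (hN : N.Good B κ) (hm : 4 * B ≤ m) (p α : I) (s w : Fin n)
    (hsw : s ≠ w) :
    ENNReal.ofReal (p * α * (1 - p) * (Real.exp (-(4 * B * κ)) / (4 * m ^ 2)))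
      ≤ pathLaw n m p α {q | N.Hop s w q.1 (q.2 0)} := by
  classical
  have hset : MeasurableSet {q : (Fin n → ZMod m) × (ℕ → Fin n → NodeCoins n) |
      N.Hop s w q.1 (q.2 0)} := by
    refine measurableSet_setOfPred.2 (measurable_from_prod_countable_right fun x => ?_)
    exact (measurable_of_countable (N.Hop s w x)).comp (measurable_pi_apply 0)
  rw [pathLaw, Measure.prod_apply hset]
  have hQ : 0 ≤ (p : ℝ) * α * (1 - p) :=
    mul_nonneg (mul_nonneg p.2.1 α.2.1) (by have := p.2.2; linarith)
  have h := integral_pair_event p α s w hsw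
      (fun q : RestCoins n => q.1.1 = true ∧ q.1.2.1 = true)
      (fun q => q.1.1 = false) (p * α) (1 - p) (mul_nonneg p.2.1 α.2.1)
      (by have := p.2.2; linarith) (restLaw_activeA_sendA p α) (restLaw_not_activeA p α)
  set f := meetAlone s w (N.site s w) (N.site w s) (N.near s w) with hf
  have hf0 : ∀ x, 0 ≤ f x := meetAlone_nonneg _ _ _ _ _
  have h1 : ∀ x, (Measure.infinitePi fun _ : ℕ => slotLaw n p α)
      (Prod.mk x ⁻¹' {q | N.Hop s w q.1 (q.2 0)})
      = ENNReal.ofReal (p * α * (1 - p)) * ENNReal.ofReal (f x) := by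
    intro x
    have e1 : Prod.mk x ⁻¹' {q : (Fin n → ZMod m) × (ℕ → Fin n → NodeCoins n) |
        N.Hop s w q.1 (q.2 0)} = (fun ω => ω 0) ⁻¹' {ξ | N.Hop s w x ξ} := rfl
    have hm1 : MeasurableSet {ξ : Fin n → NodeCoins n | N.Hop s w x ξ} :=
      measurableSet_setOfPred.2 (measurable_of_countable _)
    have e2 := (measurePreserving_eval_infinitePi (fun _ : ℕ => slotLaw n p α) 0).measure_preimage
      hm1.nullMeasurableSet
    rw [e1]
    refine Eq.trans e2 ?_
    have h2 := lintegral_slot_eq (m := m) p α (fun q => if ((q s).1.1 = true ∧ (q s).1.2.1 = true) ∧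
      (q w).1.1 = false then (1 : ℝ) else 0) (fun q => by split_ifs <;> norm_num)
      (fun _ => f x) (fun _ => hf0 x) x
    have e3 : ∫ q : Fin n → RestCoins n,
        (if ((q s).1.1 = true ∧ (q s).1.2.1 = true) ∧ (q w).1.1 = false then (1 : ℝ) else 0)
        ∂(Measure.pi fun _ => restLaw n p α) = p * α * (1 - p) := by convert h
    rw [e3, stepOp_const, ENNReal.ofReal_mul hQ] at h2
    rw [← h2, ← lintegral_indicator_one hm1]
    refine lintegral_congr fun ξ => ?_
    have hfx := N.meetAlone_eq s w x
    by_cases h3 : N.Hop s w x ξ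
    · rw [Set.indicator_of_mem (show ξ ∈ {ξ | N.Hop s w x ξ} from h3), hf, hfx, if_pos h3.1]
      have h5 : ((ξ s).2.1.1 = true ∧ (ξ s).2.1.2.1 = true) ∧ (ξ w).2.1.1 = false := h3.2
      simp [h5]
    · rw [Set.indicator_of_notMem (show ξ ∉ {ξ | N.Hop s w x ξ} from h3)]
      by_cases h4 : N.MeetsAlone s w x
      · have h5 : ¬(((ξ s).2.1.1 = true ∧ (ξ s).2.1.2.1 = true) ∧ (ξ w).2.1.1 = false) :=
          fun h5 => h3 ⟨h4, h5⟩
        simp [h5]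
      · rw [hf, hfx, if_neg h4]; simp
  simp only [h1]
  rw [lintegral_const_mul _ (measurable_of_countable _), ENNReal.ofReal_mul hQ]
  gcongr
  exact lintegral_startLaw_ofReal_ge f hf0 (36 * m ^ 2) _
    fun y => N.evolve_meetAlone_ge hN hm s w hsw (36 * m ^ 2) le_rfl y

/-- Source `s` hands a packet for `d` over to a node that does not meet `d` up to time `T`. -/
def Late (s d : Fin n) (T : ℕ) (q : (Fin n → ZMod m) × (ℕ → Fin n → NodeCoins n)) : Prop :=
  ∃ w, w ≠ s ∧ w ≠ d ∧ N.Hop s w q.1 (q.2 0) ∧ ∀ t ≤ T, ¬ N.Meets w d (orbit move t q.1 q.2)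

lemma measurableSet_hop_meets (s w d : Fin n) (T : ℕ) :
    MeasurableSet {q : (Fin n → ZMod m) × (ℕ → Fin n → NodeCoins n) |
      N.Hop s w q.1 (q.2 0) ∧ ∀ t ≤ T, ¬ N.Meets w d (orbit move t q.1 q.2)} := by
  have h1 : ∀ x, Measurable fun ω : ℕ → Fin n → NodeCoins n => N.Hop s w x (ω 0) := fun x =>
    (measurable_of_countable (N.Hop s w x)).comp (measurable_pi_apply 0)
  have h2 : ∀ t x, Measurable fun ω : ℕ → Fin n → NodeCoins n =>
      ¬ N.Meets w d (orbit move t x ω) := fun t x =>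
    measurable_orbit_comp move t x fun y => ¬ N.Meets w d y
  refine measurableSet_setOfPred.2 (measurable_from_prod_countable_right fun x => ?_)
  refine (h1 x).and (Measurable.forall fun t => Measurable.forall fun _ => h2 t x)

lemma measurableSet_late (s d : Fin n) (T : ℕ) :
    MeasurableSet {q : (Fin n → ZMod m) × (ℕ → Fin n → NodeCoins n) | N.Late s d T q} := by
  have : {q : (Fin n → ZMod m) × (ℕ → Fin n → NodeCoins n) | N.Late s d T q}
      = ⋃ w ∈ (Finset.univ.erase s).erase d, {q | N.Hop s w q.1 (q.2 0) ∧
          ∀ t ≤ T, ¬ N.Meets w d (orbit move t q.1 q.2)} := by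
    ext q; simp [Late, and_assoc, and_left_comm]
  rw [this]
  exact Finset.measurableSet_biUnion _ fun w _ => N.measurableSet_hop_meets s w d T

/-- For a fixed relay the hop has probability at least `Q E / (4 n)`, and by the assumption on the
scales an early meeting with `d` removes at most half of it. The events of different relays are
disjoint, since a source meets at most one node alone, and there are at least `n / 2` relays other
than `s` and `d`. -/
lemma pathLaw_late_ge {B κ : ℝ} (hN : N.Good B κ) (hm : 4 * B ≤ m) (hnm : n = m ^ 2) (hn4 : 4 ≤ n)
    (p α : I) (s d : Fin n) (hsd : s ≠ d) (L T : ℕ) (hL : 0 < L) (hlog : 0 < Real.log (L / 4))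
    (hbound : (1 + L / m + 6 * √L) / m + T * ((2 * L / m ^ 2 + 18 * (1 + Real.log L)) / L)
      ≤ p * α * (1 - p) * Real.exp (-(4 * B * κ)) / 8 * (Real.log (L / 4) / 360)) :
    ENNReal.ofReal (p * α * (1 - p) * Real.exp (-(4 * B * κ)) / 16)
      ≤ pathLaw n m p α {q | N.Late s d T q} := by
  classical
  have hm0 : (0 : ℝ) < m := by exact_mod_cast NeZero.pos m
  have em : (m : ℝ) ^ 2 = n := by rw [hnm]; push_cast; rfl
  have hn0 : (0 : ℝ) < n := by rw [← em]; positivity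
  set E := Real.exp (-(4 * B * κ)) with hE
  set Q : ℝ := p * α * (1 - p) with hQd
  have hQ : 0 ≤ Q := mul_nonneg (mul_nonneg p.2.1 α.2.1) (by have := p.2.2; linarith)
  have hE0 : 0 < E := Real.exp_pos _
  set D := fun w => {q : (Fin n → ZMod m) × (ℕ → Fin n → NodeCoins n) | N.Hop s w q.1 (q.2 0) ∧
          ∀ t ≤ T, ¬ N.Meets w d (orbit move t q.1 q.2)} with hD
  have hD1 : ∀ w ∈ (Finset.univ.erase s).erase d,
      ENNReal.ofReal (Q * E / (8 * n)) ≤ pathLaw n m p α (D w) := by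
    intro w hw
    simp only [Finset.mem_erase, Finset.mem_univ, and_true] at hw
    have h1 := N.pathLaw_hop_ge hN hm p α s w hw.2.symm
    have h2 := N.lintegral_meets_hit_le p α s w d hw.2.symm hsd hw.1 L T hL
    set γ := Real.log (L / 4) / 360 with hγ
    have hγ0 : 0 < γ := by positivity
    set hitSet := {q : (Fin n → ZMod m) × (ℕ → Fin n → NodeCoins n) |
      N.Meets s w q.1 ∧ ∃ t ≤ T, N.Meets w d (orbit move t q.1 q.2)} with hhit
    have h3 : pathLaw n m p α hitSet ≤ ENNReal.ofReal (Q * E / (8 * n)) := by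
      have e : (m : ℝ≥0∞)⁻¹ = ENNReal.ofReal ((m : ℝ)⁻¹) := by
        rw [ENNReal.ofReal_inv_of_pos hm0, ENNReal.ofReal_natCast]
      have h4 : ENNReal.ofReal γ * pathLaw n m p α hitSet
          ≤ ENNReal.ofReal γ * ENNReal.ofReal (Q * E / (8 * n)) := by
        refine h2.trans ?_
        rw [e, ← ENNReal.ofReal_mul (by positivity), ← ENNReal.ofReal_mul' (by positivity),
          ← ENNReal.ofReal_mul hγ0.le]
        apply ENNReal.ofReal_le_ofReal
        calc _ ≤ (Q * E / 8 * γ) * ((m : ℝ)⁻¹ * (m : ℝ)⁻¹) := by gcongr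
          _ = γ * (Q * E / (8 * n)) := by rw [← em]; field_simp
      exact (ENNReal.mul_le_mul_iff_right (by simpa using hγ0) ENNReal.ofReal_ne_top).1 h4
    have h5 : pathLaw n m p α {q | N.Hop s w q.1 (q.2 0)}
        ≤ pathLaw n m p α (D w) + pathLaw n m p α hitSet := by
      refine le_trans (measure_mono ?_) (measure_union_le _ _)
      intro q hq
      have hq' : N.Hop s w q.1 (q.2 0) := hq
      by_cases h6 : ∃ t ≤ T, N.Meets w d (orbit move t q.1 q.2)
      · exact Or.inr ⟨hq'.1.meets, h6⟩
      · exact Or.inl ⟨hq', fun t ht h7 => h6 ⟨t, ht, h7⟩⟩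
    have h6 : ENNReal.ofReal (Q * E / (8 * n)) + ENNReal.ofReal (Q * E / (8 * n))
        ≤ pathLaw n m p α (D w) + ENNReal.ofReal (Q * E / (8 * n)) := by
      rw [← ENNReal.ofReal_add (by positivity) (by positivity)]
      have e : Q * E / (8 * n) + Q * E / (8 * n) = Q * (E / (4 * m ^ 2)) := by
        rw [em]; field_simp; ring
      rw [e]
      exact h1.trans (h5.trans (by gcongr))
    exact (ENNReal.add_le_add_iff_right ENNReal.ofReal_ne_top).1 h6
  have hset : {q : (Fin n → ZMod m) × (ℕ → Fin n → NodeCoins n) | N.Late s d T q}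
      = ⋃ w ∈ (Finset.univ.erase s).erase d, D w := by
    ext q; simp [Late, hD, and_assoc, and_left_comm]
  have hdisj : Set.PairwiseDisjoint (((Finset.univ.erase s).erase d : Finset (Fin n)) : Set (Fin n))
      D := by
    intro w hw w' hw' hne
    simp only [Finset.coe_erase, Set.mem_sdiff, Set.mem_singleton_iff, Finset.coe_univ,
      Set.mem_univ, true_and] at hw hw'
    rw [Function.onFun, Set.disjoint_left]
    intro q hq hq'
    have h1 : N.Hop s w q.1 (q.2 0) := hq.1
    have h2 : N.Hop s w' q.1 (q.2 0) := hq'.1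
    exact hne (h2.1.unique hN (Ne.symm hw'.1) (Ne.symm hw.1) h1.1.meets)
  rw [hset, measure_biUnion_finset hdisj fun w _ => N.measurableSet_hop_meets s w d T]
  refine le_trans ?_ (Finset.sum_le_sum hD1)
  rw [Finset.sum_const, Finset.card_erase_of_mem (Finset.mem_erase.2 ⟨hsd.symm, Finset.mem_univ d⟩),
    Finset.card_erase_of_mem (Finset.mem_univ s), Finset.card_univ, Fintype.card_fin,
    nsmul_eq_mul, ← ENNReal.ofReal_natCast, ← ENNReal.ofReal_mul (by positivity)]
  apply ENNReal.ofReal_le_ofReal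
  have h2 : (n : ℝ) / 2 ≤ ((n - 1 - 1 : ℕ) : ℝ) := by
    have : n ≤ 2 * (n - 1 - 1) := by omega
    have : (n : ℝ) ≤ 2 * ((n - 1 - 1 : ℕ) : ℝ) := by exact_mod_cast this
    linarith
  calc Q * E / 16 = (n : ℝ) / 2 * (Q * E / (8 * n)) := by field_simp; ring
    _ ≤ _ := by gcongr

end Sites

/-- The scales on which meetings are late. -/
lemma exists_late_scale (δ : ℝ) (hδ : 0 < δ) : ∃ c : ℝ, 0 < c ∧ ∃ l₀ : ℝ, ∀ n m : ℕ, n = m ^ 2 →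
    l₀ ≤ Real.log n → ∃ L : ℕ, 0 < L ∧ 0 < Real.log (L / 4) ∧
      (1 + L / m + 6 * √L) / m + c * (n * Real.log n) *
        ((2 * L / m ^ 2 + 18 * (1 + Real.log L)) / L) ≤ δ * (Real.log (L / 4) / 360) := by
  -- With `L` about `ε n log n`, the starting value is about `2 ε log n` up to lower order, and `c n
  -- log n` slots add at most `c (2 + 72 / ε) log n`. So `ε` is taken small against `δ`, and then
  -- `c` small against `ε`.
  set ε : ℝ := min 1 (δ / 2880) with hε
  have hε0 : 0 < ε := lt_min one_pos (by positivity)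
  have hε1 : ε ≤ 1 := min_le_left _ _
  have hε2 : ε ≤ δ / 2880 := min_le_right _ _
  set c : ℝ := δ / 1440 / (2 + 54 / ε) with hc
  have hc0 : 0 < c := by positivity
  refine ⟨c, hc0, max (max 2 (4 / ε)) (max (1440 / δ) (2 * (8640 / δ) ^ 2)), fun n m hnm hl => ?_⟩
  set l := Real.log n with hld
  have hl2 : 2 ≤ l := (le_max_left _ _).trans ((le_max_left _ _).trans hl)
  have hl4 : 4 / ε ≤ l := (le_max_right _ _).trans ((le_max_left _ _).trans hl)
  have hl5 : 1440 / δ ≤ l := (le_max_left _ _).trans ((le_max_right _ _).trans hl)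
  have hl6 : 2 * (8640 / δ) ^ 2 ≤ l := (le_max_right _ _).trans ((le_max_right _ _).trans hl)
  have hl0 : 0 < l := by linarith
  have hn0 : (0 : ℝ) < n := by
    rcases Nat.eq_zero_or_pos n with h | h
    · subst h; norm_num [hld] at hl2
    · exact_mod_cast h
  have hlogle := Real.log_le_sub_one_of_pos hn0
  have hn1 : (1 : ℝ) ≤ n := by linarith
  have em : (m : ℝ) ^ 2 = n := by rw [hnm]; push_cast; rfl
  have hm0 : (0 : ℝ) < m := by
    rcases Nat.eq_zero_or_pos m with h | h
    · subst h; simp at em; linarith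
    · exact_mod_cast h
  have hm1 : (1 : ℝ) ≤ m := by nlinarith
  -- This gives `L ≥ 4 n`, so the threshold `log (L / 4)` is at least `log n`.
  have hεl : 4 ≤ ε * l := by rwa [div_le_iff₀ hε0, mul_comm] at hl4
  set L := ⌈ε * (n * l)⌉₊ with hL
  have hL1 : ε * (n * l) ≤ L := Nat.le_ceil _
  have hL2 : (L : ℝ) < ε * (n * l) + 1 := Nat.ceil_lt_add_one (by positivity)
  have hL4 : 4 * (n : ℝ) ≤ L := by nlinarith
  have hL3 : (L : ℝ) ≤ 2 * (ε * (n * l)) := by nlinarith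
  have hL0 : (0 : ℝ) < L := by linarith
  have hlogL4 : l ≤ Real.log (L / 4) := Real.log_le_log hn0 (by linarith)
  have hlogL : Real.log L ≤ 3 * l := by
    have : (L : ℝ) ≤ n ^ 3 := by
      have h1 : ε * (n * l) ≤ n * n := by
        have : ε * (n * l) ≤ 1 * (n * l) := by gcongr
        nlinarith
      have h2 : (n : ℝ) ≥ 3 := by linarith
      nlinarith [mul_pos hn0 hn0]
    calc Real.log L ≤ Real.log (n ^ 3) := Real.log_le_log hL0 this
      _ = 3 * l := by rw [Real.log_pow, ← hld]; norm_num
  refine ⟨L, by exact_mod_cast hL0, by linarith, ?_⟩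
  have hsqrt : √(L : ℝ) ≤ m * √(2 * l) := by
    have : (L : ℝ) ≤ m ^ 2 * (2 * l) := by
      rw [em]
      have : ε * (n * l) ≤ 1 * (n * l) := by gcongr
      linarith
    calc √(L : ℝ) ≤ √((m : ℝ) ^ 2 * (2 * l)) := Real.sqrt_le_sqrt this
      _ = _ := by rw [Real.sqrt_mul (by positivity), Real.sqrt_sq hm0.le]
  have hA : (1 + L / m + 6 * √L) / m ≤ 1 + 2 * ε * l + 6 * √(2 * l) := by
    rw [div_le_iff₀ hm0]
    have h1 : (L : ℝ) / m ≤ 2 * ε * l * m := by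
      rw [div_le_iff₀ hm0]
      calc (L : ℝ) ≤ 2 * (ε * (n * l)) := hL3
        _ = _ := by rw [← em]; ring
    nlinarith
  have hB : c * (n * l) * ((2 * L / m ^ 2 + 18 * (1 + Real.log L)) / L)
      ≤ c * (2 + 54 / ε * (4 / 3)) * l := by
    have h1 : (2 * L / m ^ 2 + 18 * (1 + Real.log L)) / L
        ≤ 2 / n + 72 * l / (ε * (n * l)) := by
      rw [add_div, em]
      refine add_le_add (le_of_eq (by field_simp)) ?_
      apply div_le_div₀ (by positivity) _ (by positivity) hL1
      linarith
    calc _ ≤ c * (n * l) * (2 / n + 72 * l / (ε * (n * l))) := by gcongr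
      _ = _ := by field_simp; ring
  have hcc : c * (2 + 54 / ε * (4 / 3)) ≤ δ / 1080 := by
    have h1 : c * (2 + 54 / ε) = δ / 1440 := by
      rw [hc, div_mul_cancel₀]; positivity
    have h2 : 0 ≤ c * 2 := by positivity
    have h3 : c * (2 + 54 / ε * (4 / 3)) = 4 / 3 * (c * (2 + 54 / ε)) - c * 2 / 3 := by ring
    rw [h3, h1]; linarith
  have hC : 1 ≤ δ * l / 1440 := by
    rw [div_le_iff₀ hδ] at hl5; linarith
  have hD : √(2 * l) ≤ δ / 8640 * l := by
    apply Real.sqrt_le_iff.2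
    refine ⟨by positivity, ?_⟩
    have h1 : 2 * (8640 / δ) ^ 2 * (δ / 8640) ^ 2 = 2 := by field_simp
    have h2 : 2 * (8640 / δ) ^ 2 * (δ / 8640) ^ 2 ≤ l * (δ / 8640) ^ 2 := by gcongr
    rw [h1] at h2
    calc 2 * l ≤ (l * (δ / 8640) ^ 2) * l := by gcongr
      _ = _ := by ring
  have hF : 2 * ε * l ≤ δ / 1440 * l := by
    have : 2 * ε ≤ δ / 1440 := by linarith
    gcongr
  have hG : c * (2 + 54 / ε * (4 / 3)) * l ≤ δ / 1080 * l := by gcongr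
  have hH : δ * (l / 360) ≤ δ * (Real.log (L / 4) / 360) := by gcongr
  have hδl : 0 < δ * l := by positivity
  refine le_trans ?_ hH
  calc _ ≤ (1 + 2 * ε * l + 6 * √(2 * l)) + c * (2 + 54 / ε * (4 / 3)) * l := add_le_add hA hB
    _ ≤ δ * (l / 360) := by linarith

/-! ### Counting in queues -/

section Counting

open Classical in
/-- The number of the first `t` slots from slot `u` on in which `a` holds. -/
def countFrom (a : ℕ → Prop) (u t : ℕ) : ℕ := ((Finset.range t).filter fun j => a (u + j)).card

open Classical in
/-- The number of slots in `[u, t)` in which `a` holds. -/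
def countIco (a : ℕ → Prop) (u t : ℕ) : ℕ := ((Finset.Ico u t).filter a).card

lemma countFrom_eq_countIco (a : ℕ → Prop) (u t : ℕ) : countFrom a u t = countIco a u (u + t) := by
  classical
  unfold countFrom countIco
  refine Finset.card_bij (fun j _ => u + j) ?_ ?_ ?_
  · intro j hj
    simp only [Finset.mem_filter, Finset.mem_range, Finset.mem_Ico] at hj ⊢
    exact ⟨⟨by omega, by omega⟩, hj.2⟩
  · intro j _ k _ h; simpa using h
  · intro k hk
    simp only [Finset.mem_filter, Finset.mem_Ico] at hk
    refine ⟨k - u, ?_, by omega⟩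
    simp only [Finset.mem_filter, Finset.mem_range]
    refine ⟨by omega, ?_⟩
    rw [show u + (k - u) = k by omega]; exact hk.2

open Classical in
lemma countIco_succ_right (a : ℕ → Prop) {u t : ℕ} (h : u ≤ t) :
    countIco a u (t + 1) = countIco a u t + if a t then 1 else 0 := by
  unfold countIco
  rw [← Finset.insert_Ico_right_eq_Ico_add_one h, Finset.filter_insert]
  split_ifs
  · rw [Finset.card_insert_of_notMem (by simp)]
  · rfl

open Classical in
lemma countIco_eq_succ_left (a : ℕ → Prop) {u t : ℕ} (h : u < t) :
    countIco a u t = countIco a (u + 1) t + if a u then 1 else 0 := by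
  unfold countIco
  rw [← Finset.insert_Ico_add_one_left_eq_Ico h, Finset.filter_insert]
  split_ifs
  · rw [Finset.card_insert_of_notMem (by simp)]
  · rfl

lemma countIco_mono (a : ℕ → Prop) {u t t' : ℕ} (h : t ≤ t') : countIco a u t ≤ countIco a u t' := by
  classical
  exact Finset.card_le_card (Finset.filter_subset_filter _ (Finset.Ico_subset_Ico_right h))

lemma countIco_self (a : ℕ → Prop) (u : ℕ) : countIco a u u = 0 := by
  classical
  simp [countIco]

open Classical in
/-- The excess of `a` over `b` from slot `u` on is at most the number of `a`-slots from which on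
there is such an excess. -/
lemma countIco_le_add_card (a b : ℕ → Prop) (T t u : ℕ)
    (hu : u ≤ T) :
    countIco a u T ≤ countIco b u t + ((Finset.Ico u T).filter fun w => a w ∧
      countIco b w t < countIco a w T).card := by
  classical
  induction hu using Nat.decreasingInduction with
  | self => simp [countIco_self]
  | of_succ u hu ih =>
    -- Without an excess from `u` on nothing has to be counted. With an excess, `u` itself is
    -- counted if it is an `a`-slot, and this pays for the arrival in it.
    by_cases hg : countIco b u t < countIco a u T
    · have h1 := countIco_eq_succ_left a hu
      have h3 : countIco b (u + 1) t ≤ countIco b u t := by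
        unfold countIco
        exact Finset.card_le_card (Finset.filter_subset_filter _
          (Finset.Ico_subset_Ico_left (Nat.le_succ u)))
      rw [← Finset.insert_Ico_add_one_left_eq_Ico hu, Finset.filter_insert]
      by_cases ha : a u
      · rw [if_pos ⟨ha, hg⟩, Finset.card_insert_of_notMem (by simp)]
        rw [if_pos ha] at h1
        omega
      · rw [if_neg (fun h => ha h.1)]
        rw [if_neg ha] at h1
        omega
    · omega

end Counting

/-! ### Queues as ordered lists of departure slots -/

namespace Realization

variable {n : ℕ} (r : Realization n) (Δ : ℝ) (i : Fin (n / 2))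

/-- The queue of `v` for pair `i` after sub-slot A. -/
def line (t : ℕ) (v : Fin n) : List ℕ := r.afterA Δ t (r.queues Δ t) v i

variable {r Δ i}

lemma SendsA.unique {t : ℕ} {v w w' : Fin n} (h : r.SendsA t v w) (h' : r.SendsA t v w') :
    w = w' := by
  obtain ⟨_, _, _, h1, h2⟩ := h
  obtain ⟨_, _, _, h1', h2'⟩ := h'
  exact h2.symm.trans h2'

lemma HopA.unique {t : ℕ} {w w' : Fin n} (h : r.HopA Δ t i w) (h' : r.HopA Δ t i w') : w = w' :=
  h.1.unique h'.1

open Classical in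
lemma line_zero (v : Fin n) :
    r.line Δ i 0 v = if r.HopA Δ 0 i v ∧ v ≠ r.dst i then [0] else [] := by
  simp [line, afterA, queues]

open Classical in
lemma line_succ (t : ℕ) (v : Fin n) :
    r.line Δ i (t + 1) v =
      (if r.HopB Δ t (r.afterA Δ t (r.queues Δ t)) v i then (r.line Δ i t v).tail
        else r.line Δ i t v) ++ (if r.HopA Δ (t + 1) i v ∧ v ≠ r.dst i then [t + 1] else []) := by
  conv_lhs => rw [line, afterA, queues, afterB]
  split_ifs <;> simp [line]

lemma line_spec (t : ℕ) (v : Fin n) : (r.line Δ i t v).Pairwise (· < ·) ∧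
    ∀ s ∈ r.line Δ i t v, s ≤ t ∧ r.HopA Δ s i v ∧ v ≠ r.dst i := by
  classical
  induction t with
  | zero =>
    rw [line_zero]
    split_ifs with h
    · simp [h]
    · simp
  | succ t ih =>
    rw [line_succ]
    have hsub : ∀ l : List ℕ, l.Sublist (r.line Δ i t v) →
        (l ++ (if r.HopA Δ (t + 1) i v ∧ v ≠ r.dst i then [t + 1] else [])).Pairwise (· < ·) ∧
        ∀ s ∈ l ++ (if r.HopA Δ (t + 1) i v ∧ v ≠ r.dst i then [t + 1] else []),
          s ≤ t + 1 ∧ r.HopA Δ s i v ∧ v ≠ r.dst i := by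
      intro l hl
      have h1 : ∀ s ∈ l, s ≤ t ∧ r.HopA Δ s i v ∧ v ≠ r.dst i := fun s hs => ih.2 s (hl.subset hs)
      have h2 : l.Pairwise (· < ·) := ih.1.sublist hl
      split_ifs with h
      · constructor
        · rw [List.pairwise_append]
          refine ⟨h2, by simp, ?_⟩
          intro s hs b hb
          rw [List.mem_singleton] at hb
          have := (h1 s hs).1
          omega
        · intro s hs
          rw [List.mem_append, List.mem_singleton] at hs
          rcases hs with hs | rfl
          · exact ⟨by have := (h1 s hs).1; omega, (h1 s hs).2⟩
          · exact ⟨le_rfl, h⟩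
      · rw [List.append_nil]
        exact ⟨h2, fun s hs => ⟨by have := (h1 s hs).1; omega, (h1 s hs).2⟩⟩
    by_cases hB : r.HopB Δ t (r.afterA Δ t (r.queues Δ t)) v i
    · rw [if_pos hB]; exact hsub _ (List.tail_sublist _)
    · rw [if_neg hB]; exact hsub _ (List.Sublist.refl _)

lemma mem_line_self {s : ℕ} {v : Fin n} (h : r.HopA Δ s i v) (hv : v ≠ r.dst i) :
    s ∈ r.line Δ i s v := by
  classical
  cases s with
  | zero => rw [line_zero, if_pos ⟨h, hv⟩]; simp
  | succ s =>
    rw [line_succ, List.mem_append]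
    right
    rw [if_pos ⟨h, hv⟩]; simp

lemma mem_line_succ {s t : ℕ} {v : Fin n} (h : s ∈ r.line Δ i t v)
    (ha : ¬ r.RelayArrives Δ i s t) : s ∈ r.line Δ i (t + 1) v := by
  classical
  rw [line_succ, List.mem_append]
  left
  split_ifs with hB
  · rcases hl : r.line Δ i t v with _ | ⟨b, l⟩
    · rw [hl] at h; simp at h
    · rw [hl, List.mem_cons] at h
      rcases h with rfl | h
      · refine (ha (Or.inr ⟨v, hB, ?_⟩)).elim
        show (r.line Δ i t v).head? = some s
        rw [hl]; rfl
      · simpa using h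
  · exact h

variable (r Δ i)

/-- The delay of the packet of pair `i` that left in slot `s`. -/
def delay (s : ℕ) : ℝ≥0∞ := ⨅ (t : ℕ) (_ : r.RelayArrives Δ i s t), ((t - s + 1 : ℕ) : ℝ≥0∞)

variable {r Δ i}

-- The packet is in the queue of its relay after sub-slot A in every slot from its departure to its
-- arrival, both included, so counting these slots gives the delay. If it never arrives, it stays
-- forever and the sum is infinite.
open Classical in
lemma delay_le_tsum {s : ℕ} {v : Fin n} (h : r.HopA Δ s i v) (hv : v ≠ r.dst i) :
    r.delay Δ i s ≤ ∑' t, if s ∈ r.line Δ i t v then (1 : ℝ≥0∞) else 0 := by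
  by_cases hex : ∃ k, r.RelayArrives Δ i s (s + k)
  · have hk := Nat.find_spec hex
    have hmin : ∀ j < Nat.find hex, ¬ r.RelayArrives Δ i s (s + j) := fun j hj => Nat.find_min hex hj
    set k := Nat.find hex with hkd
    have hmem : ∀ j ≤ k, s ∈ r.line Δ i (s + j) v := by
      intro j
      induction j with
      | zero => exact fun _ => mem_line_self h hv
      | succ j ih => exact fun hj => mem_line_succ (ih (by omega)) (hmin j (by omega))
    calc r.delay Δ i s ≤ ((s + k - s + 1 : ℕ) : ℝ≥0∞) := iInf₂_le (s + k) hk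
      _ = ∑ t ∈ (Finset.range (k + 1)).map (addLeftEmbedding s),
            if s ∈ r.line Δ i t v then (1 : ℝ≥0∞) else 0 := by
          rw [Finset.sum_map, Finset.sum_congr rfl (g := fun _ => 1)]
          · simp
          · intro j hj
            exact if_pos (hmem j (by simpa [Nat.lt_succ_iff] using hj))
      _ ≤ _ := ENNReal.sum_le_tsum _
  · have hmem : ∀ j, s ∈ r.line Δ i (s + j) v := by
      intro j
      induction j with
      | zero => exact mem_line_self h hv
      | succ j ih => exact mem_line_succ ih (fun h => hex ⟨j, h⟩)
    refine le_trans le_top (ge_of_eq ?_)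
    rw [eq_top_iff]
    calc (⊤ : ℝ≥0∞) = ∑' j : ℕ, (1 : ℝ≥0∞) := by simp
      _ = ∑' j : ℕ, (fun t => if s ∈ r.line Δ i t v then (1 : ℝ≥0∞) else 0) (s + j) := by
          refine tsum_congr fun j => ?_
          simp [hmem j]
      _ ≤ _ := ENNReal.tsum_comp_le_tsum_of_injective (add_right_injective s) _

/-- The oldest packet is served first: if the head of an increasing list did not leave before `T`,
then no other packet did. -/
lemma countP_tail_lt {l : List ℕ} (hl : l.Pairwise (· < ·)) (T : ℕ) :
    l.tail.countP (· < T) = l.countP (· < T) - 1 := by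
  cases l with
  | nil => rfl
  | cons b l =>
    rw [List.tail_cons, List.countP_cons]
    by_cases hb : b < T
    · simp [hb]
    · have : l.countP (· < T) = 0 := by
        rw [List.countP_eq_zero]
        intro c hc
        have := List.rel_of_pairwise_cons hl hc
        simp; omega
      simp [hb, this]

/-- Number of packets in a queue that left before slot `T`, in terms of the slots `a` in which
packets may arrive and the slots `b` in which the queue is served. -/
lemma exists_countP_line_le (a b : ℕ → Prop) (v : Fin n) (ha : ∀ t, r.HopA Δ t i v → a t)
    (hb : ∀ t, b t → r.line Δ i t v ≠ [] → r.HopB Δ t (r.afterA Δ t (r.queues Δ t)) v i)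
    (T t : ℕ) : ∃ u ≤ t, (r.line Δ i t v).countP (· < T) + countIco b u t
      ≤ countIco a u (min T (t + 1)) ∨ (r.line Δ i t v).countP (· < T) = 0 := by
  classical
  induction t with
  | zero =>
    refine ⟨0, le_rfl, ?_⟩
    rw [line_zero, countIco_self]
    split_ifs with h
    · by_cases hT : 0 < T
      · left
        rw [show min T (0 + 1) = 0 + 1 by omega, countIco_succ_right a le_rfl,
          if_pos (ha 0 h.1)]
        simp [hT, countIco_self]
      · right; simp [hT]
    · right; simp
  | succ t ih =>
    have hsort := (line_spec (r := r) (Δ := Δ) (i := i) t v).1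
    obtain ⟨u, hu, ih⟩ := ih
    set q := (r.line Δ i t v).countP (· < T) with hq
    set nw : ℕ := if a (t + 1) ∧ t + 1 < T then 1 else 0 with hnw
    have hstep : (r.line Δ i (t + 1) v).countP (· < T) ≤ (q - if b t then 1 else 0) + nw := by
      rw [line_succ, List.countP_append]
      refine add_le_add ?_ ?_
      · by_cases hbt : b t
        · rw [if_pos hbt]
          by_cases hne : r.line Δ i t v = []
          · simp [hne]
          · rw [if_pos (hb t hbt hne), countP_tail_lt hsort]
        · rw [if_neg hbt]
          split_ifs
          · rw [countP_tail_lt hsort]; omega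
          · omega
      · split_ifs with h
        · by_cases hT : t + 1 < T
          · simp [hnw, ha _ h.1, hT]
          · simp [hT]
        · simp
    have hA : ∀ w ≤ t + 1, countIco a w (min T (t + 1 + 1)) = countIco a w (min T (t + 1)) + nw := by
      intro w hw
      by_cases hT : t + 1 < T
      · rw [show min T (t + 1 + 1) = t + 1 + 1 by omega, show min T (t + 1) = t + 1 by omega,
          countIco_succ_right a hw, hnw]
        simp [hT]
      · rw [show min T (t + 1 + 1) = min T (t + 1) by omega, hnw]
        simp [hT]
    -- This is Lindley's formula for a queue. When no old packet from before `T` is left, the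
    -- comparison starts afresh at the current slot; otherwise the previous starting slot is kept.
    have hz : (r.line Δ i (t + 1) v).countP (· < T) ≤ nw →
        ∃ u ≤ t + 1, (r.line Δ i (t + 1) v).countP (· < T) + countIco b u (t + 1)
          ≤ countIco a u (min T (t + 1 + 1)) ∨ (r.line Δ i (t + 1) v).countP (· < T) = 0 := by
      intro h
      refine ⟨t + 1, le_rfl, Or.inl ?_⟩
      rw [hA _ le_rfl, countIco_self]
      omega
    by_cases hq0 : q = 0
    · apply hz; omega
    · rcases ih with ih | ih
      · refine ⟨u, by omega, Or.inl ?_⟩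
        rw [hA u (by omega), countIco_succ_right b hu]
        split_ifs at hstep ⊢ <;> omega
      · exact (hq0 ih).elim

-- Lindley's formula bounds the queue by the largest excess of arrivals over services, and
-- `countIco_le_add_card` bounds this excess by the number of arrival slots whose excess still
-- persists. The restriction to packets from before `T` allows `t` to run on beyond `T`.
open Classical in
lemma countP_line_le_card (a b : ℕ → Prop) (v : Fin n) (ha : ∀ t, r.HopA Δ t i v → a t)
    (hb : ∀ t, b t → r.line Δ i t v ≠ [] → r.HopB Δ t (r.afterA Δ t (r.queues Δ t)) v i)
    (T t : ℕ) : (r.line Δ i t v).countP (· < T) ≤ ((Finset.range T).filter fun u =>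
      a u ∧ u ≤ t ∧ countIco b u t < countIco a u (t + 1)).card := by
  obtain ⟨u, hu, h | h⟩ := exists_countP_line_le a b v ha hb T t
  · by_cases huT : u ≤ min T (t + 1)
    · have h1 := countIco_le_add_card a b (min T (t + 1)) t u huT
      refine le_trans (Nat.le_of_add_le_add_right (h.trans (h1.trans (add_comm _ _).le))) ?_
      apply Finset.card_le_card
      intro w hw
      simp only [Finset.mem_filter, Finset.mem_Ico, Finset.mem_range] at hw ⊢
      exact ⟨by omega, hw.2.1, by omega, hw.2.2.trans_le (countIco_mono a (min_le_right _ _))⟩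
    · have : countIco a u (min T (t + 1)) = 0 := by
        unfold countIco
        rw [Finset.Ico_eq_empty (by omega)]; simp
      omega
  · omega

lemma tsum_eq_tsum_add (u : ℕ) (f : ℕ → ℝ≥0∞) (hf : ∀ t < u, f t = 0) :
    ∑' t, f t = ∑' t, f (t + u) := by
  rw [← Summable.sum_add_tsum_nat_add' (f := f) (k := u) ENNReal.summable,
    Finset.sum_eq_zero fun t ht => hf t (Finset.mem_range.1 ht), zero_add]

-- Summing the queue length over all times in two ways. The delay of a packet need not be bounded by
-- the busy time that starts with it, since older packets may be ahead of it; the comparison holds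
-- only for the totals.
open Classical in
lemma sum_tsum_mem_line_le (a b : ℕ → Prop) (v : Fin n) (ha : ∀ t, r.HopA Δ t i v → a t)
    (hb : ∀ t, b t → r.line Δ i t v ≠ [] → r.HopB Δ t (r.afterA Δ t (r.queues Δ t)) v i)
    (T : ℕ) : ∑ s ∈ Finset.range T, ∑' t, (if s ∈ r.line Δ i t v then (1 : ℝ≥0∞) else 0)
      ≤ ∑ u ∈ Finset.range T, if a u then
          ∑' t, (if countFrom b u t < countFrom a u (t + 1) then (1 : ℝ≥0∞) else 0) else 0 := by
  have h1 : ∀ t, ∑ s ∈ Finset.range T, (if s ∈ r.line Δ i t v then (1 : ℝ≥0∞) else 0)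
      ≤ ∑ u ∈ Finset.range T,
        if a u ∧ u ≤ t ∧ countIco b u t < countIco a u (t + 1) then (1 : ℝ≥0∞) else 0 := by
    intro t
    rw [Finset.sum_boole, Finset.sum_boole]
    have h2 : ((Finset.range T).filter fun s => s ∈ r.line Δ i t v).card
        ≤ (r.line Δ i t v).countP (· < T) := by
      rw [List.countP_eq_length_filter]
      refine le_trans (Finset.card_le_card ?_) (List.toFinset_card_le _)
      intro s hs
      simp only [Finset.mem_filter, Finset.mem_range] at hs
      simp [hs]
    exact_mod_cast h2.trans (countP_line_le_card a b v ha hb T t)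
  have hsum : ∀ f : ℕ → ℕ → ℝ≥0∞, ∑' t, ∑ s ∈ Finset.range T, f s t
      = ∑ s ∈ Finset.range T, ∑' t, f s t := fun f =>
    Summable.tsum_finsetSum fun _ _ => ENNReal.summable
  rw [← hsum]
  refine (ENNReal.tsum_le_tsum h1).trans ?_
  rw [hsum]
  refine Finset.sum_le_sum fun u _ => ?_
  by_cases hau : a u
  · rw [if_pos hau, tsum_eq_tsum_add u]
    · refine ENNReal.tsum_le_tsum fun t => ?_
      rw [countFrom_eq_countIco, countFrom_eq_countIco, add_comm t u, ← add_assoc]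
      by_cases h3 : countIco b u (u + t) < countIco a u (u + t + 1)
      · rw [if_pos h3]; split_ifs <;> simp
      · rw [if_neg (fun h => h3 h.2.2)]; exact zero_le
    · intro t ht
      exact if_neg fun h => absurd h.2.1 (by omega)
  · rw [if_neg hau]
    simp [hau]

end Realization

/-! ### Sample means over packets and over slots -/

section Means

variable (L : ℕ → Prop) (A : ℕ → ℕ → Prop)

/-- Slots from `s` to the first `t` with `A s t`. -/
def slotDelay (s : ℕ) : ℝ≥0∞ := ⨅ (t : ℕ) (_ : A s t), ((t - s + 1 : ℕ) : ℝ≥0∞)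

open Classical in
/-- The delay that belongs to the slot number `j` of those with `L`. -/
def indexedDelay (j : ℕ) : ℝ≥0∞ :=
  ⨅ (s : ℕ) (t : ℕ) (_ : L s ∧ Nat.count L s = j ∧ A s t), ((t - s + 1 : ℕ) : ℝ≥0∞)

variable {L A}

open Classical in
lemma indexedDelay_count {s : ℕ} (hs : L s) : indexedDelay L A (Nat.count L s) = slotDelay A s := by
  unfold indexedDelay slotDelay
  apply le_antisymm
  · refine le_iInf₂ fun t ht => ?_
    exact iInf_le_of_le s (iInf_le_of_le t (iInf_le _ ⟨hs, rfl, ht⟩))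
  · refine le_iInf fun s' => le_iInf fun t => le_iInf fun h => ?_
    obtain rfl : s' = s := Nat.count_injective h.1 hs h.2.1
    exact iInf₂_le t h.2.2

open Classical in
lemma sum_indexedDelay_count (S : ℕ) :
    ∑ j ∈ Finset.range (Nat.count L S), indexedDelay L A j
      = ∑ s ∈ Finset.range S, if L s then slotDelay A s else 0 := by
  induction S with
  | zero => simp
  | succ S ih =>
    rw [Finset.sum_range_succ, ← ih, Nat.count_succ]
    split_ifs with h
    · rw [Finset.sum_range_succ, indexedDelay_count h]
    · simp

open Classical in
lemma tendsto_count_atTop (hL : {s | L s}.Infinite) :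
    Tendsto (fun S => Nat.count L S) atTop atTop :=
  tendsto_atTop_atTop_of_monotone (Nat.count_monotone L) fun b =>
    ⟨Nat.nth L b, (Nat.count_nth_of_infinite hL b).ge⟩

-- If packets leave at rate at least `c`, the slot in which packet `k` leaves is at most `k / c`, so
-- a mean over packets is at most `1 / c` times the mean over the slots up to that one.
open Classical in
lemma limsup_indexedDelay_le {c : ℝ} (hc : 0 < c)
    (h : ∀ᶠ S : ℕ in atTop, c * S ≤ (Nat.count L S : ℝ)) :
    limsup (fun k : ℕ => (∑ j ∈ Finset.range k, indexedDelay L A j) / k) atTop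
      ≤ ENNReal.ofReal (1 / c) * limsup (fun S : ℕ =>
        (∑ s ∈ Finset.range S, if L s then slotDelay A s else 0) / S) atTop := by
  have hinf : {s | L s}.Infinite := by
    intro hfin
    obtain ⟨M, hM⟩ := hfin.bddAbove
    have h1 : ∀ S, Nat.count L S ≤ M + 1 := by
      intro S
      rw [Nat.count_eq_card_filter_range]
      calc _ ≤ (Finset.range (M + 1)).card := by
            apply Finset.card_le_card
            intro s hs
            rw [Finset.mem_filter] at hs
            exact Finset.mem_range.2 (Nat.lt_succ_of_le (hM hs.2))
        _ = _ := Finset.card_range _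
    have h2 : ∀ᶠ S : ℕ in atTop, ((M : ℝ) + 1) / c < S :=
      tendsto_natCast_atTop_atTop.eventually_gt_atTop _
    obtain ⟨S, hS, hS'⟩ := (h.and h2).exists
    rw [div_lt_iff₀ hc] at hS'
    have : (Nat.count L S : ℝ) ≤ M + 1 := by exact_mod_cast h1 S
    linarith
  set g : ℕ → ℝ≥0∞ := fun S =>
    (∑ s ∈ Finset.range S, if L s then slotDelay A s else 0) / S with hg
  have hnth : Tendsto (Nat.nth L) atTop atTop := (Nat.nth_strictMono hinf).tendsto_atTop
  have h1 : ∀ᶠ k : ℕ in atTop, (∑ j ∈ Finset.range k, indexedDelay L A j) / k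
      ≤ ENNReal.ofReal (1 / c) * g (Nat.nth L k) := by
    filter_upwards [hnth.eventually h, hnth.eventually (eventually_gt_atTop 0)] with k hk hk0
    have h2 := sum_indexedDelay_count (L := L) (A := A) (Nat.nth L k)
    rw [Nat.count_nth_of_infinite hinf] at h2 hk
    rw [h2, hg]
    simp only [div_eq_mul_inv]
    rw [mul_left_comm]
    gcongr
    set S := Nat.nth L k
    have hS0 : (0 : ℝ) < S := by exact_mod_cast hk0
    have hk1 : (0 : ℝ) < k := lt_of_lt_of_le (by positivity) hk
    rw [one_mul, ← ENNReal.ofReal_natCast k, ← ENNReal.ofReal_natCast S,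
      ← ENNReal.ofReal_inv_of_pos hk1, ← ENNReal.ofReal_inv_of_pos hS0,
      ← ENNReal.ofReal_mul (by positivity)]
    apply ENNReal.ofReal_le_ofReal
    rw [← mul_inv]
    exact inv_anti₀ (by positivity) hk
  calc _ ≤ limsup (fun k => ENNReal.ofReal (1 / c) * g (Nat.nth L k)) atTop := limsup_le_limsup h1
    _ = ENNReal.ofReal (1 / c) * limsup (fun k => g (Nat.nth L k)) atTop :=
        ENNReal.limsup_const_mul_of_ne_top ENNReal.ofReal_ne_top
    _ ≤ _ := by
        gcongr
        exact limsup_le_limsup_of_le (f := map (Nat.nth L) atTop) (u := g) hnth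

-- There are at most as many packets as slots, so dividing by the number of slots only lowers the
-- mean. If only finitely many packets leave, the delays of the missing ones are infima over the
-- empty set, hence infinite.
open Classical in
lemma le_limsup_indexedDelay {T : ℝ≥0∞} {b : ℕ → Prop} (hb : ∀ s, b s → L s)
    (hT : ∀ s, b s → T ≤ slotDelay A s) :
    limsup (fun S : ℕ => (∑ s ∈ Finset.range S, if b s then T else 0) / S) atTop
      ≤ limsup (fun k : ℕ => (∑ j ∈ Finset.range k, indexedDelay L A j) / k) atTop := by
  by_cases hinf : {s | L s}.Infinite
  · set g : ℕ → ℝ≥0∞ := fun k => (∑ j ∈ Finset.range k, indexedDelay L A j) / k with hg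
    calc _ ≤ limsup (fun S => g (Nat.count L S)) atTop := by
          refine limsup_le_limsup (Eventually.of_forall fun S => ?_)
          simp only [hg]
          rw [sum_indexedDelay_count]
          have : ((Nat.count L S : ℕ) : ℝ≥0∞) ≤ S := by exact_mod_cast Nat.count_le L
          gcongr with s _
          split_ifs with h1 h2
          · exact hT s h1
          · exact (h2 (hb s h1)).elim
          · exact zero_le
          · exact le_rfl
      _ ≤ _ := limsup_le_limsup_of_le (f := map (fun S => Nat.count L S) atTop) (u := g)
          (tendsto_count_atTop hinf)
  · rw [Set.not_infinite] at hinf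
    obtain ⟨M, hM⟩ := hinf.bddAbove
    have htop : indexedDelay L A (Nat.count L (M + 1)) = ⊤ := by
      unfold indexedDelay
      simp only [iInf_eq_top]
      rintro s t ⟨h1, h2, _⟩
      have h3 : s < M + 1 := Nat.lt_succ_of_le (hM h1)
      exact absurd h2 (Nat.count_strict_mono h1 h3).ne
    refine le_trans le_top (ge_of_eq ?_)
    have h1 : (fun k : ℕ => (∑ j ∈ Finset.range k, indexedDelay L A j) / k)
        =ᶠ[atTop] fun _ => (⊤ : ℝ≥0∞) := by
      filter_upwards [eventually_gt_atTop (Nat.count L (M + 1))] with k hk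
      rw [ENNReal.sum_eq_top.2 ⟨_, Finset.mem_range.2 hk, htop⟩]
      exact ENNReal.top_div_of_ne_top (ENNReal.natCast_ne_top k)
    rw [limsup_congr h1, limsup_const]

end Means

/-! ### From meetings of nodes to delays of packets -/

namespace Sites

variable {n m : ℕ} [NeZero m] (N : Sites n m)

lemma orbit_orbit (x : Fin n → ZMod m) (ω : ℕ → Fin n → NodeCoins n) (u j : ℕ) :
    orbit move j (orbit move u x ω) (fun k => ω (k + u)) = orbit move (u + j) x ω := by
  have h := orbitShift_iterate (move (n := n) (m := m)) j ((orbitShift move)^[u] (x, ω))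
  rw [← Function.iterate_add_apply, orbitShift_iterate, orbitShift_iterate, add_comm j u] at h
  exact (congrArg Prod.fst h).symm

/-- What the delay of the relay policy depends on: along the path `q`, the sites `N` describe the
transmissions of the packets of pair `i`. -/
structure Describes (Δ : ℝ) (r : Realization n) (i : Fin (n / 2))
    (q : (Fin n → ZMod m) × (ℕ → Fin n → NodeCoins n)) : Prop where
  arr : ∀ t v, r.HopA Δ t i v → v ≠ r.src i ∧ N.Arr (r.src i) v (orbit move t q.1 q.2) (q.2 t)
  srv : ∀ t v, v ≠ r.dst i → N.Srv v (r.dst i) (orbit move t q.1 q.2) (q.2 t) →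
    r.line Δ i t v ≠ [] → r.HopB Δ t (r.afterA Δ t (r.queues Δ t)) v i
  hop : ∀ t w, w ≠ r.src i → N.Hop (r.src i) w (orbit move t q.1 q.2) (q.2 t) → r.HopA Δ t i w
  meets : ∀ t Q v, r.HopB Δ t Q v i → N.Meets v (r.dst i) (orbit move t q.1 q.2)

open Classical in
/-- An upper bound for the delays of the packets that leave `s` for `d` in slot zero. -/
def load (s d : Fin n) (q : (Fin n → ZMod m) × (ℕ → Fin n → NodeCoins n)) : ℝ≥0∞ :=
  1 + ∑ v ∈ Finset.univ.filter (fun v => v ≠ s ∧ v ≠ d), if N.Arr s v q.1 (q.2 0) then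
    ∑' t, (if N.Busy s v d q.1 q.2 t then (1 : ℝ≥0∞) else 0) else 0

lemma tally_shift (A : (Fin n → ZMod m) → (Fin n → NodeCoins n) → Prop) (x : Fin n → ZMod m)
    (ω : ℕ → Fin n → NodeCoins n) (u t : ℕ) :
    tally A (orbit move u x ω) (fun k => ω (k + u)) t
      = countFrom (fun j => A (orbit move j x ω) (ω j)) u t := by
  unfold tally countFrom
  congr 1
  ext j
  simp only [Finset.mem_filter]
  rw [orbit_orbit, add_comm j u]

variable {N} {Δ : ℝ} {r : Realization n} {i : Fin (n / 2)}
  {q : (Fin n → ZMod m) × (ℕ → Fin n → NodeCoins n)}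

open Classical in
lemma Describes.sum_delay_le (hd : N.Describes Δ r i q) (S : ℕ) :
    ∑ s ∈ Finset.range S, (if r.RelayLeaves Δ i s then r.delay Δ i s else 0)
      ≤ ∑ u ∈ Finset.range S, N.load (r.src i) (r.dst i) ((orbitShift move)^[u] q) := by
  set V := Finset.univ.filter (fun v => v ≠ r.src i ∧ v ≠ r.dst i) with hV
  have h1 : ∀ s, (if r.RelayLeaves Δ i s then r.delay Δ i s else 0)
      ≤ 1 + ∑ v ∈ V, ∑' t, (if s ∈ r.line Δ i t v then (1 : ℝ≥0∞) else 0) := by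
    intro s
    split_ifs with h
    · obtain ⟨w, hw⟩ := h
      by_cases hwd : w = r.dst i
      -- A packet handed directly to the destination has delay one; the summand `1` of `load` pays
      -- for it.
      · refine le_trans (iInf₂_le s (Or.inl ⟨rfl, hwd ▸ hw⟩)) ?_
        simp
      · refine le_trans ?_ le_add_self
        have hwV : w ∈ V := Finset.mem_filter.2 ⟨Finset.mem_univ _, (hd.arr s w hw).1, hwd⟩
        refine (Realization.delay_le_tsum hw hwd).trans ?_
        exact Finset.single_le_sum
          (f := fun v => ∑' t, (if s ∈ r.line Δ i t v then (1 : ℝ≥0∞) else 0))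
          (fun _ _ => zero_le) hwV
    · exact zero_le
  refine (Finset.sum_le_sum fun s _ => h1 s).trans ?_
  simp only [load]
  rw [Finset.sum_add_distrib, Finset.sum_add_distrib, Finset.sum_comm,
    Finset.sum_comm (s := Finset.range S) (t := V)]
  refine add_le_add le_rfl (Finset.sum_le_sum fun v hv => ?_)
  rw [hV, Finset.mem_filter] at hv
  refine (Realization.sum_tsum_mem_line_le
    (fun u => N.Arr (r.src i) v (orbit move u q.1 q.2) (q.2 u))
    (fun u => N.Srv v (r.dst i) (orbit move u q.1 q.2) (q.2 u)) v
    (fun t ht => (hd.arr t v ht).2) (fun t => hd.srv t v hv.2.2) S).trans (le_of_eq ?_)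
  refine Finset.sum_congr rfl fun u _ => ?_
  rw [orbitShift_iterate]
  simp only [zero_add, Busy, tally_shift]

/-- A packet never changes its relay, and a relay can deliver only while it meets the destination.
-/
lemma Describes.late (hd : N.Describes Δ r i q) {s T : ℕ}
    (h : N.Late (r.src i) (r.dst i) T ((orbitShift move)^[s] q)) :
    r.RelayLeaves Δ i s ∧ (T : ℝ≥0∞) ≤ r.delay Δ i s := by
  obtain ⟨w, hws, hwd, hh, hm⟩ := h
  rw [orbitShift_iterate] at hh hm
  simp only [zero_add, orbit_orbit] at hh hm
  have hA := hd.hop s w hws hh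
  refine ⟨⟨w, hA⟩, le_iInf₂ fun t ht => ?_⟩
  rcases ht with ⟨rfl, h1⟩ | ⟨v, h1, h2⟩
  · exact (hwd (hA.unique h1)).elim
  · have h3 : s ∈ r.line Δ i t v := List.mem_of_mem_head? h2
    obtain ⟨h4, h5, h6⟩ := (Realization.line_spec t v).2 s h3
    obtain rfl := hA.unique h5
    have h7 := hd.meets t _ w h1
    by_contra h8
    push Not at h8
    -- The slot of departure is included in the delay, so a delay below `T` would need a meeting at
    -- most `T` slots after the departure.
    have h9 : t - s + 1 < T := by exact_mod_cast h8
    refine hm (t - s) (by omega) ?_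
    rwa [show s + (t - s) = t by omega]

open Classical in
lemma Describes.tally_sends_le (hd : N.Describes Δ r i q) (S : ℕ) :
    tally (N.Sends (r.src i)) q.1 q.2 S ≤ Nat.count (r.RelayLeaves Δ i) S := by
  rw [Nat.count_eq_card_filter_range, tally]
  apply Finset.card_le_card
  intro s hs
  rw [Finset.mem_filter] at hs ⊢
  obtain ⟨h1, w, h2, h3⟩ := hs
  exact ⟨h1, w, hd.hop s w h2.symm h3⟩

variable (N)

lemma measurable_tally (A : (Fin n → ZMod m) → (Fin n → NodeCoins n) → Prop)
    (x : Fin n → ZMod m) (t : ℕ) : Measurable fun ω => tally A x ω t := by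
  classical
  unfold tally
  simp only [Finset.card_filter]
  refine Finset.measurable_sum _ fun u _ => ?_
  have h1 : Measurable fun ω : ℕ → Fin n → NodeCoins n => (orbit move u x ω, ω u) :=
    (measurable_orbit_comp move u x id).prodMk (measurable_pi_apply u)
  exact (measurable_of_countable
    (fun p : (Fin n → ZMod m) × (Fin n → NodeCoins n) => if A p.1 p.2 then 1 else 0)).comp h1

lemma measurableSet_busy (s v d : Fin n) (x : Fin n → ZMod m) (t : ℕ) :
    MeasurableSet {ω | N.Busy s v d x ω t} :=
  measurableSet_lt (measurable_tally _ x t) (measurable_tally _ x (t + 1))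

open Classical in
lemma measurable_tsum_busy (s v d : Fin n) (x : Fin n → ZMod m) :
    Measurable fun ω => ∑' t, (if N.Busy s v d x ω t then (1 : ℝ≥0∞) else 0) :=
  Measurable.tsum fun t =>
    Measurable.ite (N.measurableSet_busy s v d x t) measurable_const measurable_const

lemma measurable_load (s d : Fin n) : Measurable (N.load s d) := by
  classical
  refine measurable_from_prod_countable_right fun x => ?_
  unfold load
  refine (measurable_const (a := (1 : ℝ≥0∞))).add (Finset.measurable_sum _ fun v _ => ?_)
  refine Measurable.ite ?_ (N.measurable_tsum_busy s v d x) measurable_const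
  exact measurableSet_setOfPred.2
    ((measurable_of_countable (N.Arr s v x)).comp (measurable_pi_apply 0))

/-- Each relay meets the source with probability `m⁻¹ * m⁻¹ = 1 / n`, and there are at most `n`
relays. The bound for busy times is uniform in the initial positions, so it remains valid given the
meeting. -/
lemma lintegral_load_le {B κ : ℝ} (hN : N.Good B κ) (hm : 4 * B ≤ m) (hnm : n = m ^ 2)
    (hn : 72 ≤ Real.log n) (p α : I) (hp0 : 0 < p) (hp1 : p < 1)
    (hα : (α : ℝ) ≤ alphaBound p B κ) (s d : Fin n) :
    ∫⁻ q, N.load s d q ∂(pathLaw n m p α)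
      ≤ 1 + ENNReal.ofReal
        (1000000 / (p * (1 - p) * Real.exp (-(4 * B * κ))) * (n * Real.log n)) := by
  classical
  set K := ENNReal.ofReal (1000000 / (p * (1 - p) * Real.exp (-(4 * B * κ))) * (n * Real.log n))
    with hK
  set P := Measure.infinitePi fun _ : ℕ => slotLaw n p α with hP
  have h1 : ∀ x, ∫⁻ ω, N.load s d (x, ω) ∂P
      ≤ 1 + ∑ v ∈ Finset.univ.filter (fun v => v ≠ s ∧ v ≠ d),
        {x | N.Meets s v x}.indicator (fun _ => K) x := by
    intro x
    calc _ ≤ ∫⁻ ω, (1 + ∑ v ∈ Finset.univ.filter (fun v => v ≠ s ∧ v ≠ d),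
          {x | N.Meets s v x}.indicator
            (fun _ => ∑' t, (if N.Busy s v d x ω t then (1 : ℝ≥0∞) else 0)) x) ∂P := by
          refine lintegral_mono fun ω => ?_
          unfold load
          gcongr with v _
          split_ifs with h
          · rw [Set.indicator_of_mem (show x ∈ {x | N.Meets s v x} from h.1)]
          · exact zero_le
      _ = 1 + ∑ v ∈ Finset.univ.filter (fun v => v ≠ s ∧ v ≠ d),
          {x | N.Meets s v x}.indicator
            (fun _ => ∑' t, P {ω | N.Busy s v d x ω t}) x := by
          rw [lintegral_add_left measurable_const, lintegral_finsetSum]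
          · congr 1
            · simp
            · refine Finset.sum_congr rfl fun v _ => ?_
              by_cases hx : x ∈ {x | N.Meets s v x}
              · simp only [Set.indicator_of_mem hx]
                rw [lintegral_tsum fun t => (Measurable.ite (N.measurableSet_busy s v d x t)
                  measurable_const measurable_const).aemeasurable]
                refine tsum_congr fun t => ?_
                rw [← lintegral_indicator_one (N.measurableSet_busy s v d x t)]
                rfl
              · simp [Set.indicator_of_notMem hx]
          · intro v _
            by_cases hx : x ∈ {x | N.Meets s v x}
            · simp only [Set.indicator_of_mem hx]
              exact N.measurable_tsum_busy s v d x
            · simp only [Set.indicator_of_notMem hx]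
              exact measurable_const
      _ ≤ _ := by
          gcongr with v hv
          rw [Finset.mem_filter] at hv
          exact N.lintegral_busy_le hN hm hnm hn p α hp0 hp1 hα s v d hv.2.1.symm hv.2.2 x
  rw [pathLaw, lintegral_prod _ (N.measurable_load s d).aemeasurable]
  refine (lintegral_mono h1).trans ?_
  rw [lintegral_add_left measurable_const, lintegral_finsetSum _ fun _ _ => measurable_of_countable _]
  have h2 : ∀ v ∈ Finset.univ.filter (fun v => v ≠ s ∧ v ≠ d),
      ∫⁻ x, {x | N.Meets s v x}.indicator (fun _ => K) x ∂(startLaw n m)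
        = K * ((m : ℝ≥0∞)⁻¹ * (m : ℝ≥0∞)⁻¹) := by
    intro v hv
    rw [Finset.mem_filter] at hv
    rw [lintegral_indicator_const (measurableSet_setOfPred.2 (measurable_of_countable _)),
      N.startLaw_meets s v hv.2.1.symm]
  rw [Finset.sum_congr rfl h2, Finset.sum_const, nsmul_eq_mul]
  have hm0 : (m : ℝ≥0∞) ≠ 0 := Nat.cast_ne_zero.2 (NeZero.ne m)
  refine add_le_add (by simp) ?_
  calc _ ≤ (n : ℝ≥0∞) * (K * ((m : ℝ≥0∞)⁻¹ * (m : ℝ≥0∞)⁻¹)) := by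
        gcongr
        exact_mod_cast (Finset.card_le_univ _).trans (Fintype.card_fin n).le
    _ = K * ((m * (m : ℝ≥0∞)⁻¹) * (m * (m : ℝ≥0∞)⁻¹)) := by rw [hnm]; push_cast; ring
    _ = K := by rw [ENNReal.mul_inv_cancel hm0 (ENNReal.natCast_ne_top m)]; simp

lemma ae_eventually_tally_sends_path {B κ : ℝ} (hN : N.Good B κ) (hm : 4 * B ≤ m) (hnm : n = m ^ 2)
    (hn : 72 ≤ Real.log n) (p α : I) (hp0 : 0 < p) (hp1 : p < 1) (hα : 0 < α) (s : Fin n) :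
    ∀ᵐ q ∂(pathLaw n m p α), ∀ᶠ S : ℕ in atTop,
      p * α * (1 - p) * Real.exp (-(4 * B * κ)) / 128 * S ≤ (tally (N.Sends s) q.1 q.2 S : ℝ) := by
  have hmeas : MeasurableSet {q : (Fin n → ZMod m) × (ℕ → Fin n → NodeCoins n) |
      ∀ᶠ S : ℕ in atTop, p * α * (1 - p) * Real.exp (-(4 * B * κ)) / 128 * S
        ≤ (tally (N.Sends s) q.1 q.2 S : ℝ)} := by
    simp only [eventually_atTop]
    refine measurableSet_setOfPred.2 (Measurable.exists fun a => Measurable.forall fun S =>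
      Measurable.forall fun _ => measurableSet_setOfPred.1 (measurableSet_le measurable_const ?_))
    refine measurable_from_prod_countable_right fun x => ?_
    exact (measurable_of_countable (fun k : ℕ => (k : ℝ))).comp (measurable_tally _ x S)
  rw [pathLaw, Measure.ae_prod_iff_ae_ae hmeas]
  exact Eventually.of_forall fun x =>
    N.ae_eventually_tally_sends hN hm hnm hn p α hp0 hp1 hα s x

end Sites

/-! ### Points of a great circle -/

section Circle

open InnerProductGeometry

lemma sphereRadius_pos : 0 < sphereRadius := by
  unfold sphereRadius; have := Real.pi_pos; positivity

lemma geoDist_comm (x y : E3) : geoDist x y = geoDist y x := by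
  rw [geoDist, geoDist, angle_comm]

lemma geoDist_triangle (x y z : E3) : geoDist x z ≤ geoDist x y + geoDist y z := by
  unfold geoDist
  rw [← mul_add]
  exact mul_le_mul_of_nonneg_left (angle_le_angle_add_angle x y z) sphereRadius_pos.le

/-- The length `√(π / n)` is exactly the spacing of the lattice points, so distances on the sphere
can be compared with numbers of lattice steps. -/
lemma sqrt_pi_div {n m : ℕ} [NeZero m] (hnm : n = m ^ 2) :
    √(Real.pi / n) = sphereRadius * (2 * Real.pi / m) := by
  have hm0 : (0 : ℝ) < m := by exact_mod_cast NeZero.pos m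
  have hπ := Real.pi_pos
  have h1 : √Real.pi * √Real.pi = Real.pi := Real.mul_self_sqrt hπ.le
  have h2 : 0 < √Real.pi := Real.sqrt_pos.2 hπ
  rw [hnm, Nat.cast_pow, Real.sqrt_div hπ.le, Real.sqrt_sq hm0.le, sphereRadius]
  field_simp
  nlinarith

lemma geoDist_le_iff {n m : ℕ} [NeZero m] (hnm : n = m ^ 2) (c : ℝ) (x y : E3) :
    geoDist x y ≤ c * √(Real.pi / n) ↔ angle x y ≤ c * (2 * Real.pi / m) := by
  rw [sqrt_pi_div hnm, geoDist, mul_left_comm, mul_le_mul_iff_right₀ sphereRadius_pos]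

/-- The point with angle `θ` on the circle with orthonormal frame `(e, f)`. -/
def circlePoint (e f : E3) (θ : ℝ) : E3 := Real.cos θ • e + Real.sin θ • f

variable {e f u : E3}

lemma inner_circlePoint (he : ‖e‖ = 1) (hf : ‖f‖ = 1) (hef : inner ℝ e f = 0)
    (θ θ' : ℝ) :
    inner ℝ (circlePoint e f θ) (circlePoint e f θ') = Real.cos (θ - θ') := by
  have hfe : inner ℝ f e = 0 := by rw [real_inner_comm]; exact hef
  simp only [circlePoint, inner_add_left, inner_add_right, real_inner_smul_left,
    real_inner_smul_right, real_inner_self_eq_norm_sq, he, hf, hef, hfe, Real.cos_sub]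
  ring

lemma norm_circlePoint (he : ‖e‖ = 1) (hf : ‖f‖ = 1) (hef : inner ℝ e f = 0)
    (θ : ℝ) : ‖circlePoint e f θ‖ = 1 := by
  have h := inner_circlePoint he hf hef θ θ
  rw [sub_self, Real.cos_zero, real_inner_self_eq_norm_sq] at h
  exact (pow_eq_one_iff_of_nonneg (norm_nonneg _) two_ne_zero).1 h

lemma angle_circlePoint (he : ‖e‖ = 1) (hf : ‖f‖ = 1) (hef : inner ℝ e f = 0)
    (θ θ' : ℝ) :
    angle (circlePoint e f θ) (circlePoint e f θ') = Real.arccos (Real.cos (θ - θ')) := by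
  rw [angle, inner_circlePoint he hf hef, norm_circlePoint he hf hef, norm_circlePoint he hf hef]
  simp

lemma arccos_cos_le_abs (x : ℝ) : Real.arccos (Real.cos x) ≤ |x| := by
  by_cases hx : |x| ≤ Real.pi
  · rw [← Real.cos_abs, Real.arccos_cos (abs_nonneg x) hx]
  · exact (Real.arccos_le_pi _).trans (not_le.1 hx).le

/-- Every point of a great circle is of the form `circlePoint e f θ`. -/
lemma exists_eq_circlePoint (he : ‖e‖ = 1) (hf : ‖f‖ = 1) (hef : inner ℝ e f = 0)
    {z : E3} (hu : ‖u‖ = 1) (heu : inner ℝ e u = 0) (hfu : inner ℝ f u = 0)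
    (hz : ‖z‖ = 1) (hzu : inner ℝ z u = 0) : ∃ θ, z = circlePoint e f θ := by
  have hon : Orthonormal ℝ ![e, f, u] := by
    rw [orthonormal_iff_ite]
    intro a b
    have hfe : inner ℝ f e = 0 := by rw [real_inner_comm]; exact hef
    have hue : inner ℝ u e = 0 := by rw [real_inner_comm]; exact heu
    have huf : inner ℝ u f = 0 := by rw [real_inner_comm]; exact hfu
    fin_cases a <;> fin_cases b <;>
      simp [he, hf, hu, hef, heu, hfu, hfe, hue, huf]
  have hsp : ⊤ ≤ Submodule.span ℝ (Set.range ![e, f, u]) :=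
    (hon.linearIndependent.span_eq_top_of_card_eq_finrank (by simp)).ge
  set b := OrthonormalBasis.mk hon hsp with hb
  have h1 := b.sum_repr' z
  have hbe : ∀ k, b k = ![e, f, u] k := fun k => by rw [hb, OrthonormalBasis.coe_mk]
  rw [Fin.sum_univ_three, hbe, hbe, hbe] at h1
  have huz : inner ℝ u z = 0 := by rw [real_inner_comm]; exact hzu
  simp only [Matrix.cons_val_zero, Matrix.cons_val_one, Matrix.cons_val] at h1
  rw [huz, zero_smul, add_zero] at h1
  set a := inner ℝ e z
  set d := inner ℝ f z
  have h2 : a ^ 2 + d ^ 2 = 1 := by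
    have h3 : inner ℝ z z = (1 : ℝ) := by rw [real_inner_self_eq_norm_sq, hz]; norm_num
    have hfe : inner ℝ f e = 0 := by rw [real_inner_comm]; exact hef
    rw [← h1] at h3
    simp only [inner_add_left, inner_add_right, real_inner_smul_left, real_inner_smul_right,
      real_inner_self_eq_norm_sq, norm_smul, he, hf, hef, hfe, Real.norm_eq_abs, mul_one,
      sq_abs] at h3
    linarith
  set w : ℂ := ⟨a, d⟩ with hw
  have hwn : ‖w‖ = 1 := by
    rw [Complex.norm_def, Complex.normSq_apply, hw]
    simp only
    rw [← sq, ← sq, h2, Real.sqrt_one]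
  refine ⟨w.arg, ?_⟩
  have h4 := Complex.norm_mul_cos_arg w
  have h5 := Complex.norm_mul_sin_arg w
  rw [hwn, one_mul] at h4 h5
  rw [circlePoint, h4, h5, ← h1]

end Circle

/-! ### Lattice points -/

section Lattice

open InnerProductGeometry

variable {n m : ℕ} [NeZero m] {pl : Placement n} (c : Config n)

lemma norm_pole (v : Fin n) : ‖(c.pole v : E3)‖ = 1 := by simp

lemma norm_latticePoint (hpl : pl.Valid) (c : Config n)
    (v : Fin n) (a : ZMod m) : ‖latticePoint m pl c v a‖ = 1 :=
  norm_circlePoint (hpl.fst_mem c v).1 (hpl.snd_mem c v).1 (hpl.orthogonal c v) _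

lemma onGreatCircle_latticePoint (hpl : pl.Valid) (c : Config n)
    (v : Fin n) (a : ZMod m) :
    OnGreatCircle (c.pole v) (latticePoint m pl c v a) := by
  refine ⟨norm_latticePoint hpl c v a, ?_⟩
  simp only [latticePoint, inner_add_left, real_inner_smul_left, (hpl.fst_mem c v).2,
    (hpl.snd_mem c v).2]
  simp

lemma latticePoint_eq (v : Fin n) (j : ℤ) :
    latticePoint m pl c v (j : ZMod m)
      = circlePoint (pl c v).1 (pl c v).2 (2 * Real.pi * j / m) := by
  have hm0 : (m : ℝ) ≠ 0 := Nat.cast_ne_zero.2 (NeZero.ne m)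
  have h1 : (((j : ZMod m).val : ℤ) : ZMod m) = (j : ZMod m) := by
    rw [Int.cast_natCast, ZMod.natCast_zmod_val]
  obtain ⟨k, hk⟩ := (ZMod.intCast_eq_intCast_iff_dvd_sub _ _ _).1 h1
  have hk' : (j : ℝ) = ((j : ZMod m).val : ℝ) + m * k := by
    have : ((j - ((j : ZMod m).val : ℤ) : ℤ) : ℝ) = ((m * k : ℤ) : ℝ) := by rw [hk]
    push_cast at this
    linarith
  have h2 : 2 * Real.pi * j / m = 2 * Real.pi * ((j : ZMod m).val : ℝ) / m + k * (2 * Real.pi) := by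
    rw [hk']; field_simp
  rw [latticePoint, circlePoint, h2, Real.cos_add_int_mul_two_pi, Real.sin_add_int_mul_two_pi]

lemma exists_latticePoint_angle_le (hpl : pl.Valid) (c : Config n)
    (v : Fin n) {z : E3} (hz : OnGreatCircle (c.pole v) z) :
    ∃ a : ZMod m, angle (latticePoint m pl c v a) z ≤ Real.pi / m := by
  have hm0 : (0 : ℝ) < m := by exact_mod_cast NeZero.pos m
  have hπ := Real.pi_pos
  obtain ⟨θ, rfl⟩ := exists_eq_circlePoint (hpl.fst_mem c v).1 (hpl.snd_mem c v).1
    (hpl.orthogonal c v) (norm_pole c v) (hpl.fst_mem c v).2 (hpl.snd_mem c v).2 hz.1 hz.2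
  set y := θ * m / (2 * Real.pi) with hy
  refine ⟨((round y : ℤ) : ZMod m), ?_⟩
  rw [latticePoint_eq, angle_circlePoint (hpl.fst_mem c v).1 (hpl.snd_mem c v).1
    (hpl.orthogonal c v)]
  refine (arccos_cos_le_abs _).trans ?_
  have h1 : 2 * Real.pi * (round y : ℤ) / m - θ = -(2 * Real.pi / m) * (y - round y) := by
    rw [hy]; field_simp; ring
  rw [h1, abs_mul, abs_neg, abs_of_pos (by positivity)]
  calc 2 * Real.pi / m * |y - round y| ≤ 2 * Real.pi / m * (1 / 2) := by
        gcongr; exact abs_sub_round y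
    _ = Real.pi / m := by ring

/-- The nearest lattice point is close. -/
lemma geoDist_nearestSite_le (hpl : pl.Valid) (c : Config n)
    (hnm : n = m ^ 2) (v : Fin n) {z : E3}
    (hz : OnGreatCircle (c.pole v) z) :
    geoDist (latticePoint m pl c v (nearestSite m pl c v z)) z ≤ 1 / 2 * √(Real.pi / n) := by
  obtain ⟨a, ha⟩ := exists_latticePoint_angle_le (m := m) hpl c v hz
  have hsp := (Finset.exists_min_image Finset.univ
    (fun a : ZMod m => geoDist (latticePoint m pl c v a) z) Finset.univ_nonempty).choose_spec
  refine (hsp.2 a (Finset.mem_univ a)).trans ?_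
  rw [geoDist_le_iff hnm]
  refine ha.trans (le_of_eq (by ring))

-- Two lattice points near `z` are at most `2 ρ` steps apart. Relative to one of them, the signed
-- numbers of steps therefore lie in an interval with `2 ⌊2ρ⌋ + 1` integers.
open Classical in
lemma card_near_le (hpl : pl.Valid) (c : Config n)
    (hnm : n = m ^ 2) {ρ : ℝ} (hρ : 0 ≤ ρ) (v : Fin n) (z : E3) :
    ((Finset.univ.filter fun a : ZMod m =>
      geoDist (latticePoint m pl c v a) z ≤ ρ * √(Real.pi / n)).card : ℝ) ≤ 4 * ρ + 1 := by
  have hm0 : (0 : ℝ) < m := by exact_mod_cast NeZero.pos m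
  have hπ := Real.pi_pos
  set s := Finset.univ.filter fun a : ZMod m =>
      geoDist (latticePoint m pl c v a) z ≤ ρ * √(Real.pi / n) with hs
  rcases s.eq_empty_or_nonempty with h | ⟨b, hb⟩
  · rw [h]; simp; positivity
  have hclose : ∀ a ∈ s, (|(a - b).valMinAbs| : ℝ) ≤ 2 * ρ := by
    intro a ha
    have h1 := (geoDist_le_iff hnm ρ _ _).1 (Finset.mem_filter.1 ha).2
    have h2 := (geoDist_le_iff hnm ρ _ _).1 (Finset.mem_filter.1 hb).2
    rw [angle_comm] at h2
    have h3 := (angle_le_angle_add_angle _ z _).trans (add_le_add h1 h2)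
    have h4 : Real.cos (2 * Real.pi * (a - b).valMinAbs / m)
        = inner ℝ (latticePoint m pl c v a) (latticePoint m pl c v b) := by
      have e1 : a = ((b.val + (a - b).valMinAbs : ℤ) : ZMod m) := by
        push_cast
        rw [ZMod.natCast_zmod_val]; ring
      have e2 : b = ((b.val : ℤ) : ZMod m) := by
        push_cast
        rw [ZMod.natCast_zmod_val]
      conv_rhs => rw [e1, latticePoint_eq]; arg 3; rw [e2, latticePoint_eq]
      rw [inner_circlePoint (hpl.fst_mem c v).1 (hpl.snd_mem c v).1 (hpl.orthogonal c v)]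
      congr 1
      push_cast
      ring
    set j := (a - b).valMinAbs with hj
    have hjm := (a - b).valMinAbs_mem_Ioc
    rw [← hj] at hjm
    have hjm' : |(j : ℝ)| * 2 ≤ m := by
      have : |j| * 2 ≤ (m : ℤ) := by
        rcases abs_cases j with ⟨h, _⟩ | ⟨h, _⟩ <;> rw [h] <;> linarith [hjm.1, hjm.2]
      exact_mod_cast this
    have habs : |2 * Real.pi * j / m| = 2 * Real.pi * |(j : ℝ)| / m := by
      rw [abs_div, abs_mul, abs_of_pos hm0, abs_of_pos (by positivity : 0 < 2 * Real.pi)]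
    have h5 : angle (latticePoint m pl c v a) (latticePoint m pl c v b)
        = 2 * Real.pi * |(j : ℝ)| / m := by
      rw [angle, ← h4, norm_latticePoint hpl, norm_latticePoint hpl, mul_one, div_one,
        ← Real.cos_abs, habs, Real.arccos_cos (by positivity)]
      rw [div_le_iff₀ hm0]
      nlinarith
    rw [h5] at h3
    have h6 : |(j : ℝ)| * (2 * Real.pi / m) ≤ (2 * ρ) * (2 * Real.pi / m) := by
      calc _ = 2 * Real.pi * |(j : ℝ)| / m := by ring
        _ ≤ _ := h3
        _ = _ := by ring
    exact le_of_mul_le_mul_right h6 (by positivity)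
  have hcard : s.card ≤ (Finset.Icc (-⌊2 * ρ⌋) ⌊2 * ρ⌋).card := by
    refine Finset.card_le_card_of_injOn (fun a => (a - b).valMinAbs) ?_ ?_
    · intro a ha
      have := hclose a ha
      have h7 : |(a - b).valMinAbs| ≤ ⌊2 * ρ⌋ := Int.le_floor.2 (by push_cast; exact this)
      rw [abs_le] at h7
      exact Finset.mem_coe.2 (Finset.mem_Icc.2 h7)
    · intro a _ a' _ h
      exact sub_left_injective (ZMod.injective_valMinAbs h)
  rw [Int.card_Icc] at hcard
  have h0 : 0 ≤ ⌊2 * ρ⌋ := Int.floor_nonneg.2 (by positivity)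
  have h8 : (s.card : ℤ) ≤ 2 * ⌊2 * ρ⌋ + 1 := by omega
  have h9 : (s.card : ℝ) ≤ 2 * (⌊2 * ρ⌋ : ℝ) + 1 := by exact_mod_cast h8
  have h10 := Int.floor_le (2 * ρ)
  linarith

end Lattice

/-! ### The sites of a configuration -/

namespace Config

variable {n : ℕ} (c : Config n)

lemma z_comm (i j : Fin n) : c.z i j = c.z j i := by
  have h1 : c.zCoin i j = c.zCoin j i := by
    unfold zCoin; rw [min_comm i j, max_comm i j]
  have h2 : c.crossDir i j = c.crossDir j i := by
    unfold crossDir; rw [min_comm i j, max_comm i j]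
  rw [z, z, h1, h2]

lemma src_ne_dst (i : Fin (n / 2)) : c.src i ≠ c.dst i := by
  intro h
  have := c.2.1.injective h
  simp at this

/-- A vector of the direction of the intersection of two great circles. -/
def crossVec (i j : Fin n) : E3 := WithLp.toLp 2
  (crossProduct (c.pole (min i j) : E3).ofLp (c.pole (max i j) : E3).ofLp)

lemma crossDir_eq (i j : Fin n) : c.crossDir i j = ‖c.crossVec i j‖⁻¹ • c.crossVec i j := rfl

lemma inner_crossVec_min (i j : Fin n) : inner ℝ (c.crossVec i j) (c.pole (min i j) : E3) = 0 := by
  rw [EuclideanSpace.inner_eq_star_dotProduct]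
  simp [crossVec]

lemma inner_crossVec_max (i j : Fin n) : inner ℝ (c.crossVec i j) (c.pole (max i j) : E3) = 0 := by
  rw [EuclideanSpace.inner_eq_star_dotProduct]
  simp [crossVec]

lemma inner_z_left (i j : Fin n) : inner ℝ (c.z i j) (c.pole i : E3) = 0 := by
  have h : inner ℝ (c.crossVec i j) (c.pole i : E3) = 0 := by
    rcases le_total i j with h | h
    · have := c.inner_crossVec_min i j; rwa [min_eq_left h] at this
    · have := c.inner_crossVec_max i j; rwa [max_eq_left h] at this
  unfold z
  split_ifs
  · rw [crossDir_eq, real_inner_smul_left, h, mul_zero]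
  · rw [inner_neg_left, crossDir_eq, real_inner_smul_left, h, mul_zero, neg_zero]

lemma norm_z (i j : Fin n) (h : c.crossVec i j ≠ 0) : ‖c.z i j‖ = 1 := by
  have h1 : ‖c.crossDir i j‖ = 1 := by
    rw [crossDir_eq, norm_smul, norm_inv, norm_norm, inv_mul_cancel₀ (norm_ne_zero_iff.2 h)]
  unfold z
  split_ifs
  · exact h1
  · rw [norm_neg, h1]

lemma z_eq_zero (i j : Fin n) (h : c.crossVec i j = 0) : c.z i j = 0 := by
  simp [z, crossDir_eq, h]

/-- For parallel poles the formula for `z` gives the zero vector, whose angle with every vector is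
`π / 2` by convention. Then no circle passes through the small disk, contrary to the positive lower
bound in a typical configuration. -/
lemma Typical.crossVec_ne_zero {m : ℕ} [NeZero m] (hnm : n = m ^ 2) {Δ κ₁ κ₂ : ℝ}
    (hm : 4 * (2 + Δ) < m) (hκ : 0 < κ₁) {c : Config n} (hc : c.Typical Δ κ₁ κ₂)
    {i j : Fin n} (hij : i ≠ j) : c.crossVec i j ≠ 0 := by
  classical
  intro h
  have hm0 : (0 : ℝ) < m := by exact_mod_cast NeZero.pos m
  have hn0 : (0 : ℝ) < n := by rw [hnm]; push_cast; positivity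
  have h1 := (hc i j hij).1
  have h2 : ∀ k, ¬ c.PassesThrough Δ k i j := by
    rintro k ⟨x, _, hx⟩
    rw [c.z_eq_zero i j h, geoDist_le_iff hnm, InnerProductGeometry.angle_zero_right,
      ← mul_div_assoc, le_div_iff₀ hm0] at hx
    have := Real.pi_pos
    nlinarith
  have h3 : (Finset.univ.filter fun k => c.PassesThrough Δ k i j) = ∅ := by
    rw [Finset.filter_eq_empty_iff]; exact fun k _ => h2 k
  rw [h3] at h1
  have : 0 < κ₁ * √n := mul_pos hκ (Real.sqrt_pos.2 hn0)
  simp at h1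
  linarith

lemma onGreatCircle_z {i j : Fin n} (h : c.crossVec i j ≠ 0) : OnGreatCircle (c.pole i) (c.z i j) :=
  ⟨c.norm_z i j h, c.inner_z_left i j⟩

end Config

open Classical in
/-- The sites at which nodes can meet, and the sites close to the meeting points. -/
def sitesOf {n : ℕ} (m : ℕ) [NeZero m] (Δ : ℝ) (pl : Placement n) (c : Config n) : Sites n m where
  site v w := nearestSite m pl c v (c.z v w)
  near v w k := Finset.univ.filter fun b =>
    geoDist (latticePoint m pl c k b) (c.z v w) ≤ (2 + Δ) * √(Real.pi / n)

section Typical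

variable {n m : ℕ} [NeZero m] {Δ κ₁ κ₂ : ℝ} {pl : Placement n} {c : Config n}

lemma geoDist_site_le (hpl : pl.Valid)
    (hnm : n = m ^ 2) {v w : Fin n} (hc : c.crossVec v w ≠ 0) :
    geoDist (latticePoint m pl c v ((sitesOf m Δ pl c).site v w)) (c.z v w)
      ≤ 1 / 2 * √(Real.pi / n) :=
  geoDist_nearestSite_le hpl c hnm v (c.onGreatCircle_z hc)

lemma sitesOf_good (hpl : pl.Valid)
    (hnm : n = m ^ 2) (hΔ : 0 < Δ) (hm : 4 * (2 + Δ) < m) (hκ : 0 < κ₁)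
    (hc : c.Typical Δ κ₁ κ₂) : (sitesOf m Δ pl c).Good (4 * (2 + Δ) + 1) κ₂ where
  card_near v w k _ := card_near_le hpl c hnm (by linarith) k (c.z v w)
  card_passing v w hvw := by
    classical
    have h1 := (hc v w hvw).2
    have hsq : √(n : ℝ) = m := by
      rw [hnm, Nat.cast_pow, Real.sqrt_sq (Nat.cast_nonneg m)]
    rw [hsq] at h1
    refine le_trans ?_ h1
    norm_cast
    refine Finset.card_le_card fun k hk => ?_
    rw [Finset.mem_filter] at hk ⊢
    obtain ⟨_, b, hb⟩ := hk
    exact ⟨Finset.mem_univ _, _, onGreatCircle_latticePoint hpl c k b, (Finset.mem_filter.1 hb).2⟩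
  mem_near v w w' hvw hvw' _ hs := by
    have h0 := hc.crossVec_ne_zero hnm hm hκ hvw
    have h0' := hc.crossVec_ne_zero hnm hm hκ hvw'
    have h0'' := hc.crossVec_ne_zero hnm hm hκ hvw'.symm
    have h1 := geoDist_site_le (Δ := Δ) hpl hnm h0
    have h2 := geoDist_site_le (Δ := Δ) hpl hnm h0'
    have h3 := geoDist_site_le (Δ := Δ) hpl hnm h0''
    rw [c.z_comm w' v] at h3
    rw [geoDist_comm] at h2
    rw [hs] at h1
    -- Three half spacings suffice: from the site of `w'` to `z v w'`, on to the common site of `v`,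
    -- and from there to `z v w`. The sum is below `2 + Δ` spacings.
    refine Finset.mem_filter.2 ⟨Finset.mem_univ _, ?_⟩
    have h5 := geoDist_triangle (latticePoint m pl c w' ((sitesOf m Δ pl c).site w' v))
      (c.z v w') (c.z v w)
    have h6 := geoDist_triangle (c.z v w') (latticePoint m pl c v ((sitesOf m Δ pl c).site v w'))
      (c.z v w)
    have := Real.sqrt_nonneg (Real.pi / n)
    have h4 : 0 ≤ Δ * √(Real.pi / n) := by positivity
    linarith

lemma position_eq_orbit (c : Config n) (q : (Fin n → ZMod m) × (ℕ → Fin n → NodeCoins n)) (t : ℕ) :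
    position ((c, q) : Outcome n m) t = orbit move t q.1 q.2 := by
  induction t with
  | zero => rfl
  | succ t ih =>
    rw [orbit_succ, ← ih]; rfl

lemma isNeighbor_iff (q : (Fin n → ZMod m) × (ℕ → Fin n → NodeCoins n)) (t : ℕ) (v w : Fin n) :
    IsNeighbor pl ((c, q) : Outcome n m) t v w
      ↔ v ≠ w ∧ (sitesOf m Δ pl c).Meets v w (orbit move t q.1 q.2) := by
  unfold IsNeighbor Sites.Meets
  rw [position_eq_orbit, sitesOf]
  simp only [c.z_comm w v]

/-- A transmission between nodes that meet alone is not disturbed by other nodes. -/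
lemma success_of_meetsAlone (hpl : pl.Valid)
    (hnm : n = m ^ 2) (hΔ : 0 < Δ) {v w : Fin n}
    (hvw : c.crossVec v w ≠ 0) (hwv : c.crossVec w v ≠ 0)
    (q : (Fin n → ZMod m) × (ℕ → Fin n → NodeCoins n)) (t : ℕ)
    (h : (sitesOf m Δ pl c).MeetsAlone v w (orbit move t q.1 q.2)) {T : Set (Fin n)}
    (hT : w ∉ T) : (realization pl ((c, q) : Outcome n m)).Success Δ t T v w := by
  intro k hk hkv
  have hkw : k ≠ w := fun h => hT (h ▸ hk)
  have hnear := h.2.2 k hkv hkw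
  simp only [realization, position_eq_orbit]
  have hnear' : (2 + Δ) * √(Real.pi / n)
      < geoDist (latticePoint m pl c k (orbit move t q.1 q.2 k)) (c.z v w) := by
    by_contra h'
    exact hnear (Finset.mem_filter.2 ⟨Finset.mem_univ _, not_lt.1 h'⟩)
  have h1 := geoDist_site_le (Δ := Δ) hpl hnm hvw
  have h2 := geoDist_site_le (Δ := Δ) hpl hnm hwv
  rw [← h.1] at h1
  rw [← h.2.1, c.z_comm w v] at h2
  set xv := latticePoint m pl c v (orbit move t q.1 q.2 v)
  set xw := latticePoint m pl c w (orbit move t q.1 q.2 w)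
  set xk := latticePoint m pl c k (orbit move t q.1 q.2 k)
  have h3 := geoDist_triangle xv (c.z v w) xw
  have h4 := geoDist_triangle xk xw (c.z v w)
  rw [geoDist_comm (c.z v w) xw] at h3
  -- Sender and receiver are each within half a spacing of the meeting point. A third node is more
  -- than `2 + Δ` spacings from it, hence more than `3/2 + Δ` from the receiver.
  have h5 : geoDist xv xw ≤ √(Real.pi / n) := by linarith
  have h6 : (1 + Δ) * geoDist xv xw ≤ (1 + Δ) * √(Real.pi / n) :=
    mul_le_mul_of_nonneg_left h5 (by linarith)
  have := Real.sqrt_nonneg (Real.pi / n)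
  linarith

/-- A node met alone is the only neighbor, so the uniform choice must select it. Other nodes are too
far away to disturb, and the receiver does not transmit itself because its activity coin is off. -/
lemma sitesOf_describes (hpl : pl.Valid)
    (hnm : n = m ^ 2) (hΔ : 0 < Δ) (hm : 4 * (2 + Δ) < m) (hκ : 0 < κ₁)
    (hc : c.Typical Δ κ₁ κ₂) (i : Fin (n / 2))
    (q : (Fin n → ZMod m) × (ℕ → Fin n → NodeCoins n)) :
    (sitesOf m Δ pl c).Describes Δ (realization pl ((c, q) : Outcome n m)) i q := by
  classical
  have hN := sitesOf_good (m := m) hpl hnm hΔ hm hκ hc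
  set r := realization pl ((c, q) : Outcome n m) with hr
  have hmem : ∀ t v w, w ∈ r.nbrs t v ↔
      v ≠ w ∧ (sitesOf m Δ pl c).Meets v w (orbit move t q.1 q.2) := by
    intro t v w
    rw [← isNeighbor_iff]
    simp [hr, realization]
  have hcr : ∀ {v w : Fin n}, v ≠ w → c.crossVec v w ≠ 0 := fun h =>
    hc.crossVec_ne_zero hnm hm hκ h
  refine ⟨?_, ?_, ?_, ?_⟩
  · rintro t v ⟨⟨_, _, hs, hne, hv⟩, _⟩
    have h1 : v ∈ r.nbrs t (r.src i) := by
      rw [← hv]; exact ((r.coins t (r.src i)).choiceA ⟨r.nbrs t (r.src i), hne⟩).2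
    rw [hmem] at h1
    exact ⟨h1.1.symm, h1.2, hs⟩
  · rintro t v hvd ⟨hm1, hb, hb'⟩ hline
    have hnb : r.dst i ∈ r.dstNbrs t v := by
      rw [Realization.dstNbrs, Finset.mem_filter, hmem]
      exact ⟨⟨hvd, hm1.meets⟩, i, rfl⟩
    refine ⟨⟨hb, ⟨⟨_, hnb⟩, ?_⟩, hline⟩, ?_⟩
    · have h1 := ((r.coins t v).choiceB ⟨r.dstNbrs t v, ⟨_, hnb⟩⟩).2
      simp only [Realization.dstNbrs, Finset.mem_filter] at h1
      have h2 := (hmem _ _ _).1 h1.1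
      exact hm1.unique hN hvd h2.1 h2.2
    · refine success_of_meetsAlone hpl hnm hΔ (hcr hvd) (hcr hvd.symm) q t hm1 ?_
      rintro ⟨i', hi', _⟩
      exact absurd (hi'.symm.trans hb') (by simp)
  · rintro t w hws ⟨hm1, ⟨ha, hs⟩, ha'⟩
    have hnb : w ∈ r.nbrs t (r.src i) := (hmem _ _ _).2 ⟨hws.symm, hm1.meets⟩
    refine ⟨⟨⟨i, rfl⟩, ha, hs, ⟨_, hnb⟩, ?_⟩, ?_⟩
    · have h1 := ((r.coins t (r.src i)).choiceA ⟨r.nbrs t (r.src i), ⟨_, hnb⟩⟩).2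
      have h2 := (hmem _ _ _).1 h1
      exact hm1.unique hN hws.symm h2.1 h2.2
    · refine success_of_meetsAlone hpl hnm hΔ (hcr hws.symm) (hcr hws) q t hm1 ?_
      rintro ⟨w', _, h1, _⟩
      exact absurd (h1.symm.trans ha') (by simp)
  · rintro t Q v ⟨⟨_, ⟨hne, hch⟩, _⟩, _⟩
    have h1 := ((r.coins t v).choiceB ⟨r.dstNbrs t v, hne⟩).2
    rw [hch] at h1
    simp only [Realization.dstNbrs, Finset.mem_filter] at h1
    exact ((hmem _ _ _).1 h1.1).2

/-! ### Delays in fixed configurations -/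

lemma packetDelay_eq (ω : Outcome n m) (i : Fin (n / 2)) (j : ℕ) :
    packetDelay Δ κ₁ κ₂ pl ω i j
      = indexedDelay (Leaves Δ κ₁ κ₂ pl ω i) (Arrives Δ κ₁ κ₂ pl ω i) j := rfl

lemma leaves_of_typical {ω : Outcome n m} (h : ω.1.Typical Δ κ₁ κ₂) (i : Fin (n / 2)) :
    Leaves Δ κ₁ κ₂ pl ω i = (realization pl ω).RelayLeaves Δ i := by
  ext s; simp [Leaves, h]

lemma arrives_of_typical {ω : Outcome n m} (h : ω.1.Typical Δ κ₁ κ₂) (i : Fin (n / 2)) :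
    Arrives Δ κ₁ κ₂ pl ω i = (realization pl ω).RelayArrives Δ i := by
  ext s t; simp [Arrives, h]

lemma pairDelay_of_typical {ω : Outcome n m} (h : ω.1.Typical Δ κ₁ κ₂) (i : Fin (n / 2)) :
    pairDelay Δ κ₁ κ₂ pl ω i = limsup (fun k : ℕ => (∑ j ∈ Finset.range k,
      indexedDelay ((realization pl ω).RelayLeaves Δ i) ((realization pl ω).RelayArrives Δ i) j) / k)
      atTop := by
  unfold pairDelay
  simp only [packetDelay_eq, leaves_of_typical h, arrives_of_typical h]

lemma pairDelay_le_of_not_typical {ω : Outcome n m} (h : ¬ ω.1.Typical Δ κ₁ κ₂)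
    (i : Fin (n / 2)) : pairDelay Δ κ₁ κ₂ pl ω i ≤ 1 := by
  classical
  have hA : Arrives Δ κ₁ κ₂ pl ω i = fun s t => s = t := by
    ext s t; simp [Arrives, h]
  have hL : Leaves Δ κ₁ κ₂ pl ω i = fun s => s % (n / 2) = i := by
    ext s; simp [Leaves, h]
  have hinf : {s | Leaves Δ κ₁ κ₂ pl ω i s}.Infinite := by
    rw [hL]
    refine Set.infinite_of_injective_forall_mem (f := fun k : ℕ => i + n / 2 * k) ?_ ?_
    · intro k k' hk
      have : 0 < n / 2 := i.pos
      simpa [this.ne'] using hk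
    · intro k
      show (i + n / 2 * k) % (n / 2) = i
      rw [Nat.add_mul_mod_self_left, Nat.mod_eq_of_lt i.2]
  have h1 : ∀ j, packetDelay Δ κ₁ κ₂ pl ω i j ≤ 1 := by
    intro j
    have h2 := Nat.nth_mem_of_infinite hinf j
    have h3 := indexedDelay_count (A := Arrives Δ κ₁ κ₂ pl ω i) h2
    rw [Nat.count_nth_of_infinite hinf] at h3
    rw [packetDelay_eq, h3, hA]
    refine (iInf₂_le _ rfl).trans ?_
    simp
  refine limsup_le_of_le (by isBoundedDefault) (Eventually.of_forall fun k => ?_)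
  refine ENNReal.div_le_of_le_mul ?_
  calc _ ≤ ∑ _j ∈ Finset.range k, (1 : ℝ≥0∞) := Finset.sum_le_sum fun j _ => h1 j
    _ = _ := by simp

lemma pairDelay_le (hpl : pl.Valid)
    (hnm : n = m ^ 2) (hΔ : 0 < Δ) (hm : 4 * (2 + Δ) < m) (hκ : 0 < κ₁)
    (hc : c.Typical Δ κ₁ κ₂) (i : Fin (n / 2))
    (q : (Fin n → ZMod m) × (ℕ → Fin n → NodeCoins n)) {a : ℝ} (ha : 0 < a)
    (h : ∀ᶠ S : ℕ in atTop,
      a * S ≤ (Sites.tally ((sitesOf m Δ pl c).Sends (c.src i)) q.1 q.2 S : ℝ)) :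
    pairDelay Δ κ₁ κ₂ pl ((c, q) : Outcome n m) i ≤ ENNReal.ofReal (1 / a) *
      limsup (fun S => orbitMean (orbitShift move)
        ((sitesOf m Δ pl c).load (c.src i) (c.dst i)) S q) atTop := by
  classical
  have hd := sitesOf_describes (m := m) hpl hnm hΔ hm hκ hc i q
  rw [pairDelay_of_typical (show ((c, q) : Outcome n m).1.Typical Δ κ₁ κ₂ from hc)]
  refine (limsup_indexedDelay_le ha ?_).trans ?_
  · filter_upwards [h] with S hS
    refine hS.trans ?_
    exact_mod_cast hd.tally_sends_le S
  · gcongr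
    refine limsup_le_limsup (Eventually.of_forall fun S => ?_)
    exact ENNReal.div_le_div_right (hd.sum_delay_le S) _

open Classical in
lemma le_pairDelay (hpl : pl.Valid)
    (hnm : n = m ^ 2) (hΔ : 0 < Δ) (hm : 4 * (2 + Δ) < m) (hκ : 0 < κ₁)
    (hc : c.Typical Δ κ₁ κ₂) (i : Fin (n / 2))
    (q : (Fin n → ZMod m) × (ℕ → Fin n → NodeCoins n)) (T : ℕ) :
    limsup (fun S => orbitMean (orbitShift move) (fun q =>
      if (sitesOf m Δ pl c).Late (c.src i) (c.dst i) T q then (T : ℝ≥0∞) else 0) S q) atTop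
      ≤ pairDelay Δ κ₁ κ₂ pl ((c, q) : Outcome n m) i := by
  have hd := sitesOf_describes (m := m) hpl hnm hΔ hm hκ hc i q
  rw [pairDelay_of_typical (show ((c, q) : Outcome n m).1.Typical Δ κ₁ κ₂ from hc)]
  exact le_limsup_indexedDelay (b := fun s => (sitesOf m Δ pl c).Late (c.src i) (c.dst i) T
    ((orbitShift move)^[s] q)) (fun s hs => (hd.late hs).1) (fun s hs => (hd.late hs).2)

end Typical

/-! ### The law of the configuration -/

instance poleLawIsProbabilityMeasure : IsProbabilityMeasure poleLaw := by
  refine ⟨?_⟩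
  have h0 : (volume : Measure E3).toSphere Set.univ ≠ 0 := by
    rw [Measure.toSphere_apply_univ]
    simp [Real.pi_pos]
  rw [poleLaw, Measure.smul_apply, smul_eq_mul, ENNReal.inv_mul_cancel h0 (measure_ne_top _ _)]

instance configLawIsProbabilityMeasure (n : ℕ) : IsProbabilityMeasure (configLaw n) := by
  unfold configLaw; infer_instance

lemma law_eq (n m : ℕ) [NeZero m] (p α : I) :
    law n m p α = (configLaw n).prod (pathLaw n m p α) := rfl

/-- The function has a measurable minorant with the same integral, and Tonelli's theorem applies to
the minorant. The upper bound therefore does not need measurability of the delay. -/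
lemma lintegral_prod_le_of_forall {X Y : Type*} [MeasurableSpace X] [MeasurableSpace Y]
    {μ : Measure X} [IsProbabilityMeasure μ] {ν : Measure Y} [IsProbabilityMeasure ν]
    (f : X × Y → ℝ≥0∞) {K : ℝ≥0∞} (h : ∀ x, ∫⁻ y, f (x, y) ∂ν ≤ K) :
    ∫⁻ q, f q ∂(μ.prod ν) ≤ K := by
  obtain ⟨g, hg, hgf, he⟩ := exists_measurable_le_lintegral_eq (μ.prod ν) f
  rw [he, lintegral_prod _ hg.aemeasurable]
  calc _ ≤ ∫⁻ _, K ∂μ := lintegral_mono fun x => (lintegral_mono fun y => hgf (x, y)).trans (h x)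
    _ = K := by simp

/-! ### Upper bound -/

section Upper

variable {n m : ℕ} [NeZero m] {Δ κ₁ κ₂ : ℝ} {pl : Placement n}

lemma two_div_mul_card_le (n : ℕ) (K : ℝ≥0∞) :
    2 / (n : ℝ≥0∞) * ∑ _i : Fin (n / 2), K ≤ K := by
  rw [Finset.sum_const, Finset.card_univ, Fintype.card_fin, nsmul_eq_mul]
  rcases Nat.eq_zero_or_pos n with rfl | hn
  · simp
  have h1 : 2 * ((n / 2 : ℕ) : ℝ≥0∞) ≤ n := by exact_mod_cast Nat.mul_div_le n 2
  have hn0 : (n : ℝ≥0∞) ≠ 0 := by exact_mod_cast hn.ne'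
  calc 2 / (n : ℝ≥0∞) * (((n / 2 : ℕ) : ℝ≥0∞) * K)
      = 2 * ((n / 2 : ℕ) : ℝ≥0∞) * (n : ℝ≥0∞)⁻¹ * K := by rw [div_eq_mul_inv]; ring
    _ ≤ n * (n : ℝ≥0∞)⁻¹ * K := by gcongr
    _ = K := by rw [ENNReal.mul_inv_cancel hn0 (ENNReal.natCast_ne_top n), one_mul]

lemma averageDelay_le_of_not_typical {ω : Outcome n m} (h : ¬ ω.1.Typical Δ κ₁ κ₂) :
    averageDelay Δ κ₁ κ₂ pl ω ≤ 1 := by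
  refine le_trans ?_ (two_div_mul_card_le n 1)
  unfold averageDelay
  gcongr with i
  exact pairDelay_le_of_not_typical h i

lemma lintegral_averageDelay_le (hpl : pl.Valid) {c : Config n} (hnm : n = m ^ 2) (hΔ : 0 < Δ)
    (hm : 4 * (4 * (2 + Δ) + 1) ≤ m) (hn : 72 ≤ Real.log n) (hκ : 0 < κ₁)
    (hc : c.Typical Δ κ₁ κ₂) (p α : I) (hp0 : 0 < p) (hp1 : p < 1) (hα0 : 0 < α)
    (hα : (α : ℝ) ≤ Sites.alphaBound p (4 * (2 + Δ) + 1) κ₂) :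
    ∫⁻ q, averageDelay Δ κ₁ κ₂ pl ((c, q) : Outcome n m) ∂(pathLaw n m p α)
      ≤ ENNReal.ofReal
          (1 / (p * α * (1 - p) * Real.exp (-(4 * (4 * (2 + Δ) + 1) * κ₂)) / 128)) *
        (1 + ENNReal.ofReal (1000000 / (p * (1 - p) * Real.exp (-(4 * (4 * (2 + Δ) + 1) * κ₂))) *
          (n * Real.log n))) := by
  have hm' : 4 * (2 + Δ) < m := by linarith
  have hN := sitesOf_good (m := m) hpl hnm hΔ hm' hκ hc
  have hp0' : (0 : ℝ) < p := hp0
  have hp1' : (p : ℝ) < 1 := hp1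
  have hα0' : (0 : ℝ) < α := hα0
  set a : ℝ := p * α * (1 - p) * Real.exp (-(4 * (4 * (2 + Δ) + 1) * κ₂)) / 128 with ha
  have ha0 : 0 < a := by
    have : 0 < 1 - (p : ℝ) := by linarith
    have := Real.exp_pos (-(4 * (4 * (2 + Δ) + 1) * κ₂))
    positivity
  set N := sitesOf m Δ pl c with hNd
  set g : Fin (n / 2) → ((Fin n → ZMod m) × (ℕ → Fin n → NodeCoins n)) → ℝ≥0∞ := fun i q =>
    limsup (fun S => orbitMean (orbitShift move) (N.load (c.src i) (c.dst i)) S q) atTop with hg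
  have hmp := measurePreserving_orbitShift_move (n := n) (m := m) p α
  have hgm : ∀ i, Measurable (g i) := fun i =>
    measurable_limsup_orbitMean hmp.measurable (N.measurable_load _ _)
  have hae : ∀ᵐ q ∂(pathLaw n m p α), ∀ i, pairDelay Δ κ₁ κ₂ pl ((c, q) : Outcome n m) i
      ≤ ENNReal.ofReal (1 / a) * g i q := by
    rw [ae_all_iff]
    intro i
    filter_upwards [N.ae_eventually_tally_sends_path hN hm hnm hn p α hp0 hp1 hα0 (c.src i)]
      with q hq
    exact pairDelay_le hpl hnm hΔ hm' hκ hc i q ha0 hq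
  calc _ ≤ ∫⁻ q, 2 / (n : ℝ≥0∞) * ∑ i, ENNReal.ofReal (1 / a) * g i q ∂(pathLaw n m p α) := by
        refine lintegral_mono_ae ?_
        filter_upwards [hae] with q hq
        unfold averageDelay
        gcongr with i
        exact hq i
    _ = 2 / (n : ℝ≥0∞) * ∑ i, ENNReal.ofReal (1 / a) * ∫⁻ q, g i q ∂(pathLaw n m p α) := by
        rw [lintegral_const_mul _ (Finset.measurable_sum _ fun i _ => (hgm i).const_mul _),
          lintegral_finsetSum _ fun i _ => (hgm i).const_mul _]
        simp only [lintegral_const_mul _ (hgm _)]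
    _ ≤ 2 / (n : ℝ≥0∞) * ∑ _i : Fin (n / 2), ENNReal.ofReal (1 / a) * (1 + ENNReal.ofReal
          (1000000 / (p * (1 - p) * Real.exp (-(4 * (4 * (2 + Δ) + 1) * κ₂))) *
          (n * Real.log n))) := by
        gcongr with i
        exact (lintegral_limsup_orbitMean_le hmp (N.measurable_load _ _)).trans
          (N.lintegral_load_le hN hm hnm hn p α hp0 hp1 hα _ _)
    _ ≤ _ := two_div_mul_card_le n _

lemma schemeDelay_le (hpl : pl.Valid) (hnm : n = m ^ 2) (hΔ : 0 < Δ)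
    (hm : 4 * (4 * (2 + Δ) + 1) ≤ m) (hn : 72 ≤ Real.log n) (hκ : 0 < κ₁)
    (p α : I) (hp0 : 0 < p) (hp1 : p < 1) (hα0 : 0 < α)
    (hα : (α : ℝ) ≤ Sites.alphaBound p (4 * (2 + Δ) + 1) κ₂) :
    schemeDelay n m Δ κ₁ κ₂ p α pl ≤ ENNReal.ofReal
      ((1 + 1 / (p * α * (1 - p) * Real.exp (-(4 * (4 * (2 + Δ) + 1) * κ₂)) / 128) *
        (1 + 1000000 / (p * (1 - p) * Real.exp (-(4 * (4 * (2 + Δ) + 1) * κ₂))))) *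
        (n * Real.log n)) := by
  have hp0' : (0 : ℝ) < p := hp0
  have hp1' : (p : ℝ) < 1 := hp1
  have hα0' : (0 : ℝ) < α := hα0
  have hp2 : 0 < 1 - (p : ℝ) := by linarith
  have hE := Real.exp_pos (-(4 * (4 * (2 + Δ) + 1) * κ₂))
  set b : ℝ := 1 / (p * α * (1 - p) * Real.exp (-(4 * (4 * (2 + Δ) + 1) * κ₂)) / 128) with hb
  set K : ℝ := 1000000 / (p * (1 - p) * Real.exp (-(4 * (4 * (2 + Δ) + 1) * κ₂))) with hK
  have hb0 : 0 < b := by positivity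
  have hK0 : 0 < K := by positivity
  have hn1 : 1 ≤ n * Real.log n := by
    have : (1 : ℝ) ≤ n := by
      rcases Nat.eq_zero_or_pos n with h | h
      · subst h; norm_num at hn
      · exact_mod_cast h
    nlinarith
  set X : ℝ := n * Real.log n with hX
  rw [schemeDelay, law_eq]
  refine lintegral_prod_le_of_forall _ fun c => ?_
  by_cases hc : c.Typical Δ κ₁ κ₂
  · refine (lintegral_averageDelay_le hpl hnm hΔ hm hn hκ hc p α hp0 hp1 hα0 hα).trans ?_
    rw [← ENNReal.ofReal_one, ← ENNReal.ofReal_add zero_le_one (by positivity),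
      ← ENNReal.ofReal_mul hb0.le]
    apply ENNReal.ofReal_le_ofReal
    have h1 : b * (1 + K * X) ≤ b * ((1 + K) * X) := by
      gcongr; linarith
    calc b * (1 + K * X) ≤ b * ((1 + K) * X) := h1
      _ ≤ (1 + b * (1 + K)) * X := by nlinarith
  · calc _ ≤ ∫⁻ _, 1 ∂(pathLaw n m p α) := lintegral_mono fun q =>
        averageDelay_le_of_not_typical (ω := ((c, q) : Outcome n m)) hc
      _ = ENNReal.ofReal 1 := by simp
      _ ≤ _ := by
        apply ENNReal.ofReal_le_ofReal
        have : 0 ≤ b * (1 + K) := by positivity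
        nlinarith

end Upper

/-! ### Spherical belts -/

section Belt

open scoped Pointwise

lemma exists_orthonormalBasis_zero {z : E3} (hz : ‖z‖ = 1) :
    ∃ b : OrthonormalBasis (Fin 3) ℝ E3, b 0 = z := by
  have hv : Orthonormal ℝ (({0} : Set (Fin 3)).domRestrict fun _ => z) := by
    refine ⟨fun _ => hz, fun a b hab => ?_⟩
    exact (hab (Subtype.ext (a.2.trans b.2.symm))).elim
  obtain ⟨b, hb⟩ := hv.exists_orthonormalBasis_extension_of_card_eq (by simp)
  exact ⟨b, hb 0 rfl⟩

/-- Splitting off the first coordinate. -/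
def splitFirst (x : E3) : ℝ × EuclideanSpace ℝ (Fin 2) :=
  (x 0, WithLp.toLp 2 fun k => x k.succ)

lemma measurePreserving_splitFirst : MeasurePreserving splitFirst volume volume := by
  have h1 := PiLp.volume_preserving_ofLp (Fin 3)
  have h2 := volume_preserving_piFinSuccAbove (fun _ : Fin 3 => ℝ) 0
  have h3 := (MeasurePreserving.id (volume : Measure ℝ)).prod (PiLp.volume_preserving_toLp (Fin 2))
  exact h3.comp (h2.comp h1)

lemma norm_sq_splitFirst (x : E3) : ‖x‖ ^ 2 = (splitFirst x).1 ^ 2 + ‖(splitFirst x).2‖ ^ 2 := by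
  rw [EuclideanSpace.real_norm_sq_eq, EuclideanSpace.real_norm_sq_eq, Fin.sum_univ_succ]
  rfl

/-- The cone over a spherical belt, split. -/
def cone (h : ℝ) : Set (ℝ × EuclideanSpace ℝ (Fin 2)) :=
  {y | 0 < y.1 ^ 2 + ‖y.2‖ ^ 2 ∧ y.1 ^ 2 + ‖y.2‖ ^ 2 < 1 ∧
    y.1 ^ 2 ≤ h ^ 2 * (y.1 ^ 2 + ‖y.2‖ ^ 2)}

lemma measurableSet_cone (h : ℝ) : MeasurableSet (cone h) := by
  have h1 : Measurable fun y : ℝ × EuclideanSpace ℝ (Fin 2) => y.1 ^ 2 + ‖y.2‖ ^ 2 := by fun_prop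
  exact (measurableSet_lt measurable_const h1).inter ((measurableSet_lt h1 measurable_const).inter
    (measurableSet_le (measurable_fst.pow_const 2) (h1.const_mul _)))

/-- The slice is an annulus, of area `π (1 - a²) - π a² (1 - h²) / h²`. Away from `a = 0` the
exclusion of the origin is automatic. -/
lemma volume_cone_slice {h : ℝ} (h0 : 0 < h) (h1 : h ≤ 1) {a : ℝ} (ha : a ≠ 0) :
    volume (Prod.mk a ⁻¹' cone h)
      = (Set.Icc (-h) h).indicator (fun a => ENNReal.ofReal (Real.pi * (1 - a ^ 2 / h ^ 2))) a := by
  have ha2 : 0 < a ^ 2 := by positivity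
  have hh2 : 0 < h ^ 2 := by positivity
  by_cases hah : a ∈ Set.Icc (-h) h
  · rw [Set.indicator_of_mem hah]
    have hle : a ^ 2 ≤ h ^ 2 := sq_le_sq' hah.1 hah.2
    have hh1 : h ^ 2 ≤ 1 := pow_le_one₀ h0.le h1
    set r₁ := √(a ^ 2 * (1 - h ^ 2) / h ^ 2) with hr₁
    set r₂ := √(1 - a ^ 2) with hr₂
    have e1 : r₁ ^ 2 = a ^ 2 * (1 - h ^ 2) / h ^ 2 :=
      Real.sq_sqrt (div_nonneg (mul_nonneg ha2.le (by linarith)) hh2.le)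
    have e2 : r₂ ^ 2 = 1 - a ^ 2 := Real.sq_sqrt (by linarith)
    have hr : r₁ ≤ r₂ := by
      apply Real.sqrt_le_sqrt
      rw [div_le_iff₀ hh2]
      nlinarith
    have hset : Prod.mk a ⁻¹' cone h
        = Metric.ball (0 : EuclideanSpace ℝ (Fin 2)) r₂ \ Metric.ball 0 r₁ := by
      ext w
      have hw := norm_nonneg w
      simp only [cone, Set.mem_preimage, Set.mem_ofPred_eq, Set.mem_sdiff, Metric.mem_ball,
        dist_zero_right, not_lt]
      have k1 : ‖w‖ < r₂ ↔ a ^ 2 + ‖w‖ ^ 2 < 1 := by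
        rw [← sq_lt_sq₀ hw (Real.sqrt_nonneg _), e2]
        constructor <;> intro <;> linarith
      have k2 : r₁ ≤ ‖w‖ ↔ a ^ 2 ≤ h ^ 2 * (a ^ 2 + ‖w‖ ^ 2) := by
        rw [← sq_le_sq₀ (Real.sqrt_nonneg _) hw, e1, div_le_iff₀ hh2]
        constructor <;> intro <;> nlinarith
      rw [k1, k2]
      exact ⟨fun h => h.2, fun h => ⟨by positivity, h⟩⟩
    rw [hset, measure_sdiff (Metric.ball_subset_ball hr) measurableSet_ball.nullMeasurableSet
      (measure_ball_lt_top).ne, EuclideanSpace.volume_ball_fin_two,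
      EuclideanSpace.volume_ball_fin_two, ← ENNReal.ofReal_pow (Real.sqrt_nonneg _),
      ← ENNReal.ofReal_pow (Real.sqrt_nonneg _), e1, e2, ← ENNReal.ofReal_mul (by linarith),
      ← ENNReal.ofReal_mul (by rw [← e1]; positivity), ← ENNReal.ofReal_sub]
    · congr 1; field_simp; ring
    · have := Real.pi_pos
      rw [← e1]; positivity
  · rw [Set.indicator_of_notMem hah]
    have hlt : h ^ 2 < a ^ 2 := by
      rw [Set.mem_Icc, not_and_or] at hah
      rcases hah with h' | h' <;> nlinarith
    have : Prod.mk a ⁻¹' cone h = ∅ := by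
      ext w
      simp only [cone, Set.mem_preimage, Set.mem_ofPred_eq, Set.mem_empty_iff_false, iff_false]
      rintro ⟨k1, k2, k3⟩
      nlinarith
    rw [this, measure_empty]

lemma volume_cone {h : ℝ} (h0 : 0 < h) (h1 : h ≤ 1) :
    volume (cone h) = ENNReal.ofReal (h * (Real.pi * 4 / 3)) := by
  rw [Measure.volume_eq_prod, Measure.prod_apply (measurableSet_cone h)]
  have hae : ∀ᵐ a : ℝ, a ≠ 0 := by
    rw [ae_iff]; simp
  rw [lintegral_congr_ae (hae.mono fun a ha => volume_cone_slice h0 h1 ha),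
    lintegral_indicator measurableSet_Icc, ← ofReal_integral_eq_lintegral_ofReal]
  · congr 1
    rw [integral_Icc_eq_integral_Ioc, ← intervalIntegral.integral_of_le (by linarith)]
    rw [intervalIntegral.integral_const_mul, intervalIntegral.integral_sub (by simp)
      (Continuous.intervalIntegrable (by fun_prop) _ _), intervalIntegral.integral_div, integral_pow]
    simp
    field_simp
    ring
  · exact Continuous.integrableOn_Icc (by fun_prop)
  · refine (ae_restrict_mem measurableSet_Icc).mono fun a ha => ?_
    have : a ^ 2 / h ^ 2 ≤ 1 := by
      rw [div_le_one (by positivity)]; exact sq_le_sq' ha.1 ha.2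
    exact mul_nonneg Real.pi_pos.le (by linarith)

lemma measurableSet_belt (z : E3) (h : ℝ) :
    MeasurableSet {u : Dir | |inner ℝ (u : E3) z| ≤ h} := by
  apply measurableSet_le _ measurable_const
  fun_prop

/-- The part of the sphere at height at most `h` from a great circle is proportional to `h`. -/
theorem poleLaw_belt {z : E3} (hz : ‖z‖ = 1) {h : ℝ} (h0 : 0 < h) (h1 : h ≤ 1) :
    poleLaw {u : Dir | |inner ℝ (u : E3) z| ≤ h} = ENNReal.ofReal h := by
  obtain ⟨b, hb⟩ := exists_orthonormalBasis_zero hz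
  -- Surface measure is three times the volume of the cone over a set; an isometry that takes `z` to
  -- the first axis brings this cone to the standard form.
  have hpre : Set.Ioo (0 : ℝ) 1 • ((↑) '' {u : Dir | |inner ℝ (u : E3) z| ≤ h} : Set E3)
      = (splitFirst ∘ b.repr) ⁻¹' cone h := by
    ext x
    have hx0 : (splitFirst (b.repr x)).1 = inner ℝ x z := by
      show b.repr x 0 = _
      rw [b.repr_apply_apply, hb, real_inner_comm]
    have hxn := norm_sq_splitFirst (b.repr x)
    rw [LinearIsometryEquiv.norm_map] at hxn
    rw [Set.mem_preimage, Function.comp_apply, cone, Set.mem_ofPred_eq, ← hxn, hx0]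
    constructor
    · rintro ⟨t, ht, _, ⟨u, hu, rfl⟩, rfl⟩
      have hu' : |inner ℝ (u : E3) z| ≤ h := hu
      have hun : ‖(u : E3)‖ = 1 := by simp
      have ht0 := ht.1
      have ht1 := ht.2
      simp only [norm_smul, hun, Real.norm_eq_abs, mul_one, sq_abs, real_inner_smul_left]
      refine ⟨by positivity, by nlinarith, ?_⟩
      have : inner ℝ (u : E3) z ^ 2 ≤ h ^ 2 := by
        rw [← sq_abs]; exact pow_le_pow_left₀ (abs_nonneg _) hu' 2
      rw [mul_pow, mul_comm]
      gcongr
    · rintro ⟨k1, k2, k3⟩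
      have hxpos : 0 < ‖x‖ := by
        rcases (norm_nonneg x).eq_or_lt with h | h
        · rw [← h] at k1; norm_num at k1
        · exact h
      have hx1 : ‖x‖ < 1 := by nlinarith
      refine ⟨‖x‖, ⟨hxpos, hx1⟩, ‖x‖⁻¹ • x, ⟨⟨‖x‖⁻¹ • x, ?_⟩, ?_, rfl⟩, ?_⟩
      · simp [norm_smul, hxpos.ne']
      · show |inner ℝ (‖x‖⁻¹ • x) z| ≤ h
        rw [real_inner_smul_left, abs_mul, abs_of_pos (inv_pos.2 hxpos), inv_mul_le_iff₀ hxpos]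
        apply abs_le_of_sq_le_sq _ (by positivity)
        rw [mul_pow, mul_comm]; exact k3
      · simp only
        rw [smul_smul, mul_inv_cancel₀ hxpos.ne', one_smul]
  have hmp : MeasurePreserving (splitFirst ∘ b.repr) volume volume :=
    measurePreserving_splitFirst.comp b.measurePreserving_repr
  rw [poleLaw, Measure.smul_apply, smul_eq_mul, Measure.toSphere_apply_univ,
    Measure.toSphere_apply' _ (measurableSet_belt z h), hpre,
    hmp.measure_preimage (measurableSet_cone h).nullMeasurableSet, volume_cone h0 h1,
    EuclideanSpace.volume_ball_fin_three, ENNReal.ofReal_mul h0.le]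
  have hpos : ENNReal.ofReal (Real.pi * 4 / 3) ≠ 0 := by
    have := Real.pi_pos
    simp [this]
  simp only [finrank_euclideanSpace, Fintype.card_fin, ENNReal.ofReal_one, one_pow, one_mul]
  set A := ENNReal.ofReal (Real.pi * 4 / 3) with hA
  have h3 : ((3 : ℕ) : ℝ≥0∞) * A ≠ 0 := by simp [hpos]
  have h3' : ((3 : ℕ) : ℝ≥0∞) * A ≠ ⊤ :=
    ENNReal.mul_ne_top (ENNReal.natCast_ne_top 3) ENNReal.ofReal_ne_top
  calc (((3 : ℕ) : ℝ≥0∞) * A)⁻¹ * (((3 : ℕ) : ℝ≥0∞) * (ENNReal.ofReal h * A))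
      = ((((3 : ℕ) : ℝ≥0∞) * A)⁻¹ * (((3 : ℕ) : ℝ≥0∞) * A)) * ENNReal.ofReal h := by ring
    _ = _ := by rw [ENNReal.inv_mul_cancel h3 h3', one_mul]

/-- Great circles are null sets. -/
lemma poleLaw_orthogonal {z : E3} (hz : ‖z‖ = 1) :
    poleLaw {u : Dir | inner ℝ (u : E3) z = 0} = 0 := by
  have h1 : ∀ k : ℕ, poleLaw {u : Dir | inner ℝ (u : E3) z = 0} ≤ ENNReal.ofReal (1 / (k + 1)) := by
    intro k
    have h2 : (0 : ℝ) < 1 / ((k : ℝ) + 1) := by positivity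
    rw [← poleLaw_belt hz h2 (by rw [div_le_one (by positivity)]; linarith [k.cast_nonneg (α := ℝ)])]
    refine measure_mono fun u hu => ?_
    have hu' : inner ℝ (u : E3) z = 0 := hu
    show |inner ℝ (u : E3) z| ≤ _
    rw [hu', abs_zero]; exact h2.le
  refine le_antisymm ?_ zero_le
  have h3 : Tendsto (fun k : ℕ => ENNReal.ofReal (1 / ((k : ℝ) + 1))) atTop (nhds 0) := by
    rw [← ENNReal.ofReal_zero]
    exact ENNReal.tendsto_ofReal tendsto_one_div_add_atTop_nhds_zero_nat
  exact ge_of_tendsto' h3 h1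

end Belt

/-! ### Great circles through a disk -/

section Disk

open InnerProductGeometry

/-- The point of the circle nearest to `z` is the normalized projection of `z` to the plane of the
circle. Conversely, Bessel's inequality for a point of the circle and the pole bounds the height of
`z`. -/
lemma exists_onGreatCircle_angle_le_iff (u : Dir) {z : E3} (hz : ‖z‖ = 1) {φ : ℝ} (h0 : 0 ≤ φ)
    (h1 : φ < Real.pi / 2) :
    (∃ x, OnGreatCircle u x ∧ angle x z ≤ φ) ↔ |inner ℝ (u : E3) z| ≤ Real.sin φ := by
  have hπ := Real.pi_pos
  have hu : ‖(u : E3)‖ = 1 := by simp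
  have hsin : 0 ≤ Real.sin φ := Real.sin_nonneg_of_nonneg_of_le_pi h0 (by linarith)
  have hcos : 0 < Real.cos φ := Real.cos_pos_of_mem_Ioo ⟨by linarith, h1⟩
  have hsc := Real.sin_sq_add_cos_sq φ
  set s := inner ℝ (u : E3) z with hs
  have hs' : inner ℝ z (u : E3) = s := real_inner_comm _ _
  have huu : inner ℝ (u : E3) (u : E3) = (1 : ℝ) := by rw [real_inner_self_eq_norm_sq, hu]; norm_num
  have hzz : inner ℝ z z = (1 : ℝ) := by rw [real_inner_self_eq_norm_sq, hz]; norm_num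
  constructor
  · rintro ⟨x, ⟨hx, hxu⟩, hxz⟩
    have hxx : inner ℝ x x = (1 : ℝ) := by rw [real_inner_self_eq_norm_sq, hx]; norm_num
    have hux : inner ℝ (u : E3) x = 0 := by rw [real_inner_comm]; exact hxu
    have h2 : Real.cos φ ≤ inner ℝ x z := by
      rw [inner_eq_cos_angle_of_norm_eq_one hx hz]
      exact Real.cos_le_cos_of_nonneg_of_le_pi (angle_nonneg _ _) (by linarith) hxz
    set a := inner ℝ x z with ha
    have hzx : inner ℝ z x = a := real_inner_comm _ _
    have h3 : 0 ≤ inner ℝ (z - a • x - s • (u : E3)) (z - a • x - s • (u : E3)) :=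
      real_inner_self_nonneg
    simp only [inner_sub_left, inner_sub_right, real_inner_smul_left, real_inner_smul_right,
      hs', huu, hzz, hxx, hux, hxu, hzx, ← ha, ← hs] at h3
    apply abs_le_of_sq_le_sq _ hsin
    nlinarith
  · intro h
    have hs2 : s ^ 2 ≤ Real.sin φ ^ 2 := by
      rw [← sq_abs]; exact pow_le_pow_left₀ (abs_nonneg _) h 2
    set w := z - s • (u : E3) with hw
    have hww : ‖w‖ ^ 2 = 1 - s ^ 2 := by
      rw [← real_inner_self_eq_norm_sq]
      simp only [hw, inner_sub_left, inner_sub_right, real_inner_smul_left, real_inner_smul_right,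
        hs', huu, hzz, ← hs]
      ring
    have hwpos : 0 < ‖w‖ := by
      rcases (norm_nonneg w).eq_or_lt with h | h
      · rw [← h] at hww; nlinarith
      · exact h
    have hxn : ‖‖w‖⁻¹ • w‖ = 1 := by rw [norm_smul, norm_inv, norm_norm, inv_mul_cancel₀ hwpos.ne']
    refine ⟨‖w‖⁻¹ • w, ⟨hxn, ?_⟩, ?_⟩
    · rw [real_inner_smul_left, hw, inner_sub_left, real_inner_smul_left, huu, hs']
      ring
    · have h4 : inner ℝ (‖w‖⁻¹ • w) z = ‖w‖ := by
        rw [real_inner_smul_left]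
        have : inner ℝ w z = ‖w‖ ^ 2 := by
          rw [hww, hw, inner_sub_left, real_inner_smul_left, hzz, ← hs]; ring
        rw [this]; field_simp
      rw [angle, hxn, hz, h4, mul_one, div_one]
      have h5 : Real.cos φ ≤ ‖w‖ := by
        apply le_of_sq_le_sq _ hwpos.le
        nlinarith
      calc Real.arccos ‖w‖ ≤ Real.arccos (Real.cos φ) := Real.arccos_le_arccos h5
        _ = φ := Real.arccos_cos h0 (by linarith)

end Disk

/-! ### Deviations -/

section Chernoff

/-- A vector of the direction of the intersection of the great circles with poles `u`, `v`. -/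
def crossOf (u v : Dir) : E3 := WithLp.toLp 2 (crossProduct (u : E3).ofLp (v : E3).ofLp)

lemma measurable_crossOf : Measurable fun q : Dir × Dir => crossOf q.1 q.2 := by
  refine (MeasurableEquiv.toLp 2 (Fin 3 → ℝ)).measurable.comp (measurable_pi_iff.2 fun k => ?_)
  have h1 : ∀ j, Measurable fun q : Dir × Dir => (q.1 : E3).ofLp j := fun j => by fun_prop
  have h2 : ∀ j, Measurable fun q : Dir × Dir => (q.2 : E3).ofLp j := fun j => by fun_prop
  fin_cases k
  · simp only [cross_apply]
    exact ((h1 1).mul (h2 2)).sub ((h1 2).mul (h2 1))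
  · simp only [cross_apply]
    exact ((h1 2).mul (h2 0)).sub ((h1 0).mul (h2 2))
  · simp only [cross_apply]
    exact ((h1 0).mul (h2 1)).sub ((h1 1).mul (h2 0))

/-- Let `b 1` be a unit vector orthogonal to `u`. If `u × v = 0`, the Lagrange identity for `(u × v)
· (u × b 1)` forces `v` to be orthogonal to `b 1`, so `v` lies on a fixed great circle. -/
lemma poleLaw_crossOf_eq_zero (u : Dir) : poleLaw {v | crossOf u v = 0} = 0 := by
  have hu : ‖(u : E3)‖ = 1 := by simp
  obtain ⟨b, hb⟩ := exists_orthonormalBasis_zero hu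
  refine measure_mono_null (fun v hv => ?_) (poleLaw_orthogonal (z := b 1) (b.orthonormal.1 1))
  have hv' : crossProduct (u : E3).ofLp (v : E3).ofLp = 0 := by
    have : crossOf u v = 0 := hv
    exact congrArg WithLp.ofLp this
  have h1 := cross_dot_cross (u : E3).ofLp (v : E3).ofLp (u : E3).ofLp (b 1).ofLp
  rw [hv', zero_dotProduct] at h1
  have hdot : ∀ x y : E3, x.ofLp ⬝ᵥ y.ofLp = inner ℝ x y := by
    intro x y
    rw [EuclideanSpace.inner_eq_star_dotProduct, dotProduct_comm]
    simp
  have h2 : inner ℝ (u : E3) (b 1) = 0 := by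
    have : inner ℝ (b 0) (b 1) = 0 := b.orthonormal.2 (show (0 : Fin 3) ≠ 1 by decide)
    rwa [hb] at this
  simp only [hdot] at h1
  rw [h2, real_inner_self_eq_norm_sq, hu] at h1
  show inner ℝ (v : E3) (b 1) = 0
  linarith

variable {n : ℕ}

lemma measurable_crossOf_apply (a b : Fin n) :
    Measurable fun x : Fin n → Dir => crossOf (x a) (x b) := by
  have h := (measurable_pi_apply (X := fun _ : Fin n => Dir) a).prodMk
    (measurable_pi_apply (X := fun _ : Fin n => Dir) b)
  exact measurable_crossOf.comp h

/-- The great circle of `k` is at distance at most `h` from the intersection point of those of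
`a` and `b`. -/
def InBelt (h : ℝ) (x : Fin n → Dir) (a b k : Fin n) : Prop :=
  |inner ℝ (x k : E3) (‖crossOf (x a) (x b)‖⁻¹ • crossOf (x a) (x b))| ≤ h

lemma measurableSet_inBelt (h : ℝ) (a b k : Fin n) : MeasurableSet {x | InBelt h x a b k} := by
  have h1 := measurable_crossOf_apply a b
  have h2 : Measurable fun x : Fin n → Dir => (x k : E3) :=
    measurable_subtype_coe.comp (measurable_pi_apply k)
  have h3 : Measurable fun x : Fin n → Dir =>
      inner ℝ (x k : E3) (‖crossOf (x a) (x b)‖⁻¹ • crossOf (x a) (x b)) :=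
    h2.inner (h1.norm.inv.smul h1)
  exact measurableSet_le h3.abs measurable_const

lemma measurableSet_crossOf_ne (a b : Fin n) :
    MeasurableSet {x : Fin n → Dir | crossOf (x a) (x b) ≠ 0} := by
  have h1 := measurable_crossOf_apply a b
  exact (h1 (measurableSet_singleton 0)).compl

lemma lintegral_pi_eq_update {X : Type*} [MeasurableSpace X] (μ : Measure X)
    [IsProbabilityMeasure μ] (k : Fin n) {f : (Fin n → X) → ℝ≥0∞} (hf : Measurable f) :
    ∫⁻ x, f x ∂(Measure.pi fun _ => μ)
      = ∫⁻ x, ∫⁻ y, f (Function.update x k y) ∂μ ∂(Measure.pi fun _ => μ) := by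
  rcases isEmpty_or_nonempty (Fin n → X) with hE | ⟨⟨x₀⟩⟩
  · simp [Measure.eq_zero_of_isEmpty]
  have hg : Measurable fun x : Fin n → X => ∫⁻ y, f (Function.update x k y) ∂μ := by
    refine Measurable.lintegral_prod_right' (f := fun q : (Fin n → X) × X =>
      f (Function.update q.1 k q.2)) (hf.comp ?_)
    refine measurable_pi_iff.2 fun j => ?_
    by_cases hj : j = k
    · subst hj; simpa using measurable_snd
    · simp only [Function.update_of_ne hj]
      exact (measurable_pi_apply j).comp measurable_fst
  rw [lintegral_eq_lmarginal_univ x₀, lintegral_eq_lmarginal_univ x₀,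
    lmarginal_erase' _ hf (Finset.mem_univ k), lmarginal_erase' _ hg (Finset.mem_univ k)]
  simp

open Classical in
lemma lintegral_belt_exp_le {h : ℝ} (h0 : 0 < h) (h1 : h ≤ 1) (l : ℝ) {z : E3} (hz : ‖z‖ = 1) :
    ∫⁻ u : Dir, (if |inner ℝ (u : E3) z| ≤ h then ENNReal.ofReal (Real.exp l) else 1) ∂poleLaw
      ≤ ENNReal.ofReal (Real.exp (h * (Real.exp l - 1))) := by
  have hb := measurableSet_belt z h
  set A := {u : Dir | |inner ℝ (u : E3) z| ≤ h} with hA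
  have e : (fun u : Dir => if |inner ℝ (u : E3) z| ≤ h then ENNReal.ofReal (Real.exp l) else 1)
      = fun u => A.indicator (fun _ => ENNReal.ofReal (Real.exp l)) u + Aᶜ.indicator 1 u := by
    ext u
    by_cases hu : u ∈ A
    · have hu' : |inner ℝ (u : E3) z| ≤ h := hu
      simp [hu, hu']
    · have hu' : ¬ |inner ℝ (u : E3) z| ≤ h := hu
      simp [hu, hu']
  rw [e, lintegral_add_left (measurable_const.indicator hb), lintegral_indicator_const hb,
    lintegral_indicator_one hb.compl, prob_compl_eq_one_sub hb, poleLaw_belt hz h0 h1,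
    ← ENNReal.ofReal_mul (Real.exp_pos l).le, ← ENNReal.ofReal_one, ← ENNReal.ofReal_sub _ h0.le,
    ← ENNReal.ofReal_add (by positivity) (by linarith)]
  apply ENNReal.ofReal_le_ofReal
  have := Real.add_one_le_exp (h * (Real.exp l - 1))
  linarith

-- The circles of `s` are resampled one at a time. The intersection point does not move, since it
-- depends only on `a` and `b`, and each circle contributes the exponential moment of a Bernoulli
-- variable.
open Classical in
lemma lintegral_prod_belt_le {h : ℝ} (h0 : 0 < h) (h1 : h ≤ 1) (l : ℝ) (a b : Fin n)
    (s : Finset (Fin n)) (ha : a ∉ s) (hb : b ∉ s) :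
    ∫⁻ x : Fin n → Dir, (if crossOf (x a) (x b) ≠ 0 then
        ∏ k ∈ s, (if InBelt h x a b k then ENNReal.ofReal (Real.exp l) else 1) else 0)
        ∂(Measure.pi fun _ => poleLaw)
      ≤ ENNReal.ofReal (Real.exp (h * (Real.exp l - 1))) ^ s.card := by
  have hmeas : ∀ s : Finset (Fin n), Measurable fun x : Fin n → Dir =>
      (if crossOf (x a) (x b) ≠ 0 then
        ∏ k ∈ s, (if InBelt h x a b k then ENNReal.ofReal (Real.exp l) else 1) else 0) := fun s =>
    Measurable.ite (measurableSet_crossOf_ne a b) (Finset.measurable_prod _ fun k _ =>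
      Measurable.ite (measurableSet_inBelt h a b k) measurable_const measurable_const)
      measurable_const
  induction s using Finset.induction_on with
  | empty =>
    simp only [Finset.prod_empty, Finset.card_empty, pow_zero]
    calc _ ≤ ∫⁻ x : Fin n → Dir, 1 ∂(Measure.pi fun _ => poleLaw) :=
          lintegral_mono fun x => by split_ifs <;> simp
      _ = 1 := by simp
  | insert k s hk ih =>
    rw [Finset.mem_insert, not_or] at ha hb
    rw [lintegral_pi_eq_update poleLaw k (hmeas _), Finset.card_insert_of_notMem hk, pow_succ']
    have h2 : ∀ x : Fin n → Dir, ∫⁻ y, (if crossOf (Function.update x k y a)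
        (Function.update x k y b) ≠ 0 then ∏ j ∈ insert k s,
          (if InBelt h (Function.update x k y) a b j then ENNReal.ofReal (Real.exp l) else 1)
          else 0) ∂poleLaw
        ≤ ENNReal.ofReal (Real.exp (h * (Real.exp l - 1))) * (if crossOf (x a) (x b) ≠ 0 then
        ∏ k ∈ s, (if InBelt h x a b k then ENNReal.ofReal (Real.exp l) else 1) else 0) := by
      intro x
      simp only [Function.update_of_ne ha.1, Function.update_of_ne hb.1]
      by_cases hx : crossOf (x a) (x b) = 0
      · simp [hx]
      · simp only [ne_eq, hx, not_false_eq_true, if_true]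
        have hz : ‖‖crossOf (x a) (x b)‖⁻¹ • crossOf (x a) (x b)‖ = 1 := by
          rw [norm_smul, norm_inv, norm_norm, inv_mul_cancel₀ (norm_ne_zero_iff.2 hx)]
        have h3 : ∀ y, ∏ j ∈ insert k s, (if InBelt h (Function.update x k y) a b j then
            ENNReal.ofReal (Real.exp l) else 1)
            = (if |inner ℝ (y : E3) (‖crossOf (x a) (x b)‖⁻¹ • crossOf (x a) (x b))| ≤ h then
              ENNReal.ofReal (Real.exp l) else 1) *
              ∏ k ∈ s, (if InBelt h x a b k then ENNReal.ofReal (Real.exp l) else 1) := by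
          intro y
          rw [Finset.prod_insert hk]
          congr 1
          · simp only [InBelt, Function.update_of_ne ha.1, Function.update_of_ne hb.1,
              Function.update_self]
          · refine Finset.prod_congr rfl fun j hj => ?_
            have hjk : j ≠ k := fun h => hk (h ▸ hj)
            have e : InBelt h (Function.update x k y) a b j ↔ InBelt h x a b j := by
              simp only [InBelt, Function.update_of_ne ha.1, Function.update_of_ne hb.1,
                Function.update_of_ne hjk]
            simp only [e]
        simp only [h3]
        rw [lintegral_mul_const _ (Measurable.ite (measurableSet_belt _ h) measurable_const
          measurable_const)]
        gcongr
        exact lintegral_belt_exp_le h0 h1 l hz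
    refine (lintegral_mono h2).trans ?_
    rw [lintegral_const_mul _ (hmeas s)]
    gcongr
    exact ih ha.2 hb.2

open Classical in
/-- The number of great circles close to the intersection point of those of `a` and `b`. -/
def beltCount (h : ℝ) (x : Fin n → Dir) (a b : Fin n) : ℕ :=
  (Finset.univ.filter fun k => InBelt h x a b k).card

lemma measurable_beltCount (h : ℝ) (a b : Fin n) :
    Measurable fun x : Fin n → Dir => beltCount h x a b := by
  classical
  unfold beltCount
  simp only [Finset.card_filter]
  exact Finset.measurable_sum _ fun k _ =>
    Measurable.ite (measurableSet_inBelt h a b k) measurable_const measurable_const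

/-- Markov's inequality for an exponential moment, with `l` of either sign so that both tails are
covered. The circles of `a` and `b` are not independent of their intersection; leaving them out
changes the count by at most two, and `hP` allows for this. -/
lemma pi_beltCount_le {h : ℝ} (h0 : 0 < h) (h1 : h ≤ 1) (l y : ℝ) (a b : Fin n) (hab : a ≠ b)
    (P : ℕ → Prop) (hP : ∀ k k' : ℕ, k' ≤ k → k ≤ k' + 2 → P k → y ≤ l * k') :
    (Measure.pi fun _ => poleLaw) {x : Fin n → Dir | crossOf (x a) (x b) ≠ 0 ∧ P (beltCount h x a b)}
      ≤ ENNReal.ofReal (Real.exp (((n - 2 : ℕ) : ℝ) * (h * (Real.exp l - 1)) - y)) := by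
  classical
  set s := (Finset.univ.erase a).erase b with hs
  have hcard : s.card = n - 2 := by
    rw [hs, Finset.card_erase_of_mem (Finset.mem_erase.2 ⟨hab.symm, Finset.mem_univ b⟩),
      Finset.card_erase_of_mem (Finset.mem_univ a), Finset.card_univ, Fintype.card_fin]
    omega
  have h2 := lintegral_prod_belt_le h0 h1 l a b s (by simp [hs]) (by simp [hs])
  rw [hcard, ← ENNReal.ofReal_pow (Real.exp_pos _).le, ← Real.exp_nat_mul] at h2
  set f : (Fin n → Dir) → ℝ≥0∞ := fun x => (if crossOf (x a) (x b) ≠ 0 then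
        ∏ k ∈ s, (if InBelt h x a b k then ENNReal.ofReal (Real.exp l) else 1) else 0) with hf
  have h3 : {x : Fin n → Dir | crossOf (x a) (x b) ≠ 0 ∧ P (beltCount h x a b)}
      ⊆ {x | ENNReal.ofReal (Real.exp y) ≤ f x} := by
    rintro x ⟨hx, hPx⟩
    show ENNReal.ofReal (Real.exp y) ≤ f x
    simp only [hf]
    rw [if_pos hx, Finset.prod_ite, Finset.prod_const, Finset.prod_const_one, mul_one,
      ← ENNReal.ofReal_pow (Real.exp_pos _).le, ← Real.exp_nat_mul]
    apply ENNReal.ofReal_le_ofReal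
    apply Real.exp_le_exp.2
    rw [mul_comm]
    refine hP _ _ ?_ ?_ hPx
    · exact Finset.card_le_card (Finset.filter_subset_filter _ (Finset.subset_univ s))
    · have h4 : (Finset.univ.filter fun k => InBelt h x a b k)
          ⊆ (s.filter fun k => InBelt h x a b k) ∪ {a, b} := by
        intro k hk
        rw [Finset.mem_filter] at hk
        by_cases hka : k = a
        · simp [hka]
        by_cases hkb : k = b
        · simp [hkb]
        simp [hs, hka, hkb, hk.2]
      refine (Finset.card_le_card h4).trans ((Finset.card_union_le _ _).trans ?_)
      gcongr
      exact Finset.card_le_two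
  have hexp : ENNReal.ofReal (Real.exp y) ≠ 0 := by simp [Real.exp_pos]
  refine (measure_mono h3).trans ?_
  have hfm : Measurable f := Measurable.ite (measurableSet_crossOf_ne a b)
    (Finset.measurable_prod _ fun k _ => Measurable.ite (measurableSet_inBelt h a b k)
      measurable_const measurable_const) measurable_const
  refine (meas_ge_le_lintegral_div hfm.aemeasurable hexp ENNReal.ofReal_ne_top).trans ?_
  rw [Real.exp_sub, ENNReal.ofReal_div_of_pos (Real.exp_pos y)]
  exact ENNReal.div_le_div_right h2 _

lemma pi_crossOf_eq_zero (a b : Fin n) (hab : a ≠ b) :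
    (Measure.pi fun _ => poleLaw) {x : Fin n → Dir | crossOf (x a) (x b) = 0} = 0 := by
  have hm : MeasurableSet {x : Fin n → Dir | crossOf (x a) (x b) = 0} := by
    have := (measurableSet_crossOf_ne a b).compl
    convert this using 1
    ext x; simp
  rw [← lintegral_indicator_one hm,
    lintegral_pi_eq_update poleLaw b (measurable_one.indicator hm)]
  rw [lintegral_eq_zero_of_ae_eq_zero]
  refine Eventually.of_forall fun x => ?_
  have e : ∀ y, {x : Fin n → Dir | crossOf (x a) (x b) = 0}.indicator (1 : (Fin n → Dir) → ℝ≥0∞)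
      (Function.update x b y) = {v | crossOf (x a) v = 0}.indicator 1 y := by
    intro y
    simp [Set.indicator, Function.update_of_ne hab]
  simp only [e]
  have hm2 : MeasurableSet {v | crossOf (x a) v = 0} :=
    (measurable_crossOf.comp (measurable_const.prodMk measurable_id)) (measurableSet_singleton 0)
  rw [lintegral_indicator_one hm2, poleLaw_crossOf_eq_zero]
  rfl

end Chernoff

/-! ### Typical configurations are likely -/

section TypicalSet

/-- For `|l| ≤ 1` the exponential is at most `1 + l + l²`, and for `l ≤ (κ - μ) / (2μ)` the
quadratic term uses at most half of the linear gain. -/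
lemma exists_upper_exponent {μ κ : ℝ} (hμ : 0 < μ) (hκ : μ < κ) :
    ∃ l γ : ℝ, 0 < l ∧ l ≤ 1 ∧ 0 < γ ∧ μ * (Real.exp l - 1) - l * κ ≤ -γ := by
  set l := min 1 ((κ - μ) / (2 * μ)) with hl
  have hl0 : 0 < l := lt_min one_pos (div_pos (by linarith) (by positivity))
  have hl1 : l ≤ 1 := min_le_left _ _
  have hl2 : l ≤ (κ - μ) / (2 * μ) := min_le_right _ _
  rw [le_div_iff₀ (by positivity)] at hl2
  refine ⟨l, l * (κ - μ) / 2, hl0, hl1,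
    div_pos (mul_pos hl0 (by linarith)) two_pos, ?_⟩
  have h1 := Real.abs_exp_sub_one_sub_id_le (x := l) (by rw [abs_of_pos hl0]; exact hl1)
  have h2 := (abs_le.1 h1).2
  have h3 : μ * (Real.exp l - 1) ≤ μ * (l + l ^ 2) := by gcongr; linarith
  nlinarith

lemma exists_lower_exponent {μ κ : ℝ} (hμ : 0 < μ) (hκ : κ < μ) :
    ∃ l γ : ℝ, 0 < l ∧ l ≤ 1 ∧ 0 < γ ∧ μ * (Real.exp (-l) - 1) + l * κ ≤ -γ := by
  set l := min 1 ((μ - κ) / (2 * μ)) with hl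
  have hl0 : 0 < l := lt_min one_pos (div_pos (by linarith) (by positivity))
  have hl1 : l ≤ 1 := min_le_left _ _
  have hl2 : l ≤ (μ - κ) / (2 * μ) := min_le_right _ _
  rw [le_div_iff₀ (by positivity)] at hl2
  refine ⟨l, l * (μ - κ) / 2, hl0, hl1,
    div_pos (mul_pos hl0 (by linarith)) two_pos, ?_⟩
  have h1 := Real.abs_exp_sub_one_sub_id_le (x := -l) (by rw [abs_neg, abs_of_pos hl0]; exact hl1)
  have h2 := (abs_le.1 h1).2
  have h3 : μ * (Real.exp (-l) - 1) ≤ μ * (-l + l ^ 2) := by gcongr; linarith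
  nlinarith

/-- Bounds for the expected number of great circles through a disk. -/
lemma mul_sin_bounds {μ μ' : ℝ} (hμ : 0 < μ) (hμ' : μ' < μ) {m : ℕ} (hm : μ < m) (hm1 : 2 ≤ m)
    (hm2 : (2 * μ + μ ^ 3 / 4) / (μ - μ') ≤ m) :
    0 < Real.sin (μ / m) ∧ ((m ^ 2 - 2 : ℕ) : ℝ) * Real.sin (μ / m) ≤ μ * m ∧
      μ' * m ≤ ((m ^ 2 - 2 : ℕ) : ℝ) * Real.sin (μ / m) := by
  have hm0 : (0 : ℝ) < m := by linarith
  have hx0 : 0 < μ / m := by positivity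
  have hx1 : μ / m ≤ 1 := (div_le_one hm0).2 hm.le
  have hsin : μ / m - (μ / m) ^ 3 / 4 ≤ Real.sin (μ / m) := by
    have := Real.sin_gt_sub_cube hx0
    have : 0 < (μ / m) ^ 3 := by positivity
    linarith
  have hsin0 : 0 < Real.sin (μ / m) :=
    Real.sin_pos_of_pos_of_lt_pi hx0 (by linarith [Real.pi_gt_three])
  have hcast : ((m ^ 2 - 2 : ℕ) : ℝ) = (m : ℝ) ^ 2 - 2 := by
    rw [Nat.cast_sub (by nlinarith)]; push_cast; ring
  have hm1' : (2 : ℝ) ≤ m := by exact_mod_cast hm1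
  refine ⟨hsin0, ?_, ?_⟩
  · calc ((m ^ 2 - 2 : ℕ) : ℝ) * Real.sin (μ / m) ≤ (m : ℝ) ^ 2 * (μ / m) := by
          rw [hcast]
          apply mul_le_mul _ (Real.sin_le hx0.le) hsin0.le (by positivity)
          linarith
      _ = μ * m := by field_simp
  · rw [div_le_iff₀ (by linarith)] at hm2
    have h1 : ((m : ℝ) ^ 2 - 2) * (μ / m - (μ / m) ^ 3 / 4)
        ≤ ((m ^ 2 - 2 : ℕ) : ℝ) * Real.sin (μ / m) := by
      rw [hcast]
      apply mul_le_mul_of_nonneg_left hsin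
      nlinarith
    refine le_trans ?_ h1
    have h2 : ((m : ℝ) ^ 2 - 2) * (μ / m - (μ / m) ^ 3 / 4)
        = μ * m - (2 * μ + μ ^ 3 / 4) / m + μ ^ 3 / (2 * m ^ 3) := by
      field_simp; ring
    have h3 : (2 * μ + μ ^ 3 / 4) / m ≤ (2 * μ + μ ^ 3 / 4) :=
      div_le_self (by positivity) (by linarith)
    have h4 : 0 ≤ μ ^ 3 / (2 * (m : ℝ) ^ 3) := by positivity
    rw [h2]
    nlinarith

lemma pi_beltCount_gt_le {n m : ℕ} {h μ κ l g : ℝ} (h0 : 0 < h) (h1 : h ≤ 1) (hl0 : 0 < l)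
    (hl1 : l ≤ 1) (hl : μ * (Real.exp l - 1) - l * κ ≤ -g)
    (hμ : ((n - 2 : ℕ) : ℝ) * h ≤ μ * m) {a b : Fin n} (hab : a ≠ b) :
    (Measure.pi fun _ => poleLaw) {x : Fin n → Dir | crossOf (x a) (x b) ≠ 0 ∧
      κ * m < (beltCount h x a b : ℝ)} ≤ ENNReal.ofReal (Real.exp 2 * Real.exp (-(g * m))) := by
  refine (pi_beltCount_le h0 h1 l (l * (κ * m - 2)) a b hab
    (fun k : ℕ => κ * m < (k : ℝ)) ?_).trans ?_
  · intro k k' _ hk hPk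
    have hk' : (k : ℝ) ≤ k' + 2 := by exact_mod_cast hk
    gcongr
    linarith
  · apply ENNReal.ofReal_le_ofReal
    rw [← Real.exp_add]
    apply Real.exp_le_exp.2
    have he : 0 ≤ Real.exp l - 1 := by linarith [Real.add_one_le_exp l]
    have h2 : ((n - 2 : ℕ) : ℝ) * (h * (Real.exp l - 1)) ≤ μ * m * (Real.exp l - 1) := by
      rw [← mul_assoc]
      exact mul_le_mul_of_nonneg_right hμ he
    have h3 : (μ * (Real.exp l - 1) - l * κ) * m ≤ -g * m := by gcongr
    linarith

lemma pi_beltCount_lt_le {n m : ℕ} {h μ κ l g : ℝ} (h0 : 0 < h) (h1 : h ≤ 1) (hl0 : 0 < l)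
    (hl : μ * (Real.exp (-l) - 1) + l * κ ≤ -g)
    (hμ : μ * m ≤ ((n - 2 : ℕ) : ℝ) * h) {a b : Fin n} (hab : a ≠ b) :
    (Measure.pi fun _ => poleLaw) {x : Fin n → Dir | crossOf (x a) (x b) ≠ 0 ∧
      (beltCount h x a b : ℝ) < κ * m} ≤ ENNReal.ofReal (Real.exp (-(g * m))) := by
  refine (pi_beltCount_le h0 h1 (-l) (-l * (κ * m)) a b hab
    (fun k : ℕ => (k : ℝ) < κ * m) ?_).trans ?_
  · intro k k' hk _ hPk
    have hk' : (k' : ℝ) ≤ k := by exact_mod_cast hk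
    have : l * k' ≤ l * (κ * m) := by gcongr; linarith
    linarith
  · apply ENNReal.ofReal_le_ofReal
    apply Real.exp_le_exp.2
    have he : Real.exp (-l) - 1 ≤ 0 := by
      have := Real.exp_le_one_iff.2 (show -l ≤ 0 by linarith)
      linarith
    have h2 : ((n - 2 : ℕ) : ℝ) * (h * (Real.exp (-l) - 1)) ≤ μ * m * (Real.exp (-l) - 1) := by
      rw [← mul_assoc]
      exact mul_le_mul_of_nonpos_right hμ he
    have h3 : (μ * (Real.exp (-l) - 1) + l * κ) * m ≤ -g * m := by gcongr
    linarith

lemma Config.crossVec_eq_crossOf {n : ℕ} (c : Config n) (i j : Fin n) :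
    c.crossVec i j = crossOf (c.1 (min i j)) (c.1 (max i j)) := rfl

lemma Config.passesThrough_iff {n m : ℕ} [NeZero m] (hnm : n = m ^ 2) (c : Config n) {Δ : ℝ}
    (hΔ : 0 < Δ) (hm : (2 + Δ) * (2 * Real.pi / m) < Real.pi / 2) {i j : Fin n}
    (hij : c.crossVec i j ≠ 0) (k : Fin n) :
    c.PassesThrough Δ k i j
      ↔ InBelt (Real.sin ((2 + Δ) * (2 * Real.pi / m))) c.1 (min i j) (max i j) k := by
  have hm0 : (0 : ℝ) < m := by exact_mod_cast NeZero.pos m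
  have hπ := Real.pi_pos
  unfold Config.PassesThrough
  simp only [geoDist_le_iff hnm]
  rw [exists_onGreatCircle_angle_le_iff _ (c.norm_z i j hij) (by positivity) hm, InBelt,
    ← c.crossVec_eq_crossOf]
  unfold Config.z
  split_ifs
  · rfl
  · rw [inner_neg_right, abs_neg]; rfl

/-- Parallel poles have probability zero. For each of at most `m ^ 4` ordered pairs of nodes a count
outside the bounds has probability exponentially small in `m`, so a union bound suffices. The lower
bound on the delay needs only a measurable set of typical configurations with mass bounded below. -/
theorem exists_typical_set {Δ κ₁ κ₂ : ℝ} (hΔ : 0 < Δ) (hκ₀ : 0 < κ₁)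
    (hκ₁ : κ₁ < 2 * Real.pi * (2 + Δ)) (hκ₂ : 2 * Real.pi * (2 + Δ) < κ₂) :
    ∃ M : ℕ, ∀ (n m : ℕ) [NeZero m], M ≤ m → n = m ^ 2 →
      ∃ A : Set (Config n), MeasurableSet A ∧ (∀ c ∈ A, c.Typical Δ κ₁ κ₂) ∧
        1 / 2 ≤ configLaw n A := by
  have hπ := Real.pi_pos
  set μ := 2 * Real.pi * (2 + Δ) with hμ
  have hμ0 : 0 < μ := by positivity
  -- The mean number of circles is slightly below `μ m`, because of the sine and of the two excluded
  -- nodes; the level `μ'` between `κ₁` and `μ` absorbs this loss.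
  set μ' := (κ₁ + μ) / 2 with hμ'
  obtain ⟨l, γ, hl0, hl1, hγ0, hl⟩ := exists_upper_exponent hμ0 hκ₂
  obtain ⟨l', γ', hl0', hl1', hγ0', hl'⟩ := exists_lower_exponent (μ := μ') (κ := κ₁)
    (by linarith) (by linarith)
  set g := min γ γ' with hg
  have hg0 : 0 < g := lt_min hγ0 hγ0'
  set K := Real.exp 2 + 1 with hK
  have hK0 : 0 < K := by positivity
  have hev : ∀ᶠ m : ℕ in atTop, (g * m) ^ 4 * Real.exp (-(g * m)) < g ^ 4 / (2 * K) := by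
    have h1 : Tendsto (fun m : ℕ => g * (m : ℝ)) atTop atTop :=
      tendsto_natCast_atTop_atTop.const_mul_atTop hg0
    exact ((Real.tendsto_pow_mul_exp_neg_atTop_nhds_zero 4).comp h1).eventually_lt_const
      (by positivity)
  have hev2 : ∀ᶠ m : ℕ in atTop, max (4 * μ) ((2 * μ + μ ^ 3 / 4) / (μ - μ')) < (m : ℝ) :=
    tendsto_natCast_atTop_atTop.eventually_gt_atTop _
  obtain ⟨M, hM⟩ := eventually_atTop.1 ((hev.and hev2).and (eventually_ge_atTop 2))
  refine ⟨M, fun n m _ hMm hnm => ?_⟩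
  obtain ⟨⟨hm1, hm2⟩, hm3⟩ := hM m hMm
  have hm0 : (0 : ℝ) < m := by exact_mod_cast NeZero.pos m
  have hm4 : 4 * μ < m := (le_max_left _ _).trans_lt hm2
  have hm5 : (2 * μ + μ ^ 3 / 4) / (μ - μ') ≤ m := ((le_max_right _ _).trans_lt hm2).le
  have hφ : (2 + Δ) * (2 * Real.pi / m) = μ / m := by rw [hμ]; ring
  set h := Real.sin (μ / m) with hh
  obtain ⟨hh0, hhu, hhl⟩ := mul_sin_bounds (μ := μ) (μ' := μ') hμ0 (by rw [hμ']; linarith)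
    (by linarith) hm3 hm5
  rw [← hh] at hh0
  rw [← hh, ← hnm] at hhu hhl
  have hh1 : h ≤ 1 := Real.sin_le_one _
  have hsq : √(n : ℝ) = m := by rw [hnm, Nat.cast_pow, Real.sqrt_sq (Nat.cast_nonneg m)]
  set A' : Set (Fin n → Dir) := {x | ∀ a b, a ≠ b → crossOf (x a) (x b) ≠ 0 ∧
    κ₁ * m ≤ (beltCount h x a b : ℝ) ∧ (beltCount h x a b : ℝ) ≤ κ₂ * m} with hA'
  have hA'm : MeasurableSet A' := by
    refine measurableSet_setOfPred.2 (Measurable.forall fun a => Measurable.forall fun b =>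
      Measurable.forall fun _ => measurableSet_setOfPred.1 ?_)
    have hb : Measurable fun x : Fin n → Dir => (beltCount h x a b : ℝ) :=
      (measurable_of_countable (fun k : ℕ => (k : ℝ))).comp (measurable_beltCount h a b)
    exact (measurableSet_crossOf_ne a b).inter ((measurableSet_le measurable_const hb).inter
      (measurableSet_le hb measurable_const))
  refine ⟨A' ×ˢ Set.univ, hA'm.prod MeasurableSet.univ, ?_, ?_⟩
  · classical
    rintro c ⟨hc, _⟩ i j hij
    have hne : min i j ≠ max i j := (min_lt_max.2 hij).ne
    obtain ⟨h1, h2, h3⟩ := hc (min i j) (max i j) hne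
    have h4 : ∀ k, c.PassesThrough Δ k i j ↔ InBelt h c.1 (min i j) (max i j) k := by
      intro k
      have := c.passesThrough_iff hnm hΔ (i := i) (j := j) (by
        rw [hφ, div_lt_iff₀ hm0]; nlinarith [Real.pi_gt_three]) h1 k
      rwa [hφ] at this
    have h5 : (Finset.univ.filter fun k => c.PassesThrough Δ k i j).card
        = beltCount h c.1 (min i j) (max i j) := by
      unfold beltCount
      congr 1
      ext k
      simp only [Finset.mem_filter, h4]
    rw [hsq, h5]
    exact ⟨h2, h3⟩
  · have hprod : configLaw n (A' ×ˢ Set.univ) = (Measure.pi fun _ => poleLaw) A' := by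
      rw [configLaw, Measure.prod_prod, measure_univ, mul_one]
    rw [hprod]
    set P := Measure.pi fun _ : Fin n => poleLaw with hP
    have hbad : P A'ᶜ ≤ ENNReal.ofReal (1 / 2) := by
      set U := fun q : Fin n × Fin n => {x : Fin n → Dir | crossOf (x q.1) (x q.2) ≠ 0 ∧
        κ₂ * m < (beltCount h x q.1 q.2 : ℝ)} with hU
      set L := fun q : Fin n × Fin n => {x : Fin n → Dir | crossOf (x q.1) (x q.2) ≠ 0 ∧
        (beltCount h x q.1 q.2 : ℝ) < κ₁ * m} with hL
      set Z := fun q : Fin n × Fin n => {x : Fin n → Dir | crossOf (x q.1) (x q.2) = 0} with hZ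
      set J := (Finset.univ : Finset (Fin n × Fin n)).filter fun q => q.1 ≠ q.2 with hJ
      have hsub : A'ᶜ ⊆ ⋃ q ∈ J, (Z q ∪ (U q ∪ L q)) := by
        intro x hx
        simp only [hA', Set.mem_compl_iff, Set.mem_ofPred_eq, not_forall] at hx
        obtain ⟨a, b, hab, hx⟩ := hx
        simp only [Set.mem_iUnion]
        refine ⟨(a, b), Finset.mem_filter.2 ⟨Finset.mem_univ _, hab⟩, ?_⟩
        by_cases h1 : crossOf (x a) (x b) = 0
        · exact Or.inl h1
        · right
          by_cases h2 : κ₁ * m ≤ (beltCount h x a b : ℝ)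
          · by_cases h3 : (beltCount h x a b : ℝ) ≤ κ₂ * m
            · exact (hx ⟨h1, h2, h3⟩).elim
            · exact Or.inl ⟨h1, not_le.1 h3⟩
          · exact Or.inr ⟨h1, not_le.1 h2⟩
      have hone : ∀ q ∈ J, P (Z q ∪ (U q ∪ L q)) ≤ ENNReal.ofReal (K * Real.exp (-(g * m))) := by
        intro q hq
        have hq' : q.1 ≠ q.2 := (Finset.mem_filter.1 hq).2
        have hz : P (Z q) = 0 := pi_crossOf_eq_zero q.1 q.2 hq'
        have hu : P (U q) ≤ ENNReal.ofReal (Real.exp 2 * Real.exp (-(g * m))) :=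
          pi_beltCount_gt_le hh0 hh1 hl0 hl1 (hl.trans (neg_le_neg (min_le_left _ _))) hhu hq'
        have hlo : P (L q) ≤ ENNReal.ofReal (Real.exp (-(g * m))) :=
          pi_beltCount_lt_le hh0 hh1 hl0' (hl'.trans (neg_le_neg (min_le_right _ _))) hhl hq'
        calc P (Z q ∪ (U q ∪ L q)) ≤ P (Z q) + (P (U q) + P (L q)) :=
              (measure_union_le _ _).trans (by gcongr; exact measure_union_le _ _)
          _ ≤ 0 + (ENNReal.ofReal (Real.exp 2 * Real.exp (-(g * m)))
              + ENNReal.ofReal (Real.exp (-(g * m)))) := by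
              gcongr
              exact hz.le
          _ = _ := by
              rw [zero_add, ← ENNReal.ofReal_add (by positivity) (by positivity), hK, add_mul,
                one_mul]
      have hcardI : (J.card : ℝ) ≤ (m : ℝ) ^ 4 := by
        have : J.card ≤ n * n := by
          refine (Finset.card_le_univ _).trans ?_
          simp
        calc (J.card : ℝ) ≤ ((n * n : ℕ) : ℝ) := by exact_mod_cast this
          _ = _ := by rw [hnm]; push_cast; ring
      calc P A'ᶜ ≤ ∑ q ∈ J, P (Z q ∪ (U q ∪ L q)) :=
            (measure_mono hsub).trans (measure_biUnion_finset_le _ _)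
        _ ≤ ∑ _q ∈ J, ENNReal.ofReal (K * Real.exp (-(g * m))) := Finset.sum_le_sum hone
        _ = ENNReal.ofReal (J.card * (K * Real.exp (-(g * m)))) := by
            rw [Finset.sum_const, nsmul_eq_mul, ENNReal.ofReal_mul (Nat.cast_nonneg J.card),
              ENNReal.ofReal_natCast]
        _ ≤ ENNReal.ofReal (1 / 2) := by
            apply ENNReal.ofReal_le_ofReal
            calc (J.card : ℝ) * (K * Real.exp (-(g * m)))
                ≤ (m : ℝ) ^ 4 * (K * Real.exp (-(g * m))) := by gcongr
              _ = K / g ^ 4 * ((g * m) ^ 4 * Real.exp (-(g * m))) := by field_simp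
              _ ≤ K / g ^ 4 * (g ^ 4 / (2 * K)) := by gcongr
              _ = 1 / 2 := by field_simp
    have h1 : P A' = 1 - P A'ᶜ := by
      rw [← prob_compl_eq_one_sub hA'm.compl, compl_compl]
    rw [h1]
    have e : ENNReal.ofReal (1 / 2) = 1 / 2 := by
      rw [ENNReal.ofReal_div_of_pos two_pos]; simp
    rw [e] at hbad
    calc (1 / 2 : ℝ≥0∞) = 1 - 1 / 2 := by simp
      _ ≤ 1 - P A'ᶜ := tsub_le_tsub_left hbad _

end TypicalSet

/-! ### Measurability in the configuration -/

section Measurability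

variable {n : ℕ}

lemma measurable_z (i j : Fin n) : Measurable fun c : Config n => c.z i j := by
  have h1 : Measurable fun c : Config n => c.crossVec i j :=
    (measurable_crossOf_apply (min i j) (max i j)).comp measurable_fst
  have h2 : Measurable fun c : Config n => c.crossDir i j := h1.norm.inv.smul h1
  have h3 : Measurable fun c : Config n => c.zCoin i j :=
    (measurable_pi_apply (max i j)).comp ((measurable_pi_apply (min i j)).comp
      (measurable_snd.comp measurable_snd))
  exact Measurable.ite (h3 (measurableSet_singleton true)) h2 h2.neg

lemma measurable_latticePoint {m : ℕ} {pl : Placement n} (hpl : pl.Valid) (v : Fin n) (a : ZMod m) :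
    Measurable fun c : Config n => latticePoint m pl c v a := by
  have h := (measurable_pi_apply v).comp hpl.measurable
  exact ((measurable_fst.comp h).const_smul (Real.cos (2 * Real.pi * a.val / m))).add
    ((measurable_snd.comp h).const_smul (Real.sin (2 * Real.pi * a.val / m)))

lemma measurable_geoDist {X : Type*} [MeasurableSpace X] {f g : X → E3} (hf : Measurable f)
    (hg : Measurable g) : Measurable fun x => geoDist (f x) (g x) :=
  (Real.continuous_arccos.measurable.comp ((hf.inner hg).div (hf.norm.mul hg.norm))).const_mul _

variable {m : ℕ} [NeZero m]

-- The chosen site is a fixed function of the set of minimizers, and whether a given site is a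
-- minimizer is a measurable condition on the configuration.
open Classical in
lemma measurable_nearestSite {pl : Placement n} (hpl : pl.Valid) (v w : Fin n) :
    Measurable fun c : Config n => nearestSite m pl c v (c.z v w) := by
  set φ : (ZMod m → Prop) → ZMod m := fun P => if h : ∃ a, P a then h.choose else 0 with hφ
  set P : Config n → ZMod m → Prop := fun c a => a ∈ Finset.univ ∧ ∀ a' ∈ Finset.univ,
    geoDist (latticePoint m pl c v a) (c.z v w) ≤ geoDist (latticePoint m pl c v a') (c.z v w)
    with hP
  have h1 : ∀ c, nearestSite m pl c v (c.z v w) = φ (P c) := by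
    intro c
    have hex : ∃ a, P c a := Finset.exists_min_image Finset.univ
      (fun a : ZMod m => geoDist (latticePoint m pl c v a) (c.z v w)) Finset.univ_nonempty
    simp only [hφ]
    rw [dif_pos hex]
    rfl
  simp only [h1]
  refine (measurable_of_countable φ).comp (measurable_pi_iff.2 fun a => ?_)
  have hd : ∀ a, Measurable fun c : Config n => geoDist (latticePoint m pl c v a) (c.z v w) :=
    fun a => measurable_geoDist (measurable_latticePoint hpl v a) (measurable_z v w)
  refine Measurable.and measurable_const (Measurable.forall fun a' => Measurable.forall fun _ => ?_)
  exact measurableSet_setOfPred.1 (measurableSet_le (hd a) (hd a'))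

/-- There are only countably many tables, so with the discrete structure joint measurability in
table and path reduces to measurability in the path for each table. -/
instance sitesMeasurableSpace (n m : ℕ) : MeasurableSpace (Sites n m) := ⊤

instance sitesDiscreteMeasurableSpace (n m : ℕ) : DiscreteMeasurableSpace (Sites n m) :=
  ⟨fun _ => trivial⟩

instance sitesCountable (n m : ℕ) [NeZero m] : Countable (Sites n m) := by
  refine Function.Injective.countable (f := fun N : Sites n m => (N.site, N.near)) ?_
  rintro ⟨a, b⟩ ⟨a', b'⟩ h
  simp only [Prod.mk.injEq] at h
  rw [h.1, h.2]

lemma measurable_sitesOf {pl : Placement n} (hpl : pl.Valid) (Δ : ℝ) :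
    Measurable fun c : Config n => sitesOf m Δ pl c := by
  refine measurable_to_countable' fun N => ?_
  have : (fun c : Config n => sitesOf m Δ pl c) ⁻¹' {N}
      = {c | (∀ v w, nearestSite m pl c v (c.z v w) = N.site v w) ∧ ∀ v w k b,
        (geoDist (latticePoint m pl c k b) (c.z v w) ≤ (2 + Δ) * √(Real.pi / n)
          ↔ b ∈ N.near v w k)} := by
    ext c
    simp only [Set.mem_preimage, Set.mem_singleton_iff, Set.mem_ofPred_eq]
    constructor
    · rintro rfl
      exact ⟨fun v w => rfl, fun v w k b => by simp [sitesOf]⟩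
    · rintro ⟨h1, h2⟩
      cases N
      simp only [sitesOf, Sites.mk.injEq]
      refine ⟨funext fun v => funext fun w => h1 v w, ?_⟩
      funext v w k
      ext b
      simpa using h2 v w k b
  rw [this]
  refine measurableSet_setOfPred.2 (Measurable.and ?_ ?_)
  · exact Measurable.forall fun v => Measurable.forall fun w => measurableSet_setOfPred.1
      (measurable_nearestSite hpl v w (measurableSet_singleton _))
  · refine Measurable.forall fun v => Measurable.forall fun w => Measurable.forall fun k =>
      Measurable.forall fun b => Measurable.iff ?_ measurable_const
    exact measurableSet_setOfPred.1 (measurableSet_le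
      (measurable_geoDist (measurable_latticePoint hpl k b) (measurable_z v w)) measurable_const)

end Measurability

/-! ### Lower bound -/

section Lower

variable {n m : ℕ} [NeZero m]

open Classical in
/-- The long-run share of the packets that are late, times `T`. -/
def lateMean (T : ℕ) (N : Sites n m) (s d : Fin n)
    (q : (Fin n → ZMod m) × (ℕ → Fin n → NodeCoins n)) : ℝ≥0∞ :=
  limsup (fun S => orbitMean (orbitShift move) (fun q =>
    if N.Late s d T q then (T : ℝ≥0∞) else 0) S q) atTop

open Classical in
lemma measurable_late_ite (T : ℕ) (N : Sites n m) (s d : Fin n) :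
    Measurable fun q : (Fin n → ZMod m) × (ℕ → Fin n → NodeCoins n) =>
      if N.Late s d T q then (T : ℝ≥0∞) else 0 :=
  Measurable.ite (N.measurableSet_late s d T) measurable_const measurable_const

lemma measurable_lateMean (T : ℕ) (N : Sites n m) (s d : Fin n) : Measurable (lateMean T N s d) :=
  measurable_limsup_orbitMean
    (measurePreserving_orbitShift_move (n := n) (m := m) 0 0).measurable
    (measurable_late_ite T N s d)

/-- By stationarity every orbit mean has the same integral, and all of them are bounded by `T`, so
the reverse Fatou lemma applies. -/
lemma le_lintegral_lateMean (T : ℕ) (N : Sites n m) (s d : Fin n) (p α : I) :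
    (T : ℝ≥0∞) * pathLaw n m p α {q | N.Late s d T q}
      ≤ ∫⁻ q, lateMean T N s d q ∂(pathLaw n m p α) := by
  classical
  have hmp := measurePreserving_orbitShift_move (n := n) (m := m) p α
  set f := fun q : (Fin n → ZMod m) × (ℕ → Fin n → NodeCoins n) =>
    if N.Late s d T q then (T : ℝ≥0∞) else 0 with hf
  have hfm : Measurable f := measurable_late_ite T N s d
  have hmass : ∫⁻ q, f q ∂(pathLaw n m p α) = (T : ℝ≥0∞) * pathLaw n m p α {q | N.Late s d T q} := by
    rw [← lintegral_indicator_const (N.measurableSet_late s d T)]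
    rfl
  have hmean : ∀ S : ℕ, 0 < S → ∫⁻ q, orbitMean (orbitShift move) f S q ∂(pathLaw n m p α)
      = (T : ℝ≥0∞) * pathLaw n m p α {q | N.Late s d T q} := by
    intro S hS
    have hcomp : ∀ i, Measurable fun q => f ((orbitShift move)^[i] q) := fun i =>
      hfm.comp (hmp.measurable.iterate i)
    unfold orbitMean
    simp only [div_eq_mul_inv]
    rw [lintegral_mul_const _ (measurable_orbitSum hmp.measurable hfm S),
      lintegral_finsetSum _ fun i _ => hcomp i]
    have : ∀ i, ∫⁻ q, f ((orbitShift move)^[i] q) ∂(pathLaw n m p α)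
        = ∫⁻ q, f q ∂(pathLaw n m p α) := fun i => (hmp.iterate i).lintegral_comp hfm
    simp only [this]
    rw [Finset.sum_const, Finset.card_range, nsmul_eq_mul, hmass, mul_right_comm,
      ENNReal.mul_inv_cancel (by exact_mod_cast hS.ne') (ENNReal.natCast_ne_top S), one_mul]
  have hlim : limsup (fun S : ℕ => ∫⁻ q, orbitMean (orbitShift move) f S q ∂(pathLaw n m p α)) atTop
      = (T : ℝ≥0∞) * pathLaw n m p α {q | N.Late s d T q} := by
    rw [limsup_congr ((eventually_gt_atTop 0).mono hmean), limsup_const]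
  rw [← hlim]
  refine limsup_lintegral_le (fun _ => (T : ℝ≥0∞))
    (fun S => (measurable_orbitSum hmp.measurable hfm S).div_const _) (fun S => ?_) ?_
  · refine Eventually.of_forall fun q => ?_
    refine ENNReal.div_le_of_le_mul ?_
    calc ∑ i ∈ Finset.range S, f ((orbitShift move)^[i] q)
        ≤ ∑ _i ∈ Finset.range S, (T : ℝ≥0∞) := Finset.sum_le_sum fun i _ => by
          simp only [hf]; split_ifs <;> simp
      _ = T * S := by rw [Finset.sum_const, Finset.card_range, nsmul_eq_mul, mul_comm]
  · simp

variable {Δ κ₁ κ₂ : ℝ} {pl : Placement n}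

lemma measurable_lateMean_uncurry (T : ℕ) : Measurable fun y : (Sites n m × Fin n × Fin n) ×
    ((Fin n → ZMod m) × (ℕ → Fin n → NodeCoins n)) => lateMean T y.1.1 y.1.2.1 y.1.2.2 y.2 :=
  measurable_from_prod_countable_right fun y => measurable_lateMean T y.1 y.2.1 y.2.2

lemma measurable_src (i : Fin (n / 2)) : Measurable fun c : Config n => c.src i := by
  have hperm : Measurable fun c : Config n => c.2.1 := measurable_fst.comp measurable_snd
  have h : Measurable fun τ : Equiv.Perm (Fin n) => τ ⟨2 * i, by have := i.2; omega⟩ :=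
    measurable_from_top
  exact h.comp hperm

lemma measurable_dst (i : Fin (n / 2)) : Measurable fun c : Config n => c.dst i := by
  have hperm : Measurable fun c : Config n => c.2.1 := measurable_fst.comp measurable_snd
  have h : Measurable fun τ : Equiv.Perm (Fin n) => τ ⟨2 * i + 1, by have := i.2; omega⟩ :=
    measurable_from_top
  exact h.comp hperm

lemma measurable_comp_prodMap_fst {X Y Z W : Type*} [MeasurableSpace X] [MeasurableSpace Y]
    [MeasurableSpace Z] [MeasurableSpace W] {g : Z × Y → W} (hg : Measurable g) {f : X → Z}
    (hf : Measurable f) : Measurable fun q : X × Y => g (f q.1, q.2) :=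
  hg.comp ((hf.comp measurable_fst).prodMk measurable_snd)

lemma measurable_lateMean_sitesOf (hpl : pl.Valid) (T : ℕ) (i : Fin (n / 2)) :
    Measurable fun ω : Outcome n m =>
      lateMean T (sitesOf m Δ pl ω.1) (ω.1.src i) (ω.1.dst i) ω.2 := by
  have h1 : Measurable fun c : Config n => (sitesOf m Δ pl c, c.src i, c.dst i) :=
    (measurable_sitesOf hpl Δ).prodMk ((measurable_src i).prodMk (measurable_dst i))
  have h2 := measurable_comp_prodMap_fst (measurable_lateMean_uncurry (n := n) (m := m) T) h1
  exact h2

lemma two_div_mul_card_eq {n : ℕ} (hn : Even n) (hn0 : 0 < n) (K : ℝ≥0∞) :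
    2 / (n : ℝ≥0∞) * ∑ _i : Fin (n / 2), K = K := by
  rw [Finset.sum_const, Finset.card_univ, Fintype.card_fin, nsmul_eq_mul]
  have h1 : 2 * ((n / 2 : ℕ) : ℝ≥0∞) = n := by exact_mod_cast Nat.two_mul_div_two_of_even hn
  have hn0 : (n : ℝ≥0∞) ≠ 0 := by exact_mod_cast hn0.ne'
  calc 2 / (n : ℝ≥0∞) * (((n / 2 : ℕ) : ℝ≥0∞) * K)
      = 2 * ((n / 2 : ℕ) : ℝ≥0∞) * (n : ℝ≥0∞)⁻¹ * K := by rw [div_eq_mul_inv]; ring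
    _ = n * (n : ℝ≥0∞)⁻¹ * K := by rw [h1]
    _ = K := by rw [ENNReal.mul_inv_cancel hn0 (ENNReal.natCast_ne_top n), one_mul]

lemma le_schemeDelay (hpl : pl.Valid) (hnm : n = m ^ 2) (hn : Even n) (hΔ : 0 < Δ)
    (hm : 4 * (2 + Δ) < m) (hκ : 0 < κ₁) (p α : I) {A : Set (Config n)} (hA : MeasurableSet A)
    (hAt : ∀ c ∈ A, c.Typical Δ κ₁ κ₂) (hA2 : 1 / 2 ≤ configLaw n A) (T : ℕ) {K : ℝ≥0∞}
    (hK : ∀ c ∈ A, ∀ i, K ≤ pathLaw n m p α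
      {q | (sitesOf m Δ pl c).Late (c.src i) (c.dst i) T q}) :
    T * K * (1 / 2) ≤ schemeDelay n m Δ κ₁ κ₂ p α pl := by
  have hn0 : 0 < n := by rw [hnm]; exact pow_pos (NeZero.pos m) 2
  set g : Outcome n m → ℝ≥0∞ := fun ω => 2 / (n : ℝ≥0∞) * ∑ i,
    lateMean T (sitesOf m Δ pl ω.1) (ω.1.src i) (ω.1.dst i) ω.2 with hg
  have hgm : Measurable g := (Finset.measurable_sum _ fun i _ =>
    measurable_lateMean_sitesOf hpl T i).const_mul _
  have hle : ∀ ω : Outcome n m, (Prod.fst ⁻¹' A).indicator g ω ≤ averageDelay Δ κ₁ κ₂ pl ω := by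
    intro ω
    by_cases hω : ω.1 ∈ A
    · rw [Set.indicator_of_mem (show ω ∈ Prod.fst ⁻¹' A from hω)]
      simp only [hg, averageDelay]
      gcongr with i
      exact le_pairDelay hpl hnm hΔ hm hκ (hAt _ hω) i ω.2 T
    · rw [Set.indicator_of_notMem (show ω ∉ Prod.fst ⁻¹' A from hω)]
      exact zero_le
  have hind : Measurable ((Prod.fst ⁻¹' A).indicator g) := hgm.indicator (measurable_fst hA)
  calc T * K * (1 / 2) ≤ T * K * configLaw n A := by gcongr
    _ = ∫⁻ c, A.indicator (fun _ => T * K) c ∂(configLaw n) :=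
        (lintegral_indicator_const hA _).symm
    _ ≤ ∫⁻ c, ∫⁻ q, (Prod.fst ⁻¹' A).indicator g ((c, q) : Outcome n m) ∂(pathLaw n m p α)
        ∂(configLaw n) := by
        refine lintegral_mono fun c => ?_
        by_cases hc : c ∈ A
        · rw [Set.indicator_of_mem hc]
          have e : ∀ q, (Prod.fst ⁻¹' A).indicator g ((c, q) : Outcome n m) = g (c, q) := fun q =>
            Set.indicator_of_mem (show ((c, q) : Outcome n m) ∈ Prod.fst ⁻¹' A from hc) g
          rw [lintegral_congr e]
          simp only [hg]
          rw [lintegral_const_mul _ (Finset.measurable_sum _ fun i _ => measurable_lateMean T _ _ _),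
            lintegral_finsetSum _ fun i _ => measurable_lateMean T _ _ _]
          rw [← two_div_mul_card_eq hn hn0 (T * K)]
          gcongr with i
          refine le_trans ?_ (le_lintegral_lateMean T _ _ _ p α)
          gcongr
          exact hK c hc i
        · rw [Set.indicator_of_notMem hc]; exact zero_le
    _ = ∫⁻ ω, (Prod.fst ⁻¹' A).indicator g ω ∂((configLaw n).prod (pathLaw n m p α)) :=
        (lintegral_prod _ hind.aemeasurable).symm
    _ ≤ schemeDelay n m Δ κ₁ κ₂ p α pl := lintegral_mono hle

end Lower

end

end GreatCircleNetwork

open GreatCircleNetwork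

theorem mainTheorem1 (Δ : ℝ) (hΔ : 0 < Δ) (p : unitInterval) (hp₀ : 0 < p) (hp₁ : p < 1)
    (κ₁ κ₂ : ℝ) (hκ₀ : 0 < κ₁) (hκ₁ : κ₁ < 2 * Real.pi * (2 + Δ))
    (hκ₂ : 2 * Real.pi * (2 + Δ) < κ₂) :
    ∃ α₀ : unitInterval, 0 < α₀ ∧ ∀ α : unitInterval, 0 < α → α < α₀ →
      ∃ c C : ℝ, 0 < c ∧ 0 < C ∧ ∃ N : ℕ,
        ∀ (n m : ℕ) [NeZero m], N < n → Even n → n = m ^ 2 →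
          ∀ pl : GreatCircleNetwork.Placement n, pl.Valid →
            ENNReal.ofReal (c * (n * Real.log n)) ≤
                GreatCircleNetwork.schemeDelay n m Δ κ₁ κ₂ p α pl ∧
              GreatCircleNetwork.schemeDelay n m Δ κ₁ κ₂ p α pl ≤
                ENNReal.ofReal (C * (n * Real.log n)) := by
  have hp0 : (0 : ℝ) < p := hp₀
  have hp1 : (p : ℝ) < 1 := hp₁
  have hp2 : 0 < 1 - (p : ℝ) := by linarith
  set B : ℝ := 4 * (2 + Δ) + 1 with hB
  set E := Real.exp (-(4 * B * κ₂)) with hE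
  have hE0 : 0 < E := Real.exp_pos _
  have hab0 : 0 < Sites.alphaBound p B κ₂ := by
    unfold Sites.alphaBound
    exact lt_min (by norm_num) (by positivity)
  have hab1 : Sites.alphaBound p B κ₂ ≤ 1 := by
    unfold Sites.alphaBound
    exact (min_le_left _ _).trans (by norm_num)
  -- Only the stability of the queues requires `α` to be small, so the threshold is that of
  -- `lintegral_busy_le`.
  refine ⟨⟨_, hab0.le, hab1⟩, hab0, fun α hα₀ hα => ?_⟩
  have hα0 : (0 : ℝ) < α := hα₀
  have hα1 : (α : ℝ) ≤ Sites.alphaBound p B κ₂ := le_of_lt hα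
  set e : ℝ := p * α * (1 - p) * E with he
  have he0 : 0 < e := by positivity
  obtain ⟨c, hc0, l₀, hscale⟩ := exists_late_scale (e / 8) (by positivity)
  obtain ⟨M, hM⟩ := exists_typical_set hΔ hκ₀ hκ₁ hκ₂
  have hsq : Tendsto (fun m : ℕ => ((m ^ 2 : ℕ) : ℝ)) atTop atTop :=
    tendsto_natCast_atTop_atTop.comp (tendsto_pow_atTop two_ne_zero)
  have hlog : Tendsto (fun m : ℕ => Real.log ((m ^ 2 : ℕ) : ℝ)) atTop atTop :=
    Real.tendsto_log_atTop.comp hsq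
  -- The network must be large enough for typical configurations to be likely, for the logarithmic
  -- horizons, for `c n log n ≥ 2`, and for `m ≥ 4 * B`. None of these thresholds involves the
  -- placement.
  obtain ⟨M', hM'⟩ := eventually_atTop.1 ((((eventually_ge_atTop M).and
    (hlog.eventually_ge_atTop (max 72 l₀))).and
    ((hsq.eventually_ge_atTop (2 / c)))).and
    (tendsto_natCast_atTop_atTop.eventually_ge_atTop (4 * B)))
  -- In the lower constant, `e / 16` is the probability that a packet is late, one factor `1/2` is
  -- the loss from rounding `T` down, and the other one is the probability of a typical
  -- configuration.
  refine ⟨e / 64 * c, 1 + 1 / (e / 128) * (1 + 1000000 / (p * (1 - p) * E)), by positivity,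
    by positivity, M' ^ 2, ?_⟩
  intro n m _ hNn hn hnm pl hpl
  have hmM : M' ≤ m := by
    rw [hnm] at hNn
    exact (lt_of_pow_lt_pow_left₀ 2 (Nat.zero_le m) hNn).le
  obtain ⟨⟨⟨h1, h2⟩, h3⟩, h4⟩ := hM' m hmM
  rw [← hnm] at h2 h3
  have h72 : 72 ≤ Real.log n := (le_max_left _ _).trans h2
  have hl₀ : l₀ ≤ Real.log n := (le_max_right _ _).trans h2
  have hm1 : 4 * (2 + Δ) < m := by linarith
  constructor
  · obtain ⟨A, hA, hAt, hA2⟩ := hM n m h1 hnm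
    obtain ⟨L, hL0, hL4, hL⟩ := hscale n m hnm hl₀
    set x : ℝ := c * (n * Real.log n) with hx
    have hn0 : (0 : ℝ) < n := lt_of_lt_of_le (by positivity) h3
    have hx2 : 2 ≤ x := by
      rw [div_le_iff₀ hc0] at h3
      have : c * n ≤ x := by
        rw [hx]
        have : (n : ℝ) * 1 ≤ n * Real.log n := by gcongr; linarith
        calc c * n = c * (n * 1) := by ring
          _ ≤ _ := by gcongr
      linarith
    set T := ⌊x⌋₊ with hT
    have hT1 : (T : ℝ) ≤ x := Nat.floor_le (by linarith)
    have hT2 : x / 2 ≤ T := by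
      have := Nat.lt_floor_add_one x
      rw [← hT] at this
      linarith
    have hn4 : 4 ≤ n := by
      have : (4 : ℝ) ≤ n := by
        have := Real.log_le_sub_one_of_pos hn0
        linarith
      exact_mod_cast this
    have hb : (1 + L / m + 6 * √L) / m + T * ((2 * L / m ^ 2 + 18 * (1 + Real.log L)) / L)
        ≤ e / 8 * (Real.log (L / 4) / 360) := by
      refine le_trans ?_ hL
      have : 0 ≤ Real.log L := Real.log_natCast_nonneg L
      gcongr
    have hK : ∀ c' ∈ A, ∀ i, ENNReal.ofReal (e / 16) ≤ pathLaw n m p α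
        {q | (sitesOf m Δ pl c').Late (c'.src i) (c'.dst i) T q} := fun c' hc' i =>
      Sites.pathLaw_late_ge _ (sitesOf_good hpl hnm hΔ hm1 hκ₀ (hAt c' hc')) h4 hnm hn4 p α _ _
        (c'.src_ne_dst i) L T hL0 hL4 hb
    refine le_trans ?_ (le_schemeDelay hpl hnm hn hΔ hm1 hκ₀ p α hA hAt hA2 T hK)
    have e2 : (1 / 2 : ENNReal) = ENNReal.ofReal (1 / 2) := by
      rw [ENNReal.ofReal_div_of_pos two_pos]; simp
    rw [e2, ← ENNReal.ofReal_natCast, ← ENNReal.ofReal_mul (by positivity),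
      ← ENNReal.ofReal_mul (by positivity)]
    apply ENNReal.ofReal_le_ofReal
    calc e / 64 * c * (n * Real.log n) = (x / 2) * (e / 16) * (1 / 2) := by rw [hx]; ring
      _ ≤ _ := by gcongr
  · exact schemeDelay_le hpl hnm hΔ h4 h72 hκ₀ p α hp₀ hp₁ hα₀ hα1
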